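/- **Setting.** Let $n_a,n_c,n\ge 0$ be integers. A switched autoregressive system with submodels $i\in\{1,\dots,n\}$ has parameter vectors $b_i=[-1,a_{1i},\dots,a_{n_a i},c_{1i},\dots,c_{n_c i}]^T$, a bounded deterministic input $(u_k)$ and an output satisfying, for $k\ge 1$, $$x_k=\sum_{j=1}^{n_a}a_{j\delta_k}x_{k-j}+\sum_{j=1}^{n_c}c_{j\delta_k}u_{k-j},\qquad\text{i.e. } b_{\delta_k}^Tr_k=0,\quad r_k=[x_k,\dots,x_{k-n_a},u_{k-1},\dots,u_{k-n_c}]^T .$$ There is a constant $L$ with $|x_k|\le L$ for all $k\ge1$ almost surely. The active submodel $(\delta_k)_{k\ge1}$ is a time-homogeneous Markov chain with transition matrix $P_{true}$ and arbitrary initial law. The measurements are $y_k=x_k+\sigma\xi_k$, where the $\xi_k$ are i.i.d. standard normal and independent of $(\delta,x)$, so that the noise variance is $\sigma^2$. Let $\nu$ be the Veronese map (all monomials of degree $n$ in the $n_a+n_c+1$ entries of the regressor) and $\hat r_k=[y_k,\dots,y_{k-n_a},u_{k-1},\dots,u_{k-n_c}]^T$. **Estimate.** Fix $\sigma_{\max}>0$,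 $\varepsilon>0$ and a snippet length $n_l\ge2$. From the data up to time $N$ compute $\hat P_N$ as follows, breaking ties arbitrarily. 1. For $t\ge 0$ let $\hat M_N(t)$ be the matrix $\frac1N\sum_{k=1}^N\nu(\hat r_k)\nu(\hat r_k)^T$ in which, in each monomial, every power $y_m^h$ of an output sample is replaced by $D_h$, where $D_h=y_m^h-\sum_{d=1}^h\binom hd D_{h-d}\,\mathbb E[(t\xi)^d]$ with $\xi\sim N(0,1)$. Let $\hat\sigma$ be the smallest minimizer over $t\in[0,\sigma_{\max}]$ of the minimum singular value of $\hat M_N(t)$, let $v$ be a unit singular vector of $\hat M_N(\hat\sigma)$ for that singular value, and $p(r)=v^T\nu(r)$. 2. (Polynomial differentiation.) For $i=1,\dots,n$ successively choose $k_i\in\{1,\dots,N\}$ minimizing $$\frac{|p(\hat r_k)|/\|\nabla p(\hat r_k)\|+\varepsilon}{\prod_{j<i}|g_j^T\hat r_k|+\varepsilon}$$ among the $k\in\{1,\dots,N\}$ with $\nabla p(\hat r_k)\ne0$, and put $g_i=\nabla p(\hat r_{k_i})/\|\nabla p(\hat r_{k_i})\|$. The estimated parameter vectors $\hat b_1,\dots,\hat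 b_n$ are the multiples of the $g_i$ with first entry $-1$. They are numbered so that $\sum_i\|\hat b_i-b_i\|^2$ is minimal. 3. For each snippet start $k=(n_a+1)+(n_a+n_l)l$, $l=0,1,\dots,\lfloor N/(n_a+n_l)\rfloor-(n_a+n_l+1)$, choose a switching sequence $(\hat\delta_k,\dots,\hat\delta_{k+n_l-1})$ that maximizes the likelihood $f(Z_k)$. Here $Z_k=[z_k(\hat\delta_k),\dots,z_{k+n_l-1}(\hat\delta_{k+n_l-1})]^T$ with $z_m(i)=-\hat b_i^T\hat r_m$, and $f$ is the centred multivariate normal density with the covariance matrix that $Z_k$ has for this switching sequence, coefficients $\hat b$ and i.i.d. measurement noise of variance $\hat\sigma^2$. 4. Let $n_{ij}$ be the total number of transitions from $i$ to $j$ inside the estimated snippet sequences. $\hat P_N$ maximizes $\prod_{i,j}P_{ij}^{n_{ij}}$ over the stochastic matrices $P$. **Theorem 1.** Assume that the switching chain is irreducible and aperiodic and that, almost surely, (i) $b_i^Tr_k\neq0$ for all $k\ge1$ and all $i\ne\delta_k$, so that the noise-free data at each time are explained only by the active submodel, and (ii) for some finite $N$ the null space of $\frac1N\sum_{k=1}^N\nu(r_k)\nu(r_k)^T$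 has dimension one. Then almost surely the limit $\lim_{\sigma^2\to0}\|\hat P_N-P_{true}\|$ exists for all sufficiently large $N$, and $$\lim_{N\to\infty}\ \lim_{\sigma^2\to0}\ \|\hat P_N-P_{true}\|=0 .$$ -/

import Mathlib

open MeasureTheory ProbabilityTheory Filter Topology
open scoped Matrix

namespace SwitchedAR

/-! ### Regressors, submodels and trajectories -/

/-- Index set of the regressor `[x_k, …, x_{k-na}, u_{k-1}, …, u_{k-nc}]`:
`inl j` is the slot of `x_{k-j}` for `0 ≤ j ≤ na`, `inr j` is the slot of `u_{k-1-j}`. -/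
abbrev RegIdx (na nc : ℕ) : Type := Fin (na + 1) ⊕ Fin nc

/-- The regressor at time `k` built from an output signal `y` and the input `u`. -/
def regressor (na nc : ℕ) (y u : ℤ → ℝ) (k : ℤ) : RegIdx na nc → ℝ :=
  Sum.elim (fun j => y (k - (j : ℕ))) (fun j => u (k - 1 - (j : ℕ)))

/-- The parameter vector `[-1, a_1, …, a_na, c_1, …, c_nc]` of a submodel. -/
def paramVec {na nc : ℕ} (a : Fin na → ℝ) (c : Fin nc → ℝ) : RegIdx na nc → ℝ :=
  Sum.elim (Fin.cons (-1) a) c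

/-- Noise-free switched autoregression: at every time `k ≥ 1`,
`x_k = ∑_{j=1}^{na} a_{j,δ_k} x_{k-j} + ∑_{j=1}^{nc} c_{j,δ_k} u_{k-j}`. -/
def IsTrajectory {na nc n : ℕ} (a : Fin n → Fin na → ℝ) (c : Fin n → Fin nc → ℝ)
    (u : ℤ → ℝ) (δ : ℕ → Fin n) (x : ℤ → ℝ) : Prop :=
  ∀ k : ℕ, 1 ≤ k →
    x k = ∑ j : Fin na, a (δ k) j * x ((k : ℤ) - 1 - (j : ℕ))
      + ∑ j : Fin nc, c (δ k) j * u ((k : ℤ) - 1 - (j : ℕ))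

/-! ### The switching chain -/

/-- `δ_1, δ_2, …` is a time-homogeneous Markov chain with transition matrix `P`
(and arbitrary initial law), expressed by its path probabilities. -/
def IsMarkovChain {Ω : Type*} [MeasurableSpace Ω] (μ : Measure Ω) {n : ℕ}
    (P : Matrix (Fin n) (Fin n) ℝ) (δ : ℕ → Ω → Fin n) : Prop :=
  ∀ (k : ℕ), 1 ≤ k → ∀ s : ℕ → Fin n,
    μ.real {ω | ∀ m ∈ Finset.Icc 1 (k + 1), δ m ω = s m}
      = μ.real {ω | ∀ m ∈ Finset.Icc 1 k, δ m ω = s m} * P (s k) (s (k + 1))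

/-- Every state has period one: the only common divisor of its possible return times is `1`. -/
def IsAperiodic {n : ℕ} (P : Matrix (Fin n) (Fin n) ℝ) : Prop :=
  ∀ i : Fin n, ∀ d : ℕ, (∀ t : ℕ, 0 < t → 0 < (P ^ t) i i → d ∣ t) → d = 1

/-! ### Moment matrices -/

/-- Exponent vectors of the monomials of degree `n` in the entries of the regressor. -/
abbrev MonIdx (na nc n : ℕ) : Type :=
  ↥(Finset.piAntidiag (Finset.univ : Finset (RegIdx na nc)) n)

/-- The Veronese map: all monomials of degree `n`. -/
def veronese {na nc n : ℕ} (r : RegIdx na nc → ℝ) (α : MonIdx na nc n) : ℝ :=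
  ∏ i, r i ^ α.1 i

/-- The noise-free matrix `(1/N) ∑_{k=1}^N ν(r_k) ν(r_k)ᵀ`. -/
noncomputable def momentMatrix (na nc n N : ℕ) (x u : ℤ → ℝ) :
    Matrix (MonIdx na nc n) (MonIdx na nc n) ℝ :=
  (1 / (N : ℝ)) • ∑ k ∈ Finset.Icc 1 N,
    Matrix.vecMulVec (veronese (regressor na nc x u k)) (veronese (regressor na nc x u k))

/-- The `d`-th moment of the centred normal law with standard deviation `σ`. -/
noncomputable def gaussMoment (σ : ℝ) (d : ℕ) : ℝ :=
  ∫ t, t ^ d ∂(gaussianReal 0 (Real.toNNReal (σ ^ 2)))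

/-- The unbiased surrogate for `x ^ h` computed from `y = x + η`, `η ~ N(0, σ²)`:
`D_h = y ^ h - ∑_{d=1}^h (h choose d) D_{h-d} m_d`. -/
noncomputable def denoisedPow (σ y : ℝ) : ℕ → ℝ
  | h => y ^ h - ∑ d : Fin h,
      (h.choose ((d : ℕ) + 1) : ℝ) * denoisedPow σ y (h - ((d : ℕ) + 1))
        * gaussMoment σ ((d : ℕ) + 1)
  decreasing_by
    have := d.2
    omega

/-- The matrix estimated from noisy outputs, as a function of the noise level `σ`: in every
monomial of `ν(r_k) ν(r_k)ᵀ` the power of each output sample is replaced by its surrogate. -/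
noncomputable def noisyMomentMatrix (na nc n N : ℕ) (y u : ℤ → ℝ) (σ : ℝ) :
    Matrix (MonIdx na nc n) (MonIdx na nc n) ℝ :=
  Matrix.of fun α β => (1 / (N : ℝ)) * ∑ k ∈ Finset.Icc 1 N,
    (∏ j : Fin (na + 1),
        denoisedPow σ (y ((k : ℤ) - (j : ℕ))) (α.1 (Sum.inl j) + β.1 (Sum.inl j)))
      * ∏ j : Fin nc, u ((k : ℤ) - 1 - (j : ℕ)) ^ (α.1 (Sum.inr j) + β.1 (Sum.inr j))

/-! ### Estimation of the noise level and of the coefficients -/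

/-- Smallest singular value of a square matrix (singular values are listed in decreasing order). -/
noncomputable def minSingularValue {m : Type*} [Fintype m] [DecidableEq m]
    (A : Matrix m m ℝ) : ℝ :=
  (Matrix.toEuclideanLin A).singularValues (Fintype.card m - 1)

/-- `c` is a unit (right) singular vector of `A` for its smallest singular value. -/
def IsMinSingularVector {m : Type*} [Fintype m] [DecidableEq m]
    (A : Matrix m m ℝ) (c : m → ℝ) : Prop :=
  c ⬝ᵥ c = 1 ∧ (Aᵀ * A) *ᵥ c = minSingularValue A ^ 2 • c

/-- `s` is the smallest minimizer over `[0, σmax]` of the minimum singular value of the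
estimated matrix. -/
def IsNoiseLevelEstimate (na nc n N : ℕ) (σmax : ℝ) (y u : ℤ → ℝ) (s : ℝ) : Prop :=
  IsLeast {t | t ∈ Set.Icc 0 σmax ∧ IsMinOn
    (fun t => minSingularValue (noisyMomentMatrix na nc n N y u t)) (Set.Icc 0 σmax) t} s

/-- The homogeneous polynomial `r ↦ cᵀ ν(r)`. -/
noncomputable def veroneseForm {na nc n : ℕ} (c : MonIdx na nc n → ℝ) :
    MvPolynomial (RegIdx na nc) ℝ :=
  ∑ α, MvPolynomial.monomial (Finsupp.equivFunOnFinite.symm α.1) (c α)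

/-- Gradient of a polynomial at a point. -/
noncomputable def polyGrad {ι : Type*} (p : MvPolynomial ι ℝ) (r : ι → ℝ) : ι → ℝ :=
  fun i => MvPolynomial.eval r (MvPolynomial.pderiv i p)

/-- Euclidean norm of a vector. -/
noncomputable def euclNorm {ι : Type*} [Fintype ι] (v : ι → ℝ) : ℝ := Real.sqrt (v ⬝ᵥ v)

/-- The quantity minimized over the data points `r` in one step of the polynomial
differentiation algorithm, after the normals `g j`, `j < i`, have been found. -/
noncomputable def pdaObjective {ι : Type*} [Fintype ι] {n : ℕ} (ε : ℝ) (p : MvPolynomial ι ℝ)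
    (g : Fin n → ι → ℝ) (i : Fin n) (r : ι → ℝ) : ℝ :=
  (|MvPolynomial.eval r p| / euclNorm (polyGrad p r) + ε)
    / (∏ j ∈ Finset.univ.filter (fun j => j < i), |g j ⬝ᵥ r| + ε)

/-- `g` is a result of the polynomial differentiation algorithm for a mixture of `n` hyperplanes
with data points `r 1, …, r N`, defining polynomial `p` and tuning constant `ε`: the normals are
found one after the other, each as the normalized gradient of `p` at a data point that minimizes
the objective among the points with nonzero gradient. -/
def IsPDAOutput {ι : Type*} [Fintype ι] {n : ℕ} (ε : ℝ) (p : MvPolynomial ι ℝ) (N : ℕ)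
    (r : ℕ → ι → ℝ) (g : Fin n → ι → ℝ) : Prop :=
  ∀ i, ∃ k ∈ Finset.Icc 1 N, polyGrad p (r k) ≠ 0 ∧
    (∀ k' ∈ Finset.Icc 1 N, polyGrad p (r k') ≠ 0 →
      pdaObjective ε p g i (r k) ≤ pdaObjective ε p g i (r k')) ∧
    g i = (euclNorm (polyGrad p (r k)))⁻¹ • polyGrad p (r k)

/-- `b` is the family of estimated parameter vectors: the normals obtained from the singular vector
`v` by the polynomial differentiation algorithm, in some numbering `π`, scaled so that the
coefficient of `x_k` is `-1`. -/
def IsCoefficientEstimate {na nc n : ℕ} (ε : ℝ) (N : ℕ) (y u : ℤ → ℝ) (v : MonIdx na nc n → ℝ)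
    (b : Fin n → RegIdx na nc → ℝ) : Prop :=
  ∃ (g : Fin n → RegIdx na nc → ℝ) (π : Equiv.Perm (Fin n)),
    IsPDAOutput ε (veroneseForm v) N (fun k => regressor na nc y u k) g ∧
    ∀ i, b i (Sum.inl 0) = -1 ∧ ∃ t : ℝ, b i = t • g (π i)

/-! ### Maximum likelihood switches in the snippets -/

/-- First time index of snippet number `l`. -/
def snippetStart (na nl l : ℕ) : ℕ := (na + 1) + (na + nl) * l

/-- Number of snippets, `l = 0, …, int (N / (na + nl)) - (na + nl + 1)`. -/
def snippetCount (na nl N : ℕ) : ℕ := N / (na + nl) - (na + nl)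

/-- The vector `Z = [z_k(s_0), …, z_{k+nl-1}(s_{nl-1})]` for the switching sequence `s`, where
`z_k(i) = y_k - ∑ a_{j,i} y_{k-j} - ∑ c_{j,i} u_{k-j} = - b_iᵀ r_k`. -/
def snippetResidual {na nc n nl : ℕ} (b : Fin n → RegIdx na nc → ℝ) (y u : ℤ → ℝ) (k : ℕ)
    (s : Fin nl → Fin n) : Fin nl → ℝ :=
  fun t => -(b (s t) ⬝ᵥ regressor na nc y u ((k : ℤ) + (t : ℕ)))

/-- Covariance matrix of the vector with entries `η_{k+t} - ∑_{j=1}^{na} a_{j,s_t} η_{k+t-j}`,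
`0 ≤ t < nl`, for independent `η` of standard deviation `σ`. -/
def snippetCov {na nc n nl : ℕ} (b : Fin n → RegIdx na nc → ℝ) (σ : ℝ)
    (s : Fin nl → Fin n) : Matrix (Fin nl) (Fin nl) ℝ :=
  Matrix.of fun t t' => σ ^ 2 * ∑ j : Fin (na + 1), ∑ j' : Fin (na + 1),
    if (t : ℕ) + (j' : ℕ) = (t' : ℕ) + (j : ℕ) then
      b (s t) (Sum.inl j) * b (s t') (Sum.inl j') else 0

/-- Density at `z` of the centred multivariate normal law with covariance matrix `S`. -/
noncomputable def normalDensity {m : ℕ} (S : Matrix (Fin m) (Fin m) ℝ) (z : Fin m → ℝ) : ℝ :=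
  (Real.sqrt ((2 * Real.pi) ^ m * S.det))⁻¹ * Real.exp (-(1 / 2) * (z ⬝ᵥ (S⁻¹ *ᵥ z)))

/-- `s` is a maximum likelihood switching sequence for the snippet that starts at time `k`. -/
def IsMLSwitching {na nc n nl : ℕ} (b : Fin n → RegIdx na nc → ℝ) (σ : ℝ) (y u : ℤ → ℝ) (k : ℕ)
    (s : Fin nl → Fin n) : Prop :=
  ∀ s' : Fin nl → Fin n,
    normalDensity (snippetCov b σ s') (snippetResidual b y u k s')
      ≤ normalDensity (snippetCov b σ s) (snippetResidual b y u k s)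

/-- Number of transitions from `i` to `j` within the first `K` snippets, when `s l` is the
switching sequence of snippet `l`. -/
def transitionCount {n nl : ℕ} (K : ℕ) (s : ℕ → Fin nl → Fin n) (i j : Fin n) : ℕ :=
  ∑ l ∈ Finset.range K,
    (Finset.univ.filter fun p : Fin nl × Fin nl =>
      (p.1 : ℕ) + 1 = (p.2 : ℕ) ∧ s l p.1 = i ∧ s l p.2 = j).card

/-- `Q` maximizes `∏ Q_ij ^ m_ij` over the stochastic matrices. -/
def IsTransitionMLE {n : ℕ} (m : Fin n → Fin n → ℕ) (Q : Matrix (Fin n) (Fin n) ℝ) : Prop :=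
  Q ∈ Matrix.rowStochastic ℝ (Fin n) ∧
    ∀ Q' ∈ Matrix.rowStochastic ℝ (Fin n),
      ∏ i, ∏ j, Q' i j ^ m i j ≤ ∏ i, ∏ j, Q i j ^ m i j

/-! ### The complete identification procedure -/

/-- `(b, Q)` is a possible result (coefficients and transition matrix) of the whole identification
procedure, run on the outputs `y` and inputs `u` up to time `N`. -/
def IsEstimate {na nc n : ℕ} (nl N : ℕ) (σmax ε : ℝ) (y u : ℤ → ℝ)
    (b : Fin n → RegIdx na nc → ℝ) (Q : Matrix (Fin n) (Fin n) ℝ) : Prop :=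
  ∃ (s : ℝ) (v : MonIdx na nc n → ℝ) (d : ℕ → Fin nl → Fin n),
    IsNoiseLevelEstimate na nc n N σmax y u s ∧
    IsMinSingularVector (noisyMomentMatrix na nc n N y u s) v ∧
    IsCoefficientEstimate ε N y u v b ∧
    (∀ l < snippetCount na nl N, IsMLSwitching b s y u (snippetStart na nl l) (d l)) ∧
    IsTransitionMLE (transitionCount (snippetCount na nl N) d) Q

/-- The estimated submodels `b'` are numbered like the true ones `b`: no renumbering brings them
closer to `b`. -/
def IsNumberedLike {na nc n : ℕ} (b b' : Fin n → RegIdx na nc → ℝ) : Prop :=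
  ∀ π : Equiv.Perm (Fin n), ∑ i, euclNorm (b' i - b i) ^ 2 ≤ ∑ i, euclNorm (b' (π i) - b i) ^ 2

/-- Frobenius norm of a real square matrix. -/
noncomputable def frobNorm {n : ℕ} (A : Matrix (Fin n) (Fin n) ℝ) : ℝ :=
  Real.sqrt (∑ i, ∑ j, A i j ^ 2)

end SwitchedAR

namespace SwitchedAR

/-! Fix a sample path outside a null set and a large `N`, and let the noise level `σ` tend to `0`.
The point is that for all small `σ` the estimated snippet sequences are exactly the true ones. The
estimate is then the matrix of relative transition frequencies of the true chain inside the
snippets. It no longer depends on `σ`, and the outer limit becomes a law of large numbers.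

The denoised moment matrix is jointly continuous in `σ` and the candidate noise level `t`, and at
`(0, 0)` it is the noise-free moment matrix, whose kernel is spanned by the coefficient vector
`prodCoeff b` of the product of the forms `b i ⬝ᵥ r`. In this direction and at `σ = 0` the quadratic
form behaves like `-G t² / N` with `G > 0`, because denoising subtracts half the Laplacian of the
square of the product (`eventually_noisyMomentMatrix_neg`). At `t = 0` the matrix is positive
semidefinite for every `σ`. So for small `σ` it becomes singular at a small `t`
(`exists_det_eq_zero_of_path`). Hence the estimated noise level tends to `0`, and the singular
vector tends to a nonzero multiple of `prodCoeff b` up to the choice of a limit point.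

At a data point the gradient of the product is a nonzero multiple of the active parameter vector, so
polynomial differentiation recovers all submodels (`IsPDAOutput.exists_tendsto`). A wrong switching
sequence keeps a nonzero residual, and its likelihood loses exponentially to that of the true one as
the estimated variance vanishes (`IsMLSwitching.residual_eq_zero`). This comparison needs a positive
estimated noise level. Positivity holds almost surely because the determinant of the noisy moment
matrix is a nonzero polynomial in the Gaussian noise (`ae_eventually_det_ne_zero`).

For the chain, the centred transitions out of an arithmetic progression of times are bounded and
orthogonal, so their averages vanish almost surely. Irreducibility and aperiodicity give every state
positive lower density along the snippet starts, so the row totals grow linearly. -/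

/-! ### Singular matrices and the minimum singular value. -/

lemma minSingularValue_nonneg {m : Type*} [Fintype m] [DecidableEq m] (A : Matrix m m ℝ) :
    0 ≤ minSingularValue A :=
  LinearMap.singularValues_nonneg _ _

/-- Both sides say that the rank is less than the size. `Nonempty m` matters: for an empty index
type `Fintype.card m - 1` truncates to `0`, where the singular value is `0` although the determinant
is `1`. -/
lemma minSingularValue_eq_zero_iff {m : Type*} [Fintype m] [DecidableEq m] [Nonempty m]
    (A : Matrix m m ℝ) : minSingularValue A = 0 ↔ A.det = 0 := by
  have hc : 0 < Fintype.card m := Fintype.card_pos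
  rw [minSingularValue, LinearMap.singularValues_eq_zero_iff_le_finrank_range]
  have hr : Module.finrank ℝ (Matrix.toEuclideanLin A).range
      + Module.finrank ℝ (Matrix.toEuclideanLin A).ker = Fintype.card m := by
    rw [LinearMap.finrank_range_add_finrank_ker, finrank_euclideanSpace]
  rw [← Matrix.exists_mulVec_eq_zero_iff]
  constructor
  · intro h
    have hk : 0 < Module.finrank ℝ (Matrix.toEuclideanLin A).ker := by omega
    rw [Module.finrank_pos_iff_exists_ne_zero] at hk
    obtain ⟨⟨w, hw⟩, hne⟩ := hk
    refine ⟨WithLp.ofLp w, ?_, ?_⟩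
    · intro h0
      apply hne
      ext i
      exact congrFun h0 i
    · rw [LinearMap.mem_ker] at hw
      have := congrArg WithLp.ofLp hw
      simpa using this
  · rintro ⟨w, hw, hAw⟩
    have hk : 0 < Module.finrank ℝ (Matrix.toEuclideanLin A).ker := by
      rw [Module.finrank_pos_iff_exists_ne_zero]
      refine ⟨⟨WithLp.toLp 2 w, ?_⟩, ?_⟩
      · rw [LinearMap.mem_ker]
        ext i
        simpa using congrFun hAw i
      · intro h0
        apply hw
        have := congrArg (fun z => WithLp.ofLp z.1) h0
        simpa using this
    omega

lemma IsMinSingularVector.mulVec_eq_zero {m : Type*} [Fintype m] [DecidableEq m]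
    {A : Matrix m m ℝ} {v : m → ℝ} (h : IsMinSingularVector A v) (hA : minSingularValue A = 0) :
    A *ᵥ v = 0 := by
  have h2 := h.2
  rw [hA] at h2
  have h3 : (A *ᵥ v) ⬝ᵥ (A *ᵥ v) = 0 := by
    rw [Matrix.dotProduct_mulVec, ← Matrix.mulVec_transpose, Matrix.mulVec_mulVec, h2]
    simp
  exact dotProduct_self_eq_zero.1 h3

lemma exists_isMinSingularVector {m : Type*} [Fintype m] [DecidableEq m] [Nonempty m]
    {A : Matrix m m ℝ} (hA : A.det = 0) : ∃ v, IsMinSingularVector A v := by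
  obtain ⟨w, hw, hAw⟩ := Matrix.exists_mulVec_eq_zero_iff.2 hA
  have hpos : 0 < w ⬝ᵥ w := by
    have h0 : 0 ≤ w ⬝ᵥ w := Finset.sum_nonneg fun i _ => mul_self_nonneg _
    exact lt_of_le_of_ne h0 fun h => hw (dotProduct_self_eq_zero.1 h.symm)
  refine ⟨(Real.sqrt (w ⬝ᵥ w))⁻¹ • w, ?_, ?_⟩
  · rw [smul_dotProduct, dotProduct_smul, smul_eq_mul, smul_eq_mul, ← mul_assoc, ← mul_inv,
      Real.mul_self_sqrt hpos.le, inv_mul_cancel₀ hpos.ne']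
  · rw [(minSingularValue_eq_zero_iff A).2 hA, Matrix.mulVec_smul, ← Matrix.mulVec_mulVec, hAw]
    simp

lemma continuous_sphere_inf {m : Type*} [Fintype m] (M : ℝ → Matrix m m ℝ) (hM : Continuous M)
    (K : Set (m → ℝ)) (hK : IsCompact K) :
    Continuous fun t => sInf ((fun v => v ⬝ᵥ (M t *ᵥ v)) '' K) := by
  apply IsCompact.continuous_sInf hK (f := fun t v => v ⬝ᵥ (M t *ᵥ v))
  have : Continuous fun p : ℝ × (m → ℝ) => p.2 ⬝ᵥ (M p.1 *ᵥ p.2) :=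
    continuous_snd.dotProduct ((hM.comp continuous_fst).matrix_mulVec continuous_snd)
  exact this

lemma isCompact_unit_vectors {m : Type*} [Fintype m] : IsCompact {v : m → ℝ | v ⬝ᵥ v = 1} := by
  apply Metric.isCompact_of_isClosed_isBounded
  · exact isClosed_eq (continuous_id.dotProduct continuous_id) continuous_const
  · refine (Metric.isBounded_closedBall (x := (0 : m → ℝ)) (r := 1)).subset ?_
    intro v hv
    rw [mem_closedBall_zero_iff, pi_norm_le_iff_of_nonneg zero_le_one]
    intro i
    have h1 : v i * v i ≤ v ⬝ᵥ v :=
      Finset.single_le_sum (f := fun i => v i * v i) (fun j _ => mul_self_nonneg _)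
        (Finset.mem_univ i)
    rw [Set.mem_ofPred_eq] at hv
    rw [hv] at h1
    rw [Real.norm_eq_abs, abs_le]
    constructor <;> nlinarith

/-- A continuous path of symmetric matrices from a positive semidefinite one to one that takes a
negative value meets a singular matrix. -/
lemma exists_det_eq_zero_of_path {m : Type*} [Fintype m] [DecidableEq m]
    (M : ℝ → Matrix m m ℝ) (hM : Continuous M) (hsymm : ∀ t, (M t).IsHermitian) (T : ℝ)
    (hT : 0 ≤ T) (h0 : (M 0).PosSemidef) (w : m → ℝ) (hw : w ⬝ᵥ (M T *ᵥ w) < 0) :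
    ∃ t ∈ Set.Icc 0 T, (M t).det = 0 := by
  set K : Set (m → ℝ) := {v | v ⬝ᵥ v = 1} with hK
  -- The minimum of the quadratic form on the unit sphere is continuous in `t` and changes sign
  -- between `0` and `T`.
  set f : ℝ → ℝ := fun t => sInf ((fun v => v ⬝ᵥ (M t *ᵥ v)) '' K) with hf
  have hcont : Continuous f := continuous_sphere_inf M hM K isCompact_unit_vectors
  have hcompact : ∀ t, IsCompact ((fun v => v ⬝ᵥ (M t *ᵥ v)) '' K) := fun t =>
    isCompact_unit_vectors.image
      (continuous_id.dotProduct (continuous_const.matrix_mulVec continuous_id))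
  have hw0 : w ≠ 0 := by
    rintro rfl
    simp at hw
  have hpos : 0 < w ⬝ᵥ w := by
    have h0 : 0 ≤ w ⬝ᵥ w := Finset.sum_nonneg fun i _ => mul_self_nonneg _
    exact lt_of_le_of_ne h0 fun h => hw0 (dotProduct_self_eq_zero.1 h.symm)
  have hunit : (Real.sqrt (w ⬝ᵥ w))⁻¹ • w ∈ K := by
    rw [hK, Set.mem_ofPred_eq, smul_dotProduct, dotProduct_smul, smul_eq_mul, smul_eq_mul,
      ← mul_assoc, ← mul_inv, Real.mul_self_sqrt hpos.le, inv_mul_cancel₀ hpos.ne']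
  have hne : K.Nonempty := ⟨_, hunit⟩
  have hf0 : 0 ≤ f 0 := by
    apply Real.sInf_nonneg
    rintro _ ⟨v, -, rfl⟩
    simpa using h0.dotProduct_mulVec_nonneg v
  have hfT : f T ≤ 0 := by
    refine (csInf_le (hcompact T).bddBelow ⟨_, hunit, rfl⟩).trans ?_
    simp only [Matrix.mulVec_smul, smul_dotProduct, dotProduct_smul, smul_eq_mul]
    have : 0 ≤ (Real.sqrt (w ⬝ᵥ w))⁻¹ := by positivity
    nlinarith [mul_nonneg this this]
  obtain ⟨t, ht, hft⟩ := intermediate_value_Icc' hT hcont.continuousOn ⟨hfT, hf0⟩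
  refine ⟨t, ht, ?_⟩
  obtain ⟨v, hvK, hv⟩ := (hcompact t).sInf_mem (hne.image _)
  have hv' : v ⬝ᵥ (M t *ᵥ v) = 0 := hv.trans hft
  -- At a zero of `f` the form is nonnegative, first on the sphere and then by scaling everywhere. A
  -- null vector of a positive semidefinite form lies in the kernel.
  have hpsd : (M t).PosSemidef := by
    refine Matrix.PosSemidef.of_dotProduct_mulVec_nonneg (hsymm t) fun z => ?_
    rcases eq_or_ne z 0 with rfl | hz
    · simp
    have hzpos : 0 < z ⬝ᵥ z := by
      have h0 : 0 ≤ z ⬝ᵥ z := Finset.sum_nonneg fun i _ => mul_self_nonneg _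
      exact lt_of_le_of_ne h0 fun h => hz (dotProduct_self_eq_zero.1 h.symm)
    have hzK : (Real.sqrt (z ⬝ᵥ z))⁻¹ • z ∈ K := by
      rw [hK, Set.mem_ofPred_eq, smul_dotProduct, dotProduct_smul, smul_eq_mul, smul_eq_mul,
        ← mul_assoc, ← mul_inv, Real.mul_self_sqrt hzpos.le, inv_mul_cancel₀ hzpos.ne']
    have h1 : f t ≤ _ := csInf_le (hcompact t).bddBelow ⟨_, hzK, rfl⟩
    rw [hft] at h1
    simp only [Matrix.mulVec_smul, smul_dotProduct, dotProduct_smul, smul_eq_mul] at h1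
    have h2 : 0 < (Real.sqrt (z ⬝ᵥ z))⁻¹ := by positivity
    rw [← mul_assoc] at h1
    simpa using nonneg_of_mul_nonneg_right h1 (mul_pos h2 h2)
  rw [← Matrix.exists_mulVec_eq_zero_iff]
  refine ⟨v, ?_, ?_⟩
  · rintro rfl
    simp [hK] at hvK
  · exact (hpsd.dotProduct_mulVec_zero_iff v).1 (by simpa using hv')

/-! ### Gaussian moments and denoised powers. -/

lemma gaussMoment_eq (t : ℝ) (d : ℕ) : gaussMoment t d = t ^ d * gaussMoment 1 d := by
  have h : gaussianReal 0 (Real.toNNReal (t ^ 2)) = (gaussianReal 0 1).map (t * ·) := by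
    rw [gaussianReal_map_const_mul]
    congr 1
    · simp
    · ext
      simp [Real.coe_toNNReal _ (sq_nonneg t)]
  have h1 : gaussianReal 0 (Real.toNNReal ((1 : ℝ) ^ 2)) = gaussianReal 0 1 := by simp
  rw [gaussMoment, gaussMoment, h, h1, integral_map (by fun_prop) (by fun_prop)]
  simp_rw [mul_pow]
  rw [integral_const_mul]

lemma gaussMoment_one_one : gaussMoment 1 1 = 0 := by
  simp [gaussMoment]

lemma gaussMoment_one_two : gaussMoment 1 2 = 1 := by
  have h := variance_fun_id_gaussianReal (μ := 0) (v := 1)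
  rw [variance_eq_integral (by fun_prop)] at h
  simpa [gaussMoment] using h

lemma denoisedPow_eq (σ y : ℝ) (h : ℕ) :
    denoisedPow σ y h = y ^ h - ∑ d : Fin h,
      (h.choose ((d : ℕ) + 1) : ℝ) * denoisedPow σ y (h - ((d : ℕ) + 1))
        * gaussMoment σ ((d : ℕ) + 1) := by
  rw [denoisedPow]

lemma continuous_denoisedPow (h : ℕ) : Continuous fun p : ℝ × ℝ => denoisedPow p.1 p.2 h := by
  induction h using Nat.strong_induction_on with
  | _ h ih =>
    simp_rw [denoisedPow_eq _ _ h, fun (p : ℝ × ℝ) => gaussMoment_eq p.1]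
    refine (continuous_snd.pow h).sub (continuous_finsetSum _ fun d _ => ?_)
    have := ih (h - (d + 1)) (by have := d.2; omega)
    fun_prop

lemma denoisedPow_zero_left (y : ℝ) (h : ℕ) : denoisedPow 0 y h = y ^ h := by
  rw [denoisedPow_eq, sub_eq_self]
  refine Finset.sum_eq_zero fun d _ => ?_
  rw [gaussMoment_eq]
  simp

/-- The first Gaussian moment vanishes, the second is `t²`, and the later ones are of order at least
`t³`. So only the second moment contributes to second order. -/
lemma denoisedPow_sub_isLittleO (y : ℝ) (h : ℕ) :
    (fun t => denoisedPow t y h - (y ^ h - h.choose 2 * y ^ (h - 2) * t ^ 2))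
      =o[𝓝 0] fun t : ℝ => t ^ 2 := by
  have hD : ∀ h, Tendsto (fun t => denoisedPow t y h) (𝓝 0) (𝓝 (y ^ h)) := by
    intro h
    have := ((continuous_denoisedPow h).comp (by fun_prop : Continuous fun t : ℝ => (t, y))).tendsto 0
    simpa [denoisedPow_zero_left, Function.comp_def] using this
  -- Index `d` carries the moment of order `d + 1`. The quadratic term is placed in the slot `d =
  -- 1`, so that each summand is negligible separately.
  have key : ∀ t, denoisedPow t y h - (y ^ h - h.choose 2 * y ^ (h - 2) * t ^ 2)
      = ∑ d : Fin h, (if (d : ℕ) = 1 then h.choose 2 * y ^ (h - 2) * t ^ 2 else 0)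
        - ∑ d : Fin h, (h.choose ((d : ℕ) + 1) : ℝ) * denoisedPow t y (h - ((d : ℕ) + 1))
        * (t ^ ((d : ℕ) + 1) * gaussMoment 1 ((d : ℕ) + 1)) := by
    intro t
    have : ∑ d : Fin h, (if (d : ℕ) = 1 then h.choose 2 * y ^ (h - 2) * t ^ 2 else 0)
        = h.choose 2 * y ^ (h - 2) * t ^ 2 := by
      rcases lt_or_ge 1 h with h1 | h1
      · rw [Finset.sum_eq_single (⟨1, h1⟩ : Fin h)]
        · simp
        · intro b _ hb
          rw [if_neg]
          intro hb'
          exact hb (Fin.ext hb')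
        · simp
      · have : h.choose 2 = 0 := Nat.choose_eq_zero_of_lt (by omega)
        simp [this]
    rw [this, denoisedPow_eq _ _ h]
    simp_rw [gaussMoment_eq t]
    ring
  simp_rw [key, ← Finset.sum_sub_distrib]
  refine Asymptotics.IsLittleO.fun_sum fun d _ => ?_
  rcases lt_trichotomy (d : ℕ) 1 with hd | hd | hd
  · have h0 : (d : ℕ) = 0 := by omega
    simp [h0, gaussMoment_one_one]
  · have : (fun t : ℝ => (if (d : ℕ) = 1 then h.choose 2 * y ^ (h - 2) * t ^ 2 else 0)
        - (h.choose ((d : ℕ) + 1) : ℝ) * denoisedPow t y (h - ((d : ℕ) + 1))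
        * (t ^ ((d : ℕ) + 1) * gaussMoment 1 ((d : ℕ) + 1)))
        = fun t => (h.choose 2 * (y ^ (h - 2) - denoisedPow t y (h - 2))) * t ^ 2 := by
      funext t
      simp [hd, gaussMoment_one_two]
      ring
    rw [this]
    have h2 : Tendsto (fun t => (h.choose 2 * (y ^ (h - 2) - denoisedPow t y (h - 2)) : ℝ))
        (𝓝 0) (𝓝 0) := by
      simpa using ((tendsto_const_nhds (x := y ^ (h - 2))).sub (hD (h - 2))).const_mul
        (h.choose 2 : ℝ)
    simpa using ((Asymptotics.isLittleO_one_iff ℝ).2 h2).mul_isBigO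
      (Asymptotics.isBigO_refl (fun t : ℝ => t ^ 2) (𝓝 0))
  · have hne : (d : ℕ) ≠ 1 := by omega
    simp only [if_neg hne, zero_sub]
    have : (fun t : ℝ => -((h.choose ((d : ℕ) + 1) : ℝ) * denoisedPow t y (h - ((d : ℕ) + 1))
        * (t ^ ((d : ℕ) + 1) * gaussMoment 1 ((d : ℕ) + 1))))
        = fun t => (-(h.choose ((d : ℕ) + 1) : ℝ) * denoisedPow t y (h - ((d : ℕ) + 1))
          * t ^ ((d : ℕ) - 1) * gaussMoment 1 ((d : ℕ) + 1)) * t ^ 2 := by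
      funext t
      have : (d : ℕ) + 1 = (d - 1) + 2 := by omega
      rw [this, pow_add]
      ring
    rw [this]
    have h2 : Tendsto (fun t => -(h.choose ((d : ℕ) + 1) : ℝ)
        * denoisedPow t y (h - ((d : ℕ) + 1))
          * t ^ ((d : ℕ) - 1) * gaussMoment 1 ((d : ℕ) + 1)) (𝓝 0) (𝓝 0) := by
      have hp : Tendsto (fun t : ℝ => t ^ ((d : ℕ) - 1)) (𝓝 0) (𝓝 0) := by
        have := (continuous_pow (M := ℝ) ((d : ℕ) - 1)).tendsto 0
        rwa [zero_pow (by omega)] at this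
      simpa using (((hD (h - ((d : ℕ) + 1))).const_mul (-(h.choose ((d : ℕ) + 1) : ℝ))).mul
        hp).mul_const (gaussMoment 1 ((d : ℕ) + 1))
    simpa using ((Asymptotics.isLittleO_one_iff ℝ).2 h2).mul_isBigO
      (Asymptotics.isBigO_refl (fun t : ℝ => t ^ 2) (𝓝 0))

/-! ### Products of linear forms and the Veronese map. -/

/-- The product of the linear forms `r ↦ b_iᵀ r`. -/
noncomputable def prodForm {ι : Type*} [Fintype ι] {n : ℕ} (b : Fin n → ι → ℝ) :
    MvPolynomial ι ℝ :=
  ∏ i, ∑ j, MvPolynomial.C (b i j) * MvPolynomial.X j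

/-- The coefficient vector of `prodForm b` with respect to the monomials of degree `n`. -/
noncomputable def prodCoeff {na nc n : ℕ} (b : Fin n → RegIdx na nc → ℝ) :
    MonIdx na nc n → ℝ :=
  fun α => MvPolynomial.coeff (Finsupp.equivFunOnFinite.symm α.1) (prodForm b)

lemma prodForm_isHomogeneous {ι : Type*} [Fintype ι] {n : ℕ} (b : Fin n → ι → ℝ) :
    (prodForm b).IsHomogeneous n := by
  have := MvPolynomial.IsHomogeneous.prod (Finset.univ : Finset (Fin n))
    (fun i => ∑ j, MvPolynomial.C (b i j) * MvPolynomial.X j) (fun _ => 1) (fun i _ =>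
      MvPolynomial.IsHomogeneous.sum _ _ _ fun j _ => by
        simpa using (MvPolynomial.isHomogeneous_C ι (b i j)).mul (MvPolynomial.isHomogeneous_X ℝ j))
  simpa [prodForm] using this

lemma eval_prodForm {ι : Type*} [Fintype ι] {n : ℕ} (b : Fin n → ι → ℝ) (r : ι → ℝ) :
    MvPolynomial.eval r (prodForm b) = ∏ i, b i ⬝ᵥ r := by
  simp [prodForm, map_prod, dotProduct]

/-- In the Leibniz rule every term that differentiates a factor other than `d` still contains the
vanishing factor `b d ⬝ᵥ r`. The gradient of the product thus reveals the active parameter vector.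
-/
lemma polyGrad_prodForm {ι : Type*} [Fintype ι] {n : ℕ} (b : Fin n → ι → ℝ) (r : ι → ℝ)
    (d : Fin n) (hd : b d ⬝ᵥ r = 0) :
    polyGrad (prodForm b) r = (∏ i ∈ Finset.univ.erase d, b i ⬝ᵥ r) • b d := by
  classical
  funext l
  have hd' : MvPolynomial.eval r (∑ j, MvPolynomial.C (b d j) * MvPolynomial.X j) = 0 := by
    simpa [dotProduct] using hd
  rw [polyGrad, prodForm, ← Finset.mul_prod_erase _ _ (Finset.mem_univ d), Derivation.leibniz,
    map_add, smul_eq_mul, smul_eq_mul, map_mul, map_mul, hd', zero_mul, zero_add]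
  simp [map_prod, dotProduct, MvPolynomial.pderiv_X, Pi.single_apply]

lemma veroneseForm_coeff {na nc n : ℕ} {p : MvPolynomial (RegIdx na nc) ℝ}
    (hp : p.IsHomogeneous n) :
    veroneseForm (n := n) (fun α => p.coeff (Finsupp.equivFunOnFinite.symm α.1)) = p := by
  classical
  ext m
  rw [veroneseForm, MvPolynomial.coeff_sum]
  simp_rw [MvPolynomial.coeff_monomial]
  by_cases hm : ∑ i, m i = n
  · rw [Finset.sum_eq_single (⟨m, by simpa using hm⟩ : MonIdx na nc n)]
    · have : Finsupp.equivFunOnFinite.symm (m : RegIdx na nc → ℕ) = m :=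
        Finsupp.equivFunOnFinite.symm_apply_apply m
      simp [this]
    · intro α _ hα
      rw [if_neg]
      rintro rfl
      apply hα
      ext1
      simp
    · simp
  · rw [Finset.sum_eq_zero, hp.coeff_eq_zero]
    · rwa [Finsupp.degree_eq_sum]
    · intro α _
      rw [if_neg]
      rintro rfl
      apply hm
      simpa using (Finset.mem_piAntidiag.1 α.2).1

lemma veroneseForm_prodCoeff {na nc n : ℕ} (b : Fin n → RegIdx na nc → ℝ) :
    veroneseForm (prodCoeff b) = prodForm b :=
  veroneseForm_coeff (prodForm_isHomogeneous b)

lemma eval_monomial_eq {ι : Type*} [Fintype ι] (γ : ι →₀ ℕ) (c : ℝ) (r : ι → ℝ) :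
    MvPolynomial.eval r (MvPolynomial.monomial γ c) = c * ∏ i, r i ^ γ i := by
  rw [MvPolynomial.eval_monomial, Finsupp.prod_fintype _ _ (by simp)]

lemma eval_veroneseForm {na nc n : ℕ} (c : MonIdx na nc n → ℝ) (r : RegIdx na nc → ℝ) :
    MvPolynomial.eval r (veroneseForm c) = c ⬝ᵥ veronese r := by
  simp [veroneseForm, dotProduct, veronese, eval_monomial_eq, map_sum]

lemma prodCoeff_dotProduct_veronese {na nc n : ℕ} (b : Fin n → RegIdx na nc → ℝ)
    (r : RegIdx na nc → ℝ) : prodCoeff b ⬝ᵥ veronese r = ∏ i, b i ⬝ᵥ r := by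
  rw [← eval_veroneseForm, veroneseForm_prodCoeff, eval_prodForm]

lemma veroneseForm_smul {na nc n : ℕ} (κ : ℝ) (c : MonIdx na nc n → ℝ) :
    veroneseForm (κ • c) = MvPolynomial.C κ * veroneseForm c := by
  simp [veroneseForm, Finset.mul_sum, MvPolynomial.C_mul_monomial]

lemma polyGrad_C_mul {ι : Type*} (κ : ℝ) (p : MvPolynomial ι ℝ) (r : ι → ℝ) :
    polyGrad (MvPolynomial.C κ * p) r = κ • polyGrad p r := by
  funext i
  simp [polyGrad, Derivation.leibniz]

lemma continuous_polyGrad {na nc n : ℕ} :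
    Continuous fun q : (MonIdx na nc n → ℝ) × (RegIdx na nc → ℝ) =>
      polyGrad (veroneseForm q.1) q.2 := by
  refine continuous_pi fun i => ?_
  have : ∀ q : (MonIdx na nc n → ℝ) × (RegIdx na nc → ℝ), polyGrad (veroneseForm q.1) q.2 i
      = ∑ α, q.1 α * MvPolynomial.eval q.2 (MvPolynomial.pderiv i
        (MvPolynomial.monomial (Finsupp.equivFunOnFinite.symm α.1) 1)) := by
    intro q
    simp only [polyGrad, veroneseForm, map_sum]
    refine Finset.sum_congr rfl fun α _ => ?_
    rw [← mul_one (q.1 α), ← MvPolynomial.C_mul_monomial, mul_one]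
    simp [Derivation.leibniz]
  simp_rw [this]
  refine continuous_finsetSum _ fun α _ => ?_
  exact ((continuous_apply α).comp continuous_fst).mul
    ((MvPolynomial.continuous_eval _).comp continuous_snd)

lemma continuous_veronese {na nc n : ℕ} :
    Continuous (veronese : (RegIdx na nc → ℝ) → MonIdx na nc n → ℝ) := by
  unfold veronese
  fun_prop

/-! ### Moment matrices -/

lemma dotProduct_momentMatrix_mulVec {na nc n N : ℕ} (x u : ℤ → ℝ) (v : MonIdx na nc n → ℝ) :
    v ⬝ᵥ (momentMatrix na nc n N x u *ᵥ v)
      = (1 / (N : ℝ)) * ∑ k ∈ Finset.Icc 1 N, (v ⬝ᵥ veronese (regressor na nc x u k)) ^ 2 := by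
  rw [momentMatrix, Matrix.smul_mulVec, dotProduct_smul, smul_eq_mul, Matrix.sum_mulVec,
    dotProduct_sum]
  congr 1
  refine Finset.sum_congr rfl fun k _ => ?_
  rw [Matrix.vecMulVec_mulVec]
  simp [dotProduct_comm, pow_two]

lemma momentMatrix_posSemidef {na nc n N : ℕ} (x u : ℤ → ℝ) :
    (momentMatrix na nc n N x u).PosSemidef := by
  refine Matrix.PosSemidef.of_dotProduct_mulVec_nonneg ?_ fun v => ?_
  · rw [Matrix.IsHermitian, Matrix.conjTranspose_eq_transpose_of_trivial]
    simp [momentMatrix, Matrix.transpose_sum, Matrix.transpose_vecMulVec]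
  · rw [star_trivial, dotProduct_momentMatrix_mulVec]
    positivity

lemma momentMatrix_mulVec_eq_zero_iff {na nc n N : ℕ} (hN : 1 ≤ N) (x u : ℤ → ℝ)
    (v : MonIdx na nc n → ℝ) :
    momentMatrix na nc n N x u *ᵥ v = 0
      ↔ ∀ k ∈ Finset.Icc 1 N, v ⬝ᵥ veronese (regressor na nc x u k) = 0 := by
  have hN' : (N : ℝ) ≠ 0 := by positivity
  rw [← (momentMatrix_posSemidef x u).dotProduct_mulVec_zero_iff, star_trivial,
    dotProduct_momentMatrix_mulVec, mul_eq_zero, or_iff_right (by simpa using hN'),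
    Finset.sum_eq_zero_iff_of_nonneg (fun k _ => sq_nonneg _)]
  simp

/-- Each new data point adds a linear condition on kernel vectors. For `N = 0` the matrix is zero.
-/
lemma momentMatrix_mulVec_mono {na nc n N N' : ℕ} (hN : 1 ≤ N') (h : N ≤ N') (x u : ℤ → ℝ)
    {v : MonIdx na nc n → ℝ} (hv : momentMatrix na nc n N' x u *ᵥ v = 0) :
    momentMatrix na nc n N x u *ᵥ v = 0 := by
  rcases Nat.eq_zero_or_pos N with rfl | hN0
  · simp [momentMatrix]
  · rw [momentMatrix_mulVec_eq_zero_iff hN0]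
    rw [momentMatrix_mulVec_eq_zero_iff hN] at hv
    intro k hk
    exact hv k (Finset.Icc_subset_Icc_right h hk)

lemma veronese_mul_veronese {na nc n : ℕ} (r : RegIdx na nc → ℝ) (α β : MonIdx na nc n) :
    veronese r α * veronese r β = (∏ j : Fin (na + 1), r (Sum.inl j) ^ (α.1 (Sum.inl j)
      + β.1 (Sum.inl j))) * ∏ j : Fin nc, r (Sum.inr j) ^ (α.1 (Sum.inr j) + β.1 (Sum.inr j)) := by
  rw [veronese, veronese, ← Finset.prod_mul_distrib, Fintype.prod_sum_type]
  simp [pow_add]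

lemma noisyMomentMatrix_zero {na nc n N : ℕ} (y u : ℤ → ℝ) :
    noisyMomentMatrix na nc n N y u 0 = momentMatrix na nc n N y u := by
  ext α β
  simp only [noisyMomentMatrix, momentMatrix, Matrix.of_apply, Matrix.smul_apply, Matrix.sum_apply,
    Matrix.vecMulVec_apply, smul_eq_mul, denoisedPow_zero_left, veronese_mul_veronese]
  simp [regressor]

lemma noisyMomentMatrix_isHermitian {na nc n N : ℕ} (y u : ℤ → ℝ) (t : ℝ) :
    (noisyMomentMatrix na nc n N y u t).IsHermitian := by
  ext α β
  simp [noisyMomentMatrix, add_comm]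

lemma continuous_noisyMomentMatrix {na nc n N : ℕ} (x ξ u : ℤ → ℝ) :
    Continuous fun p : ℝ × ℝ =>
      noisyMomentMatrix na nc n N (fun k => x k + p.1 * ξ k) u p.2 := by
  refine continuous_matrix fun α β => ?_
  simp only [noisyMomentMatrix, Matrix.of_apply]
  refine continuous_const.mul (continuous_finsetSum _ fun k _ => Continuous.mul ?_ continuous_const)
  refine continuous_finsetProd _ fun j _ => ?_
  exact (continuous_denoisedPow _).comp (by fun_prop : Continuous fun p : ℝ × ℝ =>
    (p.2, x ((k : ℤ) - (j : ℕ)) + p.1 * ξ ((k : ℤ) - (j : ℕ))))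

/-! ### Second order expansion of the denoised moments -/

/-- The linear functional that replaces, in every monomial of a polynomial evaluated at `r`, the
powers of the output samples by their unbiased surrogates. -/
noncomputable def denoisedEval {na nc : ℕ} (t : ℝ) (r : RegIdx na nc → ℝ) :
    MvPolynomial (RegIdx na nc) ℝ →ₗ[ℝ] ℝ :=
  (MvPolynomial.basisMonomials (RegIdx na nc) ℝ).constr ℝ fun γ =>
    (∏ j, denoisedPow t (r (Sum.inl j)) (γ (Sum.inl j))) * ∏ j, r (Sum.inr j) ^ γ (Sum.inr j)

lemma denoisedEval_monomial {na nc : ℕ} (t : ℝ) (r : RegIdx na nc → ℝ) (γ : RegIdx na nc →₀ ℕ)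
    (a : ℝ) : denoisedEval t r (MvPolynomial.monomial γ a) = a *
      ((∏ j, denoisedPow t (r (Sum.inl j)) (γ (Sum.inl j))) * ∏ j, r (Sum.inr j) ^ γ (Sum.inr j)) := by
  have h : MvPolynomial.monomial γ a
      = a • MvPolynomial.basisMonomials (RegIdx na nc) ℝ γ := by
    simp [MvPolynomial.coe_basisMonomials, MvPolynomial.smul_monomial]
  rw [h, map_smul, denoisedEval, Module.Basis.constr_basis, smul_eq_mul]

/-- Product rule for expansions `A - B t² + o(t²)`; the cross terms `B B' t⁴` are negligible. It
carries the expansion from single powers to monomials. -/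
lemma prod_sub_isLittleO {ι : Type*} [DecidableEq ι] (s : Finset ι) (f : ι → ℝ → ℝ) (A B : ι → ℝ)
    (h : ∀ j ∈ s, (fun t => f j t - (A j - B j * t ^ 2)) =o[𝓝 0] fun t : ℝ => t ^ 2) :
    (fun t => ∏ j ∈ s, f j t - (∏ j ∈ s, A j - (∑ j ∈ s, B j * ∏ l ∈ s.erase j, A l) * t ^ 2))
      =o[𝓝 0] fun t : ℝ => t ^ 2 := by
  induction s using Finset.induction_on with
  | empty => simp
  | insert i s hi ih =>
    have ih' := ih fun j hj => h j (Finset.mem_insert_of_mem hj)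
    have hi' := h i (Finset.mem_insert_self i s)
    set S := ∑ j ∈ s, B j * ∏ l ∈ s.erase j, A l with hS
    have hsum : ∑ j ∈ insert i s, B j * ∏ l ∈ (insert i s).erase j, A l
        = B i * ∏ l ∈ s, A l + A i * S := by
      rw [Finset.sum_insert hi, Finset.erase_insert hi, hS, Finset.mul_sum]
      congr 1
      refine Finset.sum_congr rfl fun j hj => ?_
      have hij : i ≠ j := fun e => hi (e ▸ hj)
      rw [Finset.erase_insert_of_ne hij, Finset.prod_insert (fun hh => hi (Finset.mem_of_mem_erase hh))]
      ring
    have h2 : (fun t : ℝ => t ^ 2) =o[𝓝 0] fun _ : ℝ => (1 : ℝ) := by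
      rw [Asymptotics.isLittleO_one_iff]
      simpa using (continuous_pow (M := ℝ) 2).tendsto 0
    have hO : (fun t => ∏ j ∈ s, f j t) =O[𝓝 0] fun _ : ℝ => (1 : ℝ) := by
      have h3 := (ih'.trans h2).isBigO
      have h4 : (fun t : ℝ => ∏ j ∈ s, A j - S * t ^ 2) =O[𝓝 0] fun _ : ℝ => (1 : ℝ) :=
        Asymptotics.IsBigO.sub (Asymptotics.isBigO_const_const _ one_ne_zero _)
          (h2.isBigO.const_mul_left _)
      simpa using h3.add h4
    have e : (fun t => ∏ j ∈ insert i s, f j t - (∏ j ∈ insert i s, A j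
        - (∑ j ∈ insert i s, B j * ∏ l ∈ (insert i s).erase j, A l) * t ^ 2))
        = fun t => (f i t - (A i - B i * t ^ 2)) * ∏ j ∈ s, f j t
          + A i * (∏ j ∈ s, f j t - (∏ j ∈ s, A j - S * t ^ 2))
          - B i * ((∏ j ∈ s, f j t - (∏ j ∈ s, A j - S * t ^ 2)) * t ^ 2)
          + (B i * S * t ^ 2) * t ^ 2 := by
      funext t
      rw [hsum, Finset.prod_insert hi, Finset.prod_insert hi]
      ring
    rw [e]
    have e1 : (fun t => (f i t - (A i - B i * t ^ 2)) * ∏ j ∈ s, f j t)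
        =o[𝓝 0] fun t : ℝ => t ^ 2 := by simpa using hi'.mul_isBigO hO
    have e3 : (fun t => (∏ j ∈ s, f j t - (∏ j ∈ s, A j - S * t ^ 2)) * t ^ 2)
        =o[𝓝 0] fun t : ℝ => t ^ 2 := by simpa using ih'.mul_isBigO h2.isBigO
    have e4 : (fun t : ℝ => (B i * S * t ^ 2) * t ^ 2) =o[𝓝 0] fun t : ℝ => t ^ 2 := by
      simpa using (h2.const_mul_left (B i * S)).mul_isBigO
        (Asymptotics.isBigO_refl (fun t : ℝ => t ^ 2) (𝓝 0))
    exact ((e1.add (ih'.const_mul_left _)).sub (e3.const_mul_left _)).add e4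

lemma eval_pderiv_pderiv_monomial {na nc : ℕ} (r : RegIdx na nc → ℝ) (γ : RegIdx na nc →₀ ℕ)
    (a : ℝ) (j : Fin (na + 1)) :
    MvPolynomial.eval r (MvPolynomial.pderiv (Sum.inl j) (MvPolynomial.pderiv (Sum.inl j)
      (MvPolynomial.monomial γ a)))
      = 2 * a * (((γ (Sum.inl j)).choose 2 * r (Sum.inl j) ^ (γ (Sum.inl j) - 2)
        * ∏ l ∈ Finset.univ.erase j, r (Sum.inl l) ^ γ (Sum.inl l))
        * ∏ l, r (Sum.inr l) ^ γ (Sum.inr l)) := by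
  classical
  rw [MvPolynomial.pderiv_monomial, MvPolynomial.pderiv_monomial, eval_monomial_eq,
    Fintype.prod_sum_type, ← Finset.mul_prod_erase _ _ (Finset.mem_univ j)]
  have h1 : ∏ l ∈ Finset.univ.erase j, r (Sum.inl l) ^
      (γ - Finsupp.single (Sum.inl j) 1 - Finsupp.single (Sum.inl j) 1 : RegIdx na nc →₀ ℕ)
        (Sum.inl l)
      = ∏ l ∈ Finset.univ.erase j, r (Sum.inl l) ^ γ (Sum.inl l) := by
    refine Finset.prod_congr rfl fun l hl => ?_
    have : j ≠ l := fun e => Finset.ne_of_mem_erase hl e.symm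
    simp [this]
  have h2 : ((γ (Sum.inl j)).choose 2 : ℝ) * 2 = γ (Sum.inl j) * ((γ (Sum.inl j) - 1 : ℕ) : ℝ) := by
    rw [Nat.choose_two_right]
    exact_mod_cast Nat.div_mul_cancel (Nat.even_mul_pred_self _).two_dvd
  rw [h1]
  simp only [Finsupp.coe_tsub, Pi.sub_apply, Finsupp.single_eq_same, ne_eq, reduceCtorEq,
    not_false_eq_true, Finsupp.single_eq_of_ne, tsub_zero]
  rw [show γ (Sum.inl j) - 1 - 1 = γ (Sum.inl j) - 2 from by omega]
  linear_combination (-(a * (r (Sum.inl j) ^ (γ (Sum.inl j) - 2)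
    * ∏ l ∈ Finset.univ.erase j, r (Sum.inl l) ^ γ (Sum.inl l))
        * ∏ l, r (Sum.inr l) ^ γ (Sum.inr l))) * h2

/-- Adding Gaussian noise of variance `t²` to the outputs changes a mean by `t² / 2` times the
Laplacian in the output variables, to second order. Denoising inverts this and subtracts the same
amount. -/
lemma denoisedEval_sub_isLittleO {na nc : ℕ} (r : RegIdx na nc → ℝ)
    (q : MvPolynomial (RegIdx na nc) ℝ) :
    (fun t => denoisedEval t r q - (MvPolynomial.eval r q - (1 / 2) * (∑ j : Fin (na + 1),
      MvPolynomial.eval r (MvPolynomial.pderiv (Sum.inl j) (MvPolynomial.pderiv (Sum.inl j) q)))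
        * t ^ 2)) =o[𝓝 0] fun t : ℝ => t ^ 2 := by
  classical
  induction q using MvPolynomial.induction_on' with
  | monomial γ a =>
    have h := (prod_sub_isLittleO Finset.univ
      (fun j : Fin (na + 1) => fun t => denoisedPow t (r (Sum.inl j)) (γ (Sum.inl j)))
      (fun j => r (Sum.inl j) ^ γ (Sum.inl j))
      (fun j => (γ (Sum.inl j)).choose 2 * r (Sum.inl j) ^ (γ (Sum.inl j) - 2))
      (fun j _ => denoisedPow_sub_isLittleO _ _)).const_mul_left
        (a * ∏ j, r (Sum.inr j) ^ γ (Sum.inr j))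
    refine h.congr_left fun t => ?_
    simp_rw [denoisedEval_monomial, eval_pderiv_pderiv_monomial, eval_monomial_eq,
      Fintype.prod_sum_type, ← Finset.mul_sum, ← Finset.sum_mul]
    ring
  | add p q hp hq =>
    refine (hp.add hq).congr_left fun t => ?_
    simp only [map_add, Finset.sum_add_distrib]
    ring

/-- At a zero of `p` the second derivatives of `p²` are `2 (∂p)²`, so the correction has a definite
sign. This is what drives the denoised quadratic form below zero. -/
lemma denoisedEval_mul_self_sub_isLittleO {na nc : ℕ} (r : RegIdx na nc → ℝ)
    (p : MvPolynomial (RegIdx na nc) ℝ) (hp : MvPolynomial.eval r p = 0) :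
    (fun t => denoisedEval t r (p * p) + (∑ j : Fin (na + 1), polyGrad p r (Sum.inl j) ^ 2)
        * t ^ 2) =o[𝓝 0] fun t : ℝ => t ^ 2 := by
  refine (denoisedEval_sub_isLittleO r (p * p)).congr_left fun t => ?_
  have : ∀ j : Fin (na + 1), MvPolynomial.eval r (MvPolynomial.pderiv (Sum.inl j)
      (MvPolynomial.pderiv (Sum.inl j) (p * p))) = 2 * polyGrad p r (Sum.inl j) ^ 2 := by
    intro j
    simp [Derivation.leibniz, hp, polyGrad]
    ring
  simp_rw [this, ← Finset.mul_sum]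
  simp [hp]

lemma dotProduct_noisyMomentMatrix_mulVec {na nc n N : ℕ} (y u : ℤ → ℝ) (t : ℝ)
    (c : MonIdx na nc n → ℝ) :
    c ⬝ᵥ (noisyMomentMatrix na nc n N y u t *ᵥ c) = (1 / (N : ℝ)) * ∑ k ∈ Finset.Icc 1 N,
      denoisedEval t (regressor na nc y u k) (veroneseForm c * veroneseForm c) := by
  have h : ∀ k : ℤ, denoisedEval t (regressor na nc y u k) (veroneseForm c * veroneseForm c)
      = ∑ α, ∑ β, c α * c β * ((∏ j : Fin (na + 1),
        denoisedPow t (y (k - (j : ℕ))) (α.1 (Sum.inl j) + β.1 (Sum.inl j)))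
      * ∏ j : Fin nc, u (k - 1 - (j : ℕ)) ^ (α.1 (Sum.inr j) + β.1 (Sum.inr j))) := by
    intro k
    simp only [veroneseForm, Finset.sum_mul_sum, map_sum, MvPolynomial.monomial_mul,
      denoisedEval_monomial]
    simp [regressor]
  simp_rw [h]
  simp only [dotProduct, Matrix.mulVec, noisyMomentMatrix, Matrix.of_apply]
  simp_rw [Finset.mul_sum, Finset.sum_mul, Finset.mul_sum]
  symm
  rw [Finset.sum_comm]
  refine Finset.sum_congr rfl fun α _ => ?_
  rw [Finset.sum_comm]
  refine Finset.sum_congr rfl fun β _ => Finset.sum_congr rfl fun k _ => ?_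
  ring

/-- If a form vanishes at all data points and its gradient with respect to the outputs does not
vanish identically on them, then the denoised moment matrix is negative on it for all small positive
noise levels. -/
lemma eventually_noisyMomentMatrix_neg {na nc n N : ℕ} (hN : 1 ≤ N) (x u : ℤ → ℝ)
    (c : MonIdx na nc n → ℝ)
    (h0 : ∀ k ∈ Finset.Icc 1 N, MvPolynomial.eval (regressor na nc x u k) (veroneseForm c) = 0)
    (h1 : ∃ k ∈ Finset.Icc 1 N, ∃ j, polyGrad (veroneseForm c) (regressor na nc x u k)
      (Sum.inl j) ≠ 0) :
    ∀ᶠ t in 𝓝[>] (0 : ℝ), c ⬝ᵥ (noisyMomentMatrix na nc n N x u t *ᵥ c) < 0 := by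
  set G : ℝ := ∑ k ∈ Finset.Icc 1 N, ∑ j : Fin (na + 1),
    polyGrad (veroneseForm c) (regressor na nc x u k) (Sum.inl j) ^ 2 with hG
  have hGpos : 0 < G := by
    obtain ⟨k, hk, j, hj⟩ := h1
    refine Finset.sum_pos' (fun _ _ => Finset.sum_nonneg fun _ _ => sq_nonneg _) ⟨k, hk, ?_⟩
    exact Finset.sum_pos' (fun _ _ => sq_nonneg _) ⟨j, Finset.mem_univ _, by positivity⟩
  have ho : (fun t => (∑ k ∈ Finset.Icc 1 N, denoisedEval t (regressor na nc x u k)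
      (veroneseForm c * veroneseForm c)) + G * t ^ 2) =o[𝓝 0] fun t : ℝ => t ^ 2 := by
    have := Asymptotics.IsLittleO.fun_sum (s := Finset.Icc 1 N) fun (k : ℕ) hk =>
      denoisedEval_mul_self_sub_isLittleO (regressor na nc x u (k : ℤ)) (veroneseForm c) (h0 k hk)
    refine this.congr_left fun t => ?_
    rw [Finset.sum_add_distrib, hG, Finset.sum_mul]
  -- Half of the leading term `-G t²` suffices to absorb the remainder.
  have hb := (ho.def (half_pos hGpos)).filter_mono (nhdsWithin_le_nhds (s := Set.Ioi 0))
  filter_upwards [hb, self_mem_nhdsWithin] with t ht htpos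
  rw [Set.mem_Ioi] at htpos
  rw [dotProduct_noisyMomentMatrix_mulVec]
  have hN' : (0 : ℝ) < N := by positivity
  have h2 := (le_abs_self _).trans ht
  rw [Real.norm_of_nonneg (by positivity)] at h2
  have h3 : 0 < G / 2 * t ^ 2 := by positivity
  refine mul_neg_of_pos_of_neg (by positivity) ?_
  nlinarith

/-! ### The estimated noise level for small measurement noise. -/

instance nonempty_monIdx (na nc n : ℕ) : Nonempty (MonIdx na nc n) :=
  ⟨⟨Pi.single (Sum.inl 0) n, by simp⟩⟩

/-- As soon as the matrix is singular somewhere on the interval, the minimum of the smallest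
singular value is `0` and its minimizers are the zeros of the determinant. -/
lemma isNoiseLevelEstimate_iff {na nc n N : ℕ} {σmax : ℝ} {y u : ℤ → ℝ} {s : ℝ}
    (h : ∃ t ∈ Set.Icc 0 σmax, (noisyMomentMatrix na nc n N y u t).det = 0) :
    IsNoiseLevelEstimate na nc n N σmax y u s ↔
      IsLeast {t | t ∈ Set.Icc 0 σmax ∧ (noisyMomentMatrix na nc n N y u t).det = 0} s := by
  rw [IsNoiseLevelEstimate]
  suffices {t | t ∈ Set.Icc 0 σmax ∧ IsMinOn
      (fun t => minSingularValue (noisyMomentMatrix na nc n N y u t)) (Set.Icc 0 σmax) t}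
      = {t | t ∈ Set.Icc 0 σmax ∧ (noisyMomentMatrix na nc n N y u t).det = 0} by rw [this]
  ext t
  obtain ⟨t₀, ht₀, hdet⟩ := h
  refine and_congr_right fun ht => ?_
  rw [← minSingularValue_eq_zero_iff] at hdet ⊢
  rw [isMinOn_iff]
  constructor
  · intro hmin
    exact le_antisymm (hdet ▸ hmin t₀ ht₀) (minSingularValue_nonneg _)
  · intro h0 t' _
    rw [h0]
    exact minSingularValue_nonneg _

lemma exists_isNoiseLevelEstimate {na nc n N : ℕ} {σmax : ℝ} {y u : ℤ → ℝ}
    (h : ∃ t ∈ Set.Icc 0 σmax, (noisyMomentMatrix na nc n N y u t).det = 0) :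
    ∃ s, IsNoiseLevelEstimate na nc n N σmax y u s := by
  have hc : Continuous fun t => (noisyMomentMatrix na nc n N y u t).det := by
    have := (continuous_noisyMomentMatrix (na := na) (nc := nc) (n := n) (N := N) y 0 u).comp
      (by fun_prop : Continuous fun t : ℝ => ((0 : ℝ), t))
    simpa using this.matrix_det
  have hK : IsCompact {t | t ∈ Set.Icc 0 σmax ∧ (noisyMomentMatrix na nc n N y u t).det = 0} :=
    isCompact_Icc.inter_right (isClosed_eq hc continuous_const)
  obtain ⟨t, ht, ht'⟩ := h
  obtain ⟨s, hs⟩ := hK.exists_isLeast ⟨t, ht, ht'⟩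
  exact ⟨s, (isNoiseLevelEstimate_iff ⟨t, ht, ht'⟩).2 hs⟩

lemma exists_polyGrad_prodForm {na nc n : ℕ} {b : Fin n → RegIdx na nc → ℝ} {r : RegIdx na nc → ℝ}
    {d : Fin n} (hz : b d ⬝ᵥ r = 0) (hd : ∀ i, i ≠ d → b i ⬝ᵥ r ≠ 0) :
    ∃ γ : ℝ, γ ≠ 0 ∧ polyGrad (prodForm b) r = γ • b d := by
  refine ⟨_, ?_, polyGrad_prodForm b r d hz⟩
  rw [Finset.prod_ne_zero_iff]
  intro i hi
  exact hd i (Finset.ne_of_mem_erase hi)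

/-- For small measurement noise the estimated noise level exists, is small, and makes the denoised
moment matrix singular. -/
lemma eventually_noiseLevelEstimate {na nc n N : ℕ} (hN : 1 ≤ N) {σmax : ℝ} (hσmax : 0 < σmax)
    {b : Fin n → RegIdx na nc → ℝ} (hb : ∀ i, b i (Sum.inl 0) = -1) {x u ξ : ℤ → ℝ}
    {δ : ℕ → Fin n} (hz : ∀ k : ℕ, 1 ≤ k → b (δ k) ⬝ᵥ regressor na nc x u k = 0)
    (hd : ∀ k : ℕ, 1 ≤ k → ∀ i, i ≠ δ k → b i ⬝ᵥ regressor na nc x u k ≠ 0)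
    {T : ℝ} (hT : 0 < T) :
    ∀ᶠ σ in 𝓝[>] (0 : ℝ),
      (∃ s, IsNoiseLevelEstimate na nc n N σmax (fun k => x k + σ * ξ k) u s) ∧
      ∀ s, IsNoiseLevelEstimate na nc n N σmax (fun k => x k + σ * ξ k) u s →
        0 ≤ s ∧ s ≤ T ∧ (noisyMomentMatrix na nc n N (fun k => x k + σ * ξ k) u s).det = 0 := by
  set M : ℝ × ℝ → Matrix (MonIdx na nc n) (MonIdx na nc n) ℝ := fun p =>
    noisyMomentMatrix na nc n N (fun k => x k + p.1 * ξ k) u p.2 with hM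
  have hMc : Continuous M := continuous_noisyMomentMatrix x ξ u
  have hneg := eventually_noisyMomentMatrix_neg hN x u (prodCoeff b)
    (fun k hk => by
      rw [veroneseForm_prodCoeff, eval_prodForm]
      exact Finset.prod_eq_zero (Finset.mem_univ (δ k)) (hz k (Finset.mem_Icc.1 hk).1))
    -- The gradient at the first data point is a nonzero multiple of a parameter vector, whose entry
    -- at `Sum.inl 0` is `-1`.
    ⟨1, by simp [hN], 0, by
      obtain ⟨γ, hγ, h⟩ := exists_polyGrad_prodForm (hz 1 le_rfl) (hd 1 le_rfl)
      rw [veroneseForm_prodCoeff]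
      push_cast at h ⊢
      rw [h]
      simp [hb, hγ]⟩
  -- This `t` is fixed at zero measurement noise; negativity there then persists for small `σ` by
  -- continuity.
  obtain ⟨t, ht, ht0, htT⟩ := (hneg.and (Ioc_mem_nhdsGT (lt_min hT hσmax))).exists
  have hquad : Continuous fun σ => prodCoeff b ⬝ᵥ (M (σ, t) *ᵥ prodCoeff b) := by
    have : Continuous fun σ => M (σ, t) := hMc.comp (by fun_prop)
    fun_prop
  have hev : ∀ᶠ σ in 𝓝 (0 : ℝ), prodCoeff b ⬝ᵥ (M (σ, t) *ᵥ prodCoeff b) < 0 := by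
    refine hquad.tendsto 0 |>.eventually_lt_const ?_
    simpa [hM] using ht
  filter_upwards [hev.filter_mono nhdsWithin_le_nhds] with σ hσ
  -- At candidate level `0` nothing is denoised, so the matrix is the genuine moment matrix of the
  -- noisy data and is positive semidefinite.
  obtain ⟨t', ht', hdet⟩ := exists_det_eq_zero_of_path (fun t => M (σ, t))
    (hMc.comp (by fun_prop)) (fun t => noisyMomentMatrix_isHermitian _ _ _) t ht0.le
    (by
      have := momentMatrix_posSemidef (na := na) (nc := nc) (n := n) (N := N)
        (fun k => x k + σ * ξ k) u
      rwa [← noisyMomentMatrix_zero] at this) _ hσ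
  have hex : ∃ t ∈ Set.Icc 0 σmax,
      (noisyMomentMatrix na nc n N (fun k => x k + σ * ξ k) u t).det = 0 :=
    ⟨t', ⟨ht'.1, ht'.2.trans (htT.trans (min_le_right _ _))⟩, hdet⟩
  refine ⟨exists_isNoiseLevelEstimate hex, fun s hs => ?_⟩
  rw [isNoiseLevelEstimate_iff hex] at hs
  exact ⟨hs.1.1.1, (hs.2 ⟨⟨ht'.1, ht'.2.trans (htT.trans (min_le_right _ _))⟩, hdet⟩).trans
    (ht'.2.trans (htT.trans (min_le_left _ _))), hs.1.2⟩

/-! ### Limits along ultrafilters -/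

/-- If the claim failed, counterexamples could be selected along an ultrafilter. This makes later
claims uniform over all ways of breaking ties. Along an ultrafilter, unit vectors converge and
finitely valued choices are eventually constant, so no subsequences are needed. -/
lemma eventually_forall_of_ultrafilter {α β : Type*} {l : Filter α} {Q R : α → β → Prop}
    (h : ∀ F : Ultrafilter α, (F : Filter α) ≤ l → ∀ z : α → β, (∀ᶠ a in F, Q a (z a)) →
      ∀ᶠ a in F, R a (z a)) :
    ∀ᶠ a in l, ∀ z, Q a z → R a z := by
  rw [Filter.Eventually, Filter.mem_iff_ultrafilter]
  intro F hF
  by_contra hcon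
  have hcon' : ∀ᶠ a in F, ∃ z, Q a z ∧ ¬ R a z := by
    have := Ultrafilter.eventually_not.2 hcon
    filter_upwards [this] with a ha
    push Not at ha
    exact ha
  obtain ⟨a₀, z₀, -⟩ := hcon'.exists
  have : Nonempty β := ⟨z₀⟩
  choose! z hz using fun a (ha : ∃ z, Q a z ∧ ¬ R a z) => ha
  have h1 := h F hF z (hcon'.mono fun a ha => (hz a ha).1)
  obtain ⟨a, ha, ha'⟩ := (h1.and hcon').exists
  exact (hz a ha').2 ha

lemma exists_eventually_eq_of_finite {α β : Type*} (F : Ultrafilter α) (f : α → β) {s : Set β}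
    (hs : s.Finite) (hf : ∀ᶠ a in F, f a ∈ s) : ∃ y ∈ s, ∀ᶠ a in F, f a = y := by
  have h : (⋃ y ∈ s, {a | f a = y}) ∈ F := by
    filter_upwards [hf] with a ha
    simpa using ha
  rwa [Ultrafilter.finite_biUnion_mem_iff hs] at h

lemma exists_tendsto_unit_vector {α m : Type*} [Fintype m] (F : Ultrafilter α) (v : α → m → ℝ)
    (hv : ∀ᶠ a in F, v a ⬝ᵥ v a = 1) : ∃ w, w ⬝ᵥ w = 1 ∧ Tendsto v F (𝓝 w) := by
  obtain ⟨w, hw, h⟩ := isCompact_unit_vectors.ultrafilter_le_nhds (F.map v)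
    (by rw [Filter.le_principal_iff]; exact hv)
  exact ⟨w, hw, h⟩

lemma exists_smul_of_finrank_ker {m : Type*} [Fintype m] [DecidableEq m] {A : Matrix m m ℝ}
    (hA : Module.finrank ℝ (LinearMap.ker A.mulVecLin) = 1) {c w : m → ℝ} (hc : A *ᵥ c = 0)
    (hc0 : c ≠ 0) (hw : A *ᵥ w = 0) : ∃ κ : ℝ, w = κ • c := by
  have h := (finrank_eq_one_iff_of_nonzero' (⟨c, by simpa using hc⟩ : LinearMap.ker A.mulVecLin)
    (by simpa using hc0)).1 hA ⟨w, by simpa using hw⟩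
  obtain ⟨κ, hκ⟩ := h
  exact ⟨κ, by simpa using (congrArg Subtype.val hκ).symm⟩

/-! ### Existence and limits of the polynomial differentiation algorithm. -/

lemma euclNorm_pos {ι : Type*} [Fintype ι] {v : ι → ℝ} (hv : v ≠ 0) : 0 < euclNorm v := by
  have h0 : 0 ≤ v ⬝ᵥ v := Finset.sum_nonneg fun i _ => mul_self_nonneg _
  exact Real.sqrt_pos.2 (lt_of_le_of_ne h0 fun h => hv (dotProduct_self_eq_zero.1 h.symm))

lemma continuous_euclNorm {ι : Type*} [Fintype ι] :
    Continuous (euclNorm : (ι → ℝ) → ℝ) := by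
  unfold euclNorm
  fun_prop

lemma pdaObjective_congr {ι : Type*} [Fintype ι] {n : ℕ} (ε : ℝ) (p : MvPolynomial ι ℝ)
    {g g' : Fin n → ι → ℝ} (i : Fin n) (h : ∀ j < i, g j = g' j) (r : ι → ℝ) :
    pdaObjective ε p g i r = pdaObjective ε p g' i r := by
  unfold pdaObjective
  congr 2
  refine Finset.prod_congr rfl fun j hj => ?_
  rw [h j (by simpa using hj)]

/-- The objective at stage `i` involves only the normals with smaller index (`pdaObjective_congr`).
Hence the normals can be filled in one index at a time without disturbing earlier stages. -/
lemma exists_isPDAOutput {ι : Type*} [Fintype ι] {n : ℕ} (ε : ℝ) (p : MvPolynomial ι ℝ) (N : ℕ)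
    (r : ℕ → ι → ℝ) (h : ∃ k ∈ Finset.Icc 1 N, polyGrad p (r k) ≠ 0) :
    ∃ g : Fin n → ι → ℝ, IsPDAOutput ε p N r g := by
  classical
  have hstep : ∀ (g : Fin n → ι → ℝ) (i : Fin n), ∃ k ∈ Finset.Icc 1 N, polyGrad p (r k) ≠ 0 ∧
      ∀ k' ∈ Finset.Icc 1 N, polyGrad p (r k') ≠ 0 →
        pdaObjective ε p g i (r k) ≤ pdaObjective ε p g i (r k') := by
    intro g i
    obtain ⟨k, hk, hmin⟩ := ((Finset.Icc 1 N).filter fun k => polyGrad p (r k) ≠ 0).exists_min_image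
      (fun k => pdaObjective ε p g i (r k))
      (by obtain ⟨k, hk, hk'⟩ := h; exact ⟨k, by simp [hk', Finset.mem_Icc.1 hk]⟩)
    rw [Finset.mem_filter] at hk
    exact ⟨k, hk.1, hk.2, fun k' h1 h2 => hmin k' (by rw [Finset.mem_filter]; exact ⟨h1, h2⟩)⟩
  have key : ∀ m : ℕ, ∃ g : Fin n → ι → ℝ, ∀ i : Fin n, (i : ℕ) < m →
      ∃ k ∈ Finset.Icc 1 N, polyGrad p (r k) ≠ 0 ∧
      (∀ k' ∈ Finset.Icc 1 N, polyGrad p (r k') ≠ 0 →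
        pdaObjective ε p g i (r k) ≤ pdaObjective ε p g i (r k')) ∧
      g i = (euclNorm (polyGrad p (r k)))⁻¹ • polyGrad p (r k) := by
    intro m
    induction m with
    | zero => exact ⟨0, fun i hi => absurd hi (Nat.not_lt_zero _)⟩
    | succ m ih =>
      obtain ⟨g, hg⟩ := ih
      by_cases hm : m < n
      · obtain ⟨k, hk, hk0, hmin⟩ := hstep g ⟨m, hm⟩
        set g' := Function.update g ⟨m, hm⟩
          ((euclNorm (polyGrad p (r k)))⁻¹ • polyGrad p (r k)) with hg'
        have hagree : ∀ i : Fin n, (i : ℕ) ≤ m → ∀ j < i, g' j = g j := by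
          intro i hi j hj
          rw [hg', Function.update_of_ne]
          intro e
          rw [e, Fin.lt_def] at hj
          simp at hj
          omega
        refine ⟨g', fun i hi => ?_⟩
        rcases Nat.lt_succ_iff_lt_or_eq.1 hi with him | him
        · obtain ⟨k, hk, hk0, hmin, heq⟩ := hg i him
          refine ⟨k, hk, hk0, fun k' h1 h2 => ?_, ?_⟩
          · rw [pdaObjective_congr ε p i (hagree i him.le), pdaObjective_congr ε p i (hagree i him.le)]
            exact hmin k' h1 h2
          · rw [hg', Function.update_of_ne, heq]
            rintro rfl
            simp at him
        · have hi' : i = ⟨m, hm⟩ := Fin.ext him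
          subst hi'
          refine ⟨k, hk, hk0, fun k' h1 h2 => ?_, ?_⟩
          · rw [pdaObjective_congr ε p _ (hagree _ le_rfl), pdaObjective_congr ε p _ (hagree _ le_rfl)]
            exact hmin k' h1 h2
          · rw [hg', Function.update_self]
      · exact ⟨g, fun i _ => hg i (by have := i.2; omega)⟩
  obtain ⟨g, hg⟩ := key n
  exact ⟨g, fun i => hg i i.2⟩

/-- In the limit along an ultrafilter, the polynomial differentiation algorithm finds every
submodel exactly once. -/
lemma IsPDAOutput.exists_tendsto {α ι : Type*} [Fintype ι] {n N : ℕ} (F : Ultrafilter α) {ε : ℝ}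
    (hε : 0 < ε) {p : α → MvPolynomial ι ℝ} {r : α → ℕ → ι → ℝ} {g : α → Fin n → ι → ℝ}
    (hg : ∀ᶠ a in F, IsPDAOutput ε (p a) N (r a) (g a))
    {r₀ : ℕ → ι → ℝ} {b : Fin n → ι → ℝ} {δ : ℕ → Fin n} {γ : ℕ → ℝ}
    (hr : ∀ k ∈ Finset.Icc 1 N, Tendsto (fun a => r a k) F (𝓝 (r₀ k)))
    (hp : ∀ k ∈ Finset.Icc 1 N, Tendsto (fun a => MvPolynomial.eval (r a k) (p a)) F (𝓝 0))
    (hgrad : ∀ k ∈ Finset.Icc 1 N,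
      Tendsto (fun a => polyGrad (p a) (r a k)) F (𝓝 (γ k • b (δ k))))
    (hγ : ∀ k ∈ Finset.Icc 1 N, γ k ≠ 0) (hb : ∀ i, b i ≠ 0)
    (hz : ∀ k ∈ Finset.Icc 1 N, b (δ k) ⬝ᵥ r₀ k = 0)
    (hd : ∀ k ∈ Finset.Icc 1 N, ∀ i, i ≠ δ k → b i ⬝ᵥ r₀ k ≠ 0)
    (hvis : ∀ i, ∃ k ∈ Finset.Icc 1 N, δ k = i) :
    ∃ (ρ : Equiv.Perm (Fin n)) (τ : Fin n → ℝ), (∀ i, τ i ≠ 0) ∧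
      ∀ i, Tendsto (fun a => g a i) F (𝓝 (τ i • b (ρ i))) := by
  classical
  choose! κ hκN hκ0 hκmin hκg using fun a (i : Fin n) (h : IsPDAOutput ε (p a) N (r a) (g a)) => h i
  -- There are only `N` data points to choose from, so each selected index is constant along the
  -- ultrafilter.
  have hconst : ∀ i, ∃ k ∈ Finset.Icc 1 N, ∀ᶠ a in F, κ a i = k := fun i =>
    exists_eventually_eq_of_finite F (fun a => κ a i) (Finset.finite_toSet (Finset.Icc 1 N))
      (hg.mono fun a ha => hκN a i ha)
  choose k hkN hk using hconst
  have hgradne : ∀ k ∈ Finset.Icc 1 N, γ k • b (δ k) ≠ 0 := fun k hk =>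
    smul_ne_zero (hγ k hk) (hb _)
  set τ : Fin n → ℝ := fun i => (euclNorm (γ (k i) • b (δ (k i))))⁻¹ * γ (k i) with hτ
  have hτ0 : ∀ i, τ i ≠ 0 := fun i =>
    mul_ne_zero (inv_ne_zero (euclNorm_pos (hgradne _ (hkN i))).ne') (hγ _ (hkN i))
  have hlim : ∀ i, Tendsto (fun a => g a i) F (𝓝 (τ i • b (δ (k i)))) := by
    intro i
    have h1 := hgrad (k i) (hkN i)
    have h2 := ((continuous_euclNorm.tendsto _).comp h1).inv₀
      (euclNorm_pos (hgradne _ (hkN i))).ne'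
    have h3 := h2.smul h1
    rw [smul_smul] at h3
    refine h3.congr' ?_
    filter_upwards [hg, hk i] with a ha hka
    rw [hκg a i ha, hka]
    rfl
  have hobj : ∀ i, ∀ m ∈ Finset.Icc 1 N, Tendsto (fun a => pdaObjective ε (p a) (g a) i (r a m)) F
      (𝓝 ((|0| / euclNorm (γ m • b (δ m)) + ε)
        / (∏ j ∈ Finset.univ.filter (fun j => j < i), |(τ j • b (δ (k j))) ⬝ᵥ r₀ m| + ε))) := by
    intro i m hm
    refine Tendsto.div (Tendsto.add (Tendsto.div (hp m hm).abs
      ((continuous_euclNorm.tendsto _).comp (hgrad m hm)) (euclNorm_pos (hgradne m hm)).ne')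
      tendsto_const_nhds) (Tendsto.add (tendsto_finsetProd _ fun j _ => Tendsto.abs ?_)
      tendsto_const_nhds) ?_
    · have hc : Continuous fun q : (ι → ℝ) × (ι → ℝ) => q.1 ⬝ᵥ q.2 :=
        continuous_fst.dotProduct continuous_snd
      exact (hc.tendsto _).comp ((hlim j).prodMk_nhds (hr m hm))
    · positivity
  -- The limiting objective is `ε / (∏ + ε)`. It equals `1` at points of a submodel already found
  -- and is smaller than `1` at points of a new one, so no submodel is chosen twice.
  have hinj : Function.Injective fun i => δ (k i) := by
    have hlt : ∀ i j, j < i → δ (k i) ≠ δ (k j) := by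
      intro i j hji heq
      -- Fewer than `n` indices precede `i`, so some submodel has not been found yet.
      obtain ⟨d, hd'⟩ : ∃ d, d ∉ (Finset.univ.filter fun j => j < i).image fun j => δ (k j) := by
        by_contra! hall
        have h1 : Fintype.card (Fin n)
            ≤ ((Finset.univ.filter fun j => j < i).image fun j => δ (k j)).card := by
          rw [← Finset.card_univ]
          exact Finset.card_le_card fun d _ => hall d
        have h2 := h1.trans Finset.card_image_le
        exact h2.not_gt (Finset.card_lt_univ_of_notMem (x := i) (by simp))
      obtain ⟨m, hm, rfl⟩ := hvis d
      have hle : ∀ᶠ a in F, pdaObjective ε (p a) (g a) i (r a (k i))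
          ≤ pdaObjective ε (p a) (g a) i (r a m) := by
        have hne : ∀ᶠ a in F, polyGrad (p a) (r a m) ≠ 0 :=
          (hgrad m hm).eventually_ne (hgradne m hm)
        filter_upwards [hg, hk i, hne] with a ha hka hne
        have := hκmin a i ha m hm hne
        rwa [hka] at this
      have hle' := le_of_tendsto_of_tendsto (hobj i _ (hkN i)) (hobj i m hm) hle
      have hzero : ∏ j ∈ Finset.univ.filter (fun j => j < i),
          |(τ j • b (δ (k j))) ⬝ᵥ r₀ (k i)| = 0 := by
        refine Finset.prod_eq_zero (i := j) (by simpa using hji) ?_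
        rw [← heq, smul_dotProduct, hz _ (hkN i)]
        simp
      have hpos : 0 < ∏ j ∈ Finset.univ.filter (fun j => j < i),
          |(τ j • b (δ (k j))) ⬝ᵥ r₀ m| := by
        refine Finset.prod_pos fun j' hj' => abs_pos.2 ?_
        rw [smul_dotProduct]
        refine smul_ne_zero (hτ0 _) (hd m hm _ fun e => hd' ?_)
        exact Finset.mem_image.2 ⟨j', hj', e⟩
      rw [hzero, abs_zero, zero_div, zero_div, zero_add, div_self hε.ne',
        le_div_iff₀ (by positivity)] at hle'
      linarith
    intro i j hij
    rcases lt_trichotomy i j with h | h | h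
    · exact absurd hij.symm (hlt j i h)
    · exact h
    · exact absurd hij (hlt i j h)
  refine ⟨Equiv.ofBijective _ (Finite.injective_iff_bijective.1 hinj), τ, hτ0, fun i => ?_⟩
  simpa using hlim i

/-! ### Maximum likelihood switching sequences -/

/-- The matrix that maps the noise samples to the residuals of a snippet. -/
def snippetNoiseMatrix {na nc n nl : ℕ} (b : Fin n → RegIdx na nc → ℝ) (s : Fin nl → Fin n) :
    Matrix (Fin nl) (Fin (nl + na)) ℝ :=
  Matrix.of fun t m => ∑ j : Fin (na + 1),
    if (t : ℕ) + na = (m : ℕ) + (j : ℕ) then b (s t) (Sum.inl j) else 0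

/-- Column `m` stands for the noise sample `na - m` steps before the snippet start. The shift by
`na` keeps the indices natural. -/
lemma snippetCov_eq_mul_transpose {na nc n nl : ℕ} (b : Fin n → RegIdx na nc → ℝ)
    (s : Fin nl → Fin n) :
    snippetCov b 1 s = snippetNoiseMatrix b s * (snippetNoiseMatrix b s)ᵀ := by
  ext t t'
  rw [Matrix.mul_apply]
  simp only [snippetCov, snippetNoiseMatrix, Matrix.of_apply, Matrix.transpose_apply, one_pow,
    one_mul, Finset.sum_mul_sum]
  symm
  rw [Finset.sum_comm]
  refine Finset.sum_congr rfl fun j _ => ?_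
  rw [Finset.sum_comm]
  refine Finset.sum_congr rfl fun j' _ => ?_
  have hj := j.2
  have ht := t.2
  -- The only column that row `t` meets at lag `j`.
  rw [Finset.sum_eq_single (⟨(t : ℕ) + na - j, by omega⟩ : Fin (nl + na))]
  · rw [if_pos (by simp; omega)]
    by_cases h : (t : ℕ) + (j' : ℕ) = (t' : ℕ) + (j : ℕ)
    · rw [if_pos h, if_pos (by simp; omega)]
    · rw [if_neg h, if_neg (by simp; omega), mul_zero]
  · intro m _ hm
    rw [if_neg, zero_mul]
    intro h
    apply hm
    ext
    simp
    omega
  · simp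

/-- The noise matrix is in echelon form: column `t + na` is the newest noise sample of row `t`, with
coefficient `b (s t) (Sum.inl 0) ≠ 0`, and earlier rows do not see it. Looking at the last nonzero
weight shows that the rows are independent. -/
lemma snippetCov_posDef {na nc n nl : ℕ} {b : Fin n → RegIdx na nc → ℝ}
    (hb : ∀ i, b i (Sum.inl 0) ≠ 0) (s : Fin nl → Fin n) : (snippetCov b 1 s).PosDef := by
  rw [snippetCov_eq_mul_transpose, ← Matrix.conjTranspose_eq_transpose_of_trivial]
  refine Matrix.PosDef.mul_conjTranspose_self _ ?_
  rw [← Matrix.coe_vecMulLinear, ← LinearMap.ker_eq_bot, LinearMap.ker_eq_bot']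
  intro w hw
  by_contra hne
  have hne' : (Finset.univ.filter fun t => w t ≠ 0).Nonempty := by
    by_contra hemp
    apply hne
    funext t
    by_contra ht
    exact hemp ⟨t, by simpa using ht⟩
  obtain ⟨t, ht, hmax⟩ := Finset.exists_max_image _ (fun t : Fin nl => (t : ℕ)) hne'
  have hwt : w t ≠ 0 := by simpa using ht
  have h := congrFun hw ⟨(t : ℕ) + na, by have := t.2; omega⟩
  rw [Matrix.vecMulLinear_apply, Matrix.vecMul, dotProduct, Finset.sum_eq_single t] at h
  · rw [snippetNoiseMatrix, Matrix.of_apply, Finset.sum_eq_single 0] at h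
    · simp [hwt, hb] at h
    · intro j _ hj
      rw [if_neg]
      simp only [left_eq_add]
      exact fun e => hj (Fin.ext e)
    · simp
  · intro t' _ htt'
    by_cases hw' : w t' = 0
    · simp [hw']
    · have hle := hmax t' (by simpa using hw')
      have hlt : (t' : ℕ) < t := lt_of_le_of_ne hle fun e => htt' (Fin.ext e)
      rw [snippetNoiseMatrix, Matrix.of_apply, Finset.sum_eq_zero, mul_zero]
      intro j _
      rw [if_neg]
      simp only
      omega
  · simp

lemma snippetCov_eq_smul {na nc n nl : ℕ} (b : Fin n → RegIdx na nc → ℝ) (σ : ℝ)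
    (s : Fin nl → Fin n) : snippetCov b σ s = (σ ^ 2) • snippetCov b 1 s := by
  ext t t'
  simp [snippetCov]

lemma continuous_snippetCov {na nc n nl : ℕ} (s : Fin nl → Fin n) :
    Continuous fun b : Fin n → RegIdx na nc → ℝ => snippetCov b 1 s := by
  refine continuous_matrix fun t t' => ?_
  simp only [snippetCov, Matrix.of_apply]
  refine continuous_const.mul (continuous_finsetSum _ fun j _ => continuous_finsetSum _ fun j' _ => ?_)
  split_ifs
  · fun_prop
  · fun_prop

/-- The first factor is the same for all switching sequences and cancels when likelihoods are
compared. -/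
lemma normalDensity_smul {m : ℕ} {S : Matrix (Fin m) (Fin m) ℝ} (hS : 0 < S.det) {σ : ℝ}
    (hσ : 0 < σ) (z : Fin m → ℝ) :
    normalDensity ((σ ^ 2) • S) z = (Real.sqrt ((2 * Real.pi) ^ m * (σ ^ 2) ^ m))⁻¹ *
      ((Real.sqrt S.det)⁻¹ * Real.exp (-(z ⬝ᵥ (S⁻¹ *ᵥ z) * ((2 : ℝ)⁻¹ * (σ ^ 2)⁻¹)))) := by
  have hinv : ((σ ^ 2) • S)⁻¹ = (σ ^ 2)⁻¹ • S⁻¹ := by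
    apply Matrix.inv_eq_left_inv
    rw [Matrix.smul_mul, Matrix.mul_smul, smul_smul, inv_mul_cancel₀ (by positivity), one_smul,
      Matrix.nonsing_inv_mul _ (isUnit_iff_ne_zero.2 hS.ne')]
  rw [normalDensity, hinv, Matrix.det_smul, Fintype.card_fin, ← mul_assoc,
    Real.sqrt_mul (by positivity), mul_inv, mul_assoc, Matrix.smul_mulVec, dotProduct_smul,
    smul_eq_mul]
  congr 3
  ring

lemma continuous_regressor {na nc : ℕ} (u : ℤ → ℝ) (k : ℤ) :
    Continuous fun y : ℤ → ℝ => regressor na nc y u k := by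
  refine continuous_pi fun i => ?_
  rcases i with j | j
  · exact continuous_apply (k - (j : ℕ))
  · exact continuous_const

lemma continuous_snippetResidual {na nc n nl : ℕ} (u : ℤ → ℝ) (k : ℕ) (e : Fin nl → Fin n) :
    Continuous fun q : (Fin n → RegIdx na nc → ℝ) × (ℤ → ℝ) =>
      snippetResidual q.1 q.2 u k e := by
  refine continuous_pi fun t => ?_
  unfold snippetResidual
  exact (Continuous.dotProduct ((continuous_apply (e t)).comp continuous_fst)
    ((continuous_regressor u _).comp continuous_snd)).neg

/-- If the coefficient estimates converge to the true ones and the estimated noise level tends to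
zero through positive values, then the only possible limit of maximum likelihood switching sequences
is a sequence with vanishing residuals. -/
lemma IsMLSwitching.residual_eq_zero {α : Type*} {F : Filter α} [F.NeBot] {na nc n nl : ℕ}
    {b : α → Fin n → RegIdx na nc → ℝ} {b₀ : Fin n → RegIdx na nc → ℝ} {s : α → ℝ}
    {y : α → ℤ → ℝ} {x u : ℤ → ℝ} {k : ℕ} {d d₀ : Fin nl → Fin n}
    (hML : ∀ᶠ a in F, IsMLSwitching (b a) (s a) (y a) u k d)
    (hb : Tendsto b F (𝓝 b₀)) (hb₀ : ∀ i, b₀ i (Sum.inl 0) ≠ 0)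
    (hs : Tendsto s F (𝓝 0)) (hs0 : ∀ᶠ a in F, 0 < s a)
    (hy : Tendsto y F (𝓝 x)) (hd₀ : snippetResidual b₀ x u k d₀ = 0) :
    snippetResidual b₀ x u k d = 0 := by
  by_contra hne
  have hres : ∀ e : Fin nl → Fin n, Tendsto (fun a => snippetResidual (b a) (y a) u k e) F
      (𝓝 (snippetResidual b₀ x u k e)) := by
    intro e
    have hc := continuous_snippetResidual (na := na) (nc := nc) u k e
    have h1 : Tendsto (fun a => (b a, y a)) F (𝓝 (b₀, x)) := hb.prodMk_nhds hy
    have h2 := (hc.tendsto (b₀, x)).comp h1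
    simpa only [Function.comp_def] using h2
  have hcov : ∀ e : Fin nl → Fin n, Tendsto (fun a => snippetCov (b a) 1 e) F
      (𝓝 (snippetCov b₀ 1 e)) := fun e => ((continuous_snippetCov e).tendsto b₀).comp hb
  have hdet0 : ∀ e : Fin nl → Fin n, 0 < (snippetCov b₀ 1 e).det := fun e =>
    (snippetCov_posDef hb₀ e).det_pos
  have hdet : ∀ e : Fin nl → Fin n, Tendsto (fun a => (snippetCov (b a) 1 e).det) F
      (𝓝 (snippetCov b₀ 1 e).det) := fun e =>
    ((continuous_id.matrix_det).tendsto (snippetCov b₀ 1 e)).comp (hcov e)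
  have hinv : ∀ e : Fin nl → Fin n, Tendsto (fun a => (snippetCov (b a) 1 e)⁻¹) F
      (𝓝 (snippetCov b₀ 1 e)⁻¹) := by
    intro e
    simp only [Matrix.inv_def, Ring.inverse_eq_inv']
    exact ((hdet e).inv₀ (hdet0 e).ne').smul
      (((continuous_id.matrix_adjugate).tendsto (snippetCov b₀ 1 e)).comp (hcov e))
  have hquad : ∀ e : Fin nl → Fin n, Tendsto (fun a => snippetResidual (b a) (y a) u k e ⬝ᵥ
      ((snippetCov (b a) 1 e)⁻¹ *ᵥ snippetResidual (b a) (y a) u k e)) F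
      (𝓝 (snippetResidual b₀ x u k e ⬝ᵥ
        ((snippetCov b₀ 1 e)⁻¹ *ᵥ snippetResidual b₀ x u k e))) := by
    intro e
    have hc : Continuous fun q : Matrix (Fin nl) (Fin nl) ℝ × (Fin nl → ℝ) =>
        q.2 ⬝ᵥ (q.1 *ᵥ q.2) :=
      continuous_snd.dotProduct (continuous_fst.matrix_mulVec continuous_snd)
    exact (hc.tendsto (_, _)).comp ((hinv e).prodMk_nhds (hres e))
  set q : α → (Fin nl → Fin n) → ℝ := fun a e => snippetResidual (b a) (y a) u k e ⬝ᵥ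
      ((snippetCov (b a) 1 e)⁻¹ *ᵥ snippetResidual (b a) (y a) u k e) with hq
  have hqd : 0 < snippetResidual b₀ x u k d ⬝ᵥ
      ((snippetCov b₀ 1 d)⁻¹ *ᵥ snippetResidual b₀ x u k d) := by
    simpa using (snippetCov_posDef hb₀ d).inv.dotProduct_mulVec_pos hne
  have hdiff : Tendsto (fun a => q a d - q a d₀) F (𝓝 (snippetResidual b₀ x u k d ⬝ᵥ
      ((snippetCov b₀ 1 d)⁻¹ *ᵥ snippetResidual b₀ x u k d))) := by
    simpa [hd₀] using (hquad d).sub (hquad d₀)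
  have hs2 : Tendsto (fun a => (2 : ℝ)⁻¹ * (s a ^ 2)⁻¹) F atTop := by
    refine Tendsto.const_mul_atTop (by norm_num) (Tendsto.inv_tendsto_nhdsGT_zero ?_)
    rw [tendsto_nhdsWithin_iff]
    refine ⟨by simpa using hs.pow 2, hs0.mono fun a ha => ?_⟩
    rw [Set.mem_Ioi]
    positivity
  have hexp : Tendsto (fun a => Real.exp (-((q a d - q a d₀) * ((2 : ℝ)⁻¹ * (s a ^ 2)⁻¹)))) F
      (𝓝 0) :=
    Real.tendsto_exp_neg_atTop_nhds_zero.comp (hdiff.pos_mul_atTop hqd hs2)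
  -- The likelihood inequality against `d₀`, solved for the determinant of `d`. If the residual of
  -- `d` did not vanish, the right side would tend to `0` while the left side has a positive limit.
  have hle : ∀ᶠ a in F, Real.sqrt (snippetCov (b a) 1 d).det
      ≤ Real.sqrt (snippetCov (b a) 1 d₀).det
        * Real.exp (-((q a d - q a d₀) * ((2 : ℝ)⁻¹ * (s a ^ 2)⁻¹))) := by
    filter_upwards [hML, hs0, (hdet d).eventually_const_lt (hdet0 d),
      (hdet d₀).eventually_const_lt (hdet0 d₀)] with a hML hs0 hdd hdd₀
    have h := hML d₀
    rw [snippetCov_eq_smul _ _ d₀, snippetCov_eq_smul _ _ d, normalDensity_smul hdd₀ hs0,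
      normalDensity_smul hdd hs0] at h
    have hpos : 0 < (Real.sqrt ((2 * Real.pi) ^ nl * (s a ^ 2) ^ nl))⁻¹ := by
      have := Real.pi_pos
      positivity
    have h' := le_of_mul_le_mul_left h hpos
    have e1 := Real.sqrt_pos.2 hdd
    have e2 := Real.sqrt_pos.2 hdd₀
    rw [inv_mul_le_iff₀ e2, mul_left_comm (Real.sqrt (snippetCov (b a) 1 d₀).det),
      le_inv_mul_iff₀ e1] at h'
    have e3 := Real.exp_pos (-(q a d₀ * ((2 : ℝ)⁻¹ * (s a ^ 2)⁻¹)))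
    rw [← mul_le_mul_iff_left₀ e3]
    refine h'.trans (le_of_eq ?_)
    rw [mul_assoc, ← Real.exp_add]
    congr 2
    ring
  have hlim := le_of_tendsto_of_tendsto
    ((Real.continuous_sqrt.tendsto _).comp (hdet d))
    (((Real.continuous_sqrt.tendsto _).comp (hdet d₀)).mul hexp) hle
  rw [mul_zero] at hlim
  exact absurd hlim (not_le.2 (Real.sqrt_pos.2 (hdet0 d)))

lemma exists_isMLSwitching {na nc n nl : ℕ} [Nonempty (Fin n)] (b : Fin n → RegIdx na nc → ℝ)
    (σ : ℝ) (y u : ℤ → ℝ) (k : ℕ) : ∃ s : Fin nl → Fin n, IsMLSwitching b σ y u k s :=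
  Finite.exists_max fun s : Fin nl → Fin n =>
    normalDensity (snippetCov b σ s) (snippetResidual b y u k s)

/-! ### Maximum likelihood transition matrices -/

lemma exists_isTransitionMLE {n : ℕ} (m : Fin n → Fin n → ℕ) : ∃ Q, IsTransitionMLE m Q := by
  have hset : (Matrix.rowStochastic ℝ (Fin n) : Set (Matrix (Fin n) (Fin n) ℝ))
      = {Q | (∀ i j, 0 ≤ Q i j) ∧ ∀ i, ∑ j, Q i j = 1} := by
    ext Q
    exact Matrix.mem_rowStochastic_iff_sum
  have hcl : IsClosed (Matrix.rowStochastic ℝ (Fin n) : Set (Matrix (Fin n) (Fin n) ℝ)) := by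
    rw [hset]
    have h1 : IsClosed {Q : Matrix (Fin n) (Fin n) ℝ | ∀ i j, 0 ≤ Q i j} := by
      simp only [Set.ofPred_forall]
      exact isClosed_iInter fun i => isClosed_iInter fun j =>
        isClosed_le continuous_const (by fun_prop)
    have h2 : IsClosed {Q : Matrix (Fin n) (Fin n) ℝ | ∀ i, ∑ j, Q i j = 1} := by
      simp only [Set.ofPred_forall]
      exact isClosed_iInter fun i => isClosed_eq (by fun_prop) continuous_const
    exact h1.inter h2
  have hbox : IsCompact (Set.univ.pi fun _ : Fin n => Set.univ.pi fun _ : Fin n =>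
      Set.Icc (0 : ℝ) 1) := isCompact_univ_pi fun _ => isCompact_univ_pi fun _ => isCompact_Icc
  have hK : IsCompact (Matrix.rowStochastic ℝ (Fin n) : Set (Matrix (Fin n) (Fin n) ℝ)) := by
    refine hbox.of_isClosed_subset hcl fun Q hQ => ?_
    intro i _ j _
    exact ⟨Matrix.nonneg_of_mem_rowStochastic hQ, Matrix.le_one_of_mem_rowStochastic hQ⟩
  have hcont : Continuous fun Q : Matrix (Fin n) (Fin n) ℝ => ∏ i, ∏ j, Q i j ^ m i j := by
    fun_prop
  obtain ⟨Q, hQ, hmax⟩ := hK.exists_isMaxOn ⟨1, (Matrix.rowStochastic ℝ (Fin n)).one_mem⟩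
    hcont.continuousOn
  exact ⟨Q, hQ, fun Q' hQ' => hmax hQ'⟩

/-- The maximum likelihood transition matrix consists of the relative transition frequencies. -/
lemma IsTransitionMLE.eq_div {n : ℕ} {m : Fin n → Fin n → ℕ} {Q : Matrix (Fin n) (Fin n) ℝ}
    (hQ : IsTransitionMLE m Q) (hm : ∀ i, 0 < ∑ j, m i j) (i j : Fin n) :
    Q i j = m i j / ∑ j, (m i j : ℝ) := by
  have hM : ∀ i, 0 < ∑ j, (m i j : ℝ) := fun i => by exact_mod_cast hm i
  set R : Matrix (Fin n) (Fin n) ℝ := Matrix.of fun i j => m i j / ∑ j, (m i j : ℝ) with hR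
  have hRnn : ∀ i j, 0 ≤ R i j := fun i j => div_nonneg (Nat.cast_nonneg _) (hM i).le
  have hRsum : ∀ i, ∑ j, R i j = 1 := fun i => by
    simp only [hR, Matrix.of_apply]
    rw [← Finset.sum_div, div_self (hM i).ne']
  have hRpos : ∀ i j, m i j ≠ 0 → 0 < R i j := fun i j h =>
    div_pos (by positivity) (hM i)
  have hRprod : 0 < ∏ i, ∏ j, R i j ^ m i j := by
    refine Finset.prod_pos fun i _ => Finset.prod_pos fun j _ => ?_
    by_cases h : m i j = 0
    · simp [h]
    · have := hRpos i j h
      positivity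
  have hle := hQ.2 R (Matrix.mem_rowStochastic_iff_sum.2 ⟨hRnn, hRsum⟩)
  have hQprod : 0 < ∏ i, ∏ j, Q i j ^ m i j := hRprod.trans_le hle
  have hQnn : ∀ i j, 0 ≤ Q i j := fun i j => Matrix.nonneg_of_mem_rowStochastic hQ.1
  have hQsum : ∀ i, ∑ j, Q i j = 1 := fun i => Matrix.sum_row_of_mem_rowStochastic hQ.1 i
  have hQpos : ∀ i j, m i j ≠ 0 → 0 < Q i j := by
    intro i j h
    refine lt_of_le_of_ne (hQnn i j) fun e => hQprod.ne' ?_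
    refine Finset.prod_eq_zero (Finset.mem_univ i) (Finset.prod_eq_zero (Finset.mem_univ j) ?_)
    rw [← e, zero_pow h]
  have hlogle : ∑ i, ∑ j, (m i j : ℝ) * Real.log (R i j)
      ≤ ∑ i, ∑ j, (m i j : ℝ) * Real.log (Q i j) := by
    have h := Real.log_le_log hRprod hle
    have hlog : ∀ S : Matrix (Fin n) (Fin n) ℝ, (∀ i j, m i j ≠ 0 → 0 < S i j) →
        Real.log (∏ i, ∏ j, S i j ^ m i j) = ∑ i, ∑ j, (m i j : ℝ) * Real.log (S i j) := by
      intro S hS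
      have hne : ∀ i j, S i j ^ m i j ≠ 0 := by
        intro i j
        by_cases h : m i j = 0
        · simp [h]
        · exact pow_ne_zero _ (hS i j h).ne'
      rw [Real.log_prod (fun i _ => Finset.prod_ne_zero_iff.2 fun j _ => hne i j)]
      refine Finset.sum_congr rfl fun i _ => ?_
      rw [Real.log_prod (fun j _ => hne i j)]
      simp [Real.log_pow]
    rwa [hlog R hRpos, hlog Q hQpos] at h
  -- Gibbs' inequality entry by entry, from `log z ≤ z - 1` at `z = Q i j / R i j`. Optimality of
  -- `Q` forces equality in every entry.
  have hgap : ∀ i j, (m i j : ℝ) * (Real.log (Q i j) - Real.log (R i j))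
      ≤ (∑ j, (m i j : ℝ)) * (if m i j = 0 then 0 else Q i j - R i j) := by
    intro i j
    by_cases h : m i j = 0
    · simp [h]
    · have hq := hQpos i j h
      have hr := hRpos i j h
      rw [if_neg h, ← Real.log_div hq.ne' hr.ne']
      have h1 := Real.log_le_sub_one_of_pos (div_pos hq hr)
      have h2 : (m i j : ℝ) = (∑ j, (m i j : ℝ)) * R i j := by
        simp only [hR, Matrix.of_apply]
        rw [mul_div_cancel₀ _ (hM i).ne']
      calc (m i j : ℝ) * Real.log (Q i j / R i j) ≤ m i j * (Q i j / R i j - 1) := by gcongr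
        _ = (∑ j, (m i j : ℝ)) * (Q i j - R i j) := by
          rw [h2]
          field_simp
  have hrow : ∀ i, (∑ j, (m i j : ℝ)) * ∑ j, (if m i j = 0 then 0 else Q i j - R i j) ≤ 0 := by
    intro i
    refine mul_nonpos_of_nonneg_of_nonpos (hM i).le ?_
    calc ∑ j, (if m i j = 0 then 0 else Q i j - R i j) ≤ ∑ j, (Q i j - R i j) := by
          refine Finset.sum_le_sum fun j _ => ?_
          split_ifs with h
          · simp [hR, h, hQnn]
          · exact le_rfl
      _ = 0 := by rw [Finset.sum_sub_distrib, hQsum, hRsum, sub_self]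
  have hzero : ∀ i j, (m i j : ℝ) * (Real.log (Q i j) - Real.log (R i j))
      = (∑ j, (m i j : ℝ)) * (if m i j = 0 then 0 else Q i j - R i j) := by
    have h1 : ∑ i, ∑ j, (m i j : ℝ) * (Real.log (Q i j) - Real.log (R i j))
        = ∑ i, ∑ j, (∑ j, (m i j : ℝ)) * (if m i j = 0 then 0 else Q i j - R i j) := by
      apply le_antisymm
      · exact Finset.sum_le_sum fun i _ => Finset.sum_le_sum fun j _ => hgap i j
      · have h2 : ∑ i, ∑ j, (∑ j, (m i j : ℝ)) * (if m i j = 0 then 0 else Q i j - R i j) ≤ 0 := by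
          refine Finset.sum_nonpos fun i _ => ?_
          rw [← Finset.mul_sum]
          exact hrow i
        refine h2.trans ?_
        simp_rw [mul_sub, Finset.sum_sub_distrib]
        linarith
    intro i j
    have h3 := (Finset.sum_eq_sum_iff_of_le fun i _ =>
      Finset.sum_le_sum fun j _ => hgap i j).1 h1 i (Finset.mem_univ i)
    exact (Finset.sum_eq_sum_iff_of_le fun j _ => hgap i j).1 h3 j (Finset.mem_univ j)
  have hsupp : ∀ i j, m i j ≠ 0 → Q i j = R i j := by
    intro i j h
    have hq := hQpos i j h
    have hr := hRpos i j h
    have h1 := hzero i j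
    by_contra hne
    have h2 : (m i j : ℝ) = (∑ j, (m i j : ℝ)) * R i j := by
      simp only [hR, Matrix.of_apply]
      rw [mul_div_cancel₀ _ (hM i).ne']
    have h3 := Real.log_lt_sub_one_of_pos (div_pos hq hr)
      (by rwa [ne_eq, div_eq_one_iff_eq hr.ne'])
    have hmpos : (0 : ℝ) < m i j := by positivity
    rw [if_neg h, ← Real.log_div hq.ne' hr.ne'] at h1
    have h4 := mul_lt_mul_of_pos_left h3 hmpos
    rw [h1] at h4
    have h5 : (m i j : ℝ) * (Q i j / R i j - 1) = (∑ j, (m i j : ℝ)) * (Q i j - R i j) := by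
      rw [h2]
      field_simp
    linarith
  suffices h : Q i j = R i j by simpa [hR] using h
  by_cases h : m i j = 0
  -- Off the observed transitions `R` vanishes, and on them the two agree. So `R ≤ Q` entrywise, and
  -- equal row sums leave no room.
  · have hRle : ∀ j, R i j ≤ Q i j := by
      intro j
      by_cases h' : m i j = 0
      · simp [hR, h', hQnn]
      · exact (hsupp i j h').ge
    exact ((Finset.sum_eq_sum_iff_of_le fun j _ => hRle j).1
      ((hRsum i).trans (hQsum i).symm) j (Finset.mem_univ j)).symm
  · exact hsupp i j h

/-! ### The small-noise limit for a fixed sample path and a fixed number of data. -/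

/-- Noise-free data that at every time are explained only by the active submodel, together with a
noise realization for which the first `N` measurements identify the submodels. -/
structure IsIdentifiable {na nc n : ℕ} (N : ℕ) (b : Fin n → RegIdx na nc → ℝ)
    (x u ξ : ℤ → ℝ) (δ : ℕ → Fin n) : Prop where
  one_le : 1 ≤ N
  head : ∀ i, b i (Sum.inl 0) = -1
  active : ∀ k : ℕ, 1 ≤ k → b (δ k) ⬝ᵥ regressor na nc x u k = 0
  inactive : ∀ k : ℕ, 1 ≤ k → ∀ i, i ≠ δ k → b i ⬝ᵥ regressor na nc x u k ≠ 0
  visits : ∀ i, ∃ k ∈ Finset.Icc 1 N, δ k = i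
  finrank_ker : Module.finrank ℝ (LinearMap.ker (momentMatrix na nc n N x u).mulVecLin) = 1
  det_ne_zero : ∀ᶠ σ in 𝓝[>] (0 : ℝ),
    (momentMatrix na nc n N (fun k => x k + σ * ξ k) u).det ≠ 0

lemma tendsto_noisy (x ξ : ℤ → ℝ) {F : Filter ℝ} (hF : F ≤ 𝓝[>] 0) :
    Tendsto (fun σ k => x k + σ * ξ k) F (𝓝 x) := by
  refine Tendsto.mono_left ?_ (hF.trans nhdsWithin_le_nhds)
  have : Continuous fun (σ : ℝ) (k : ℤ) => x k + σ * ξ k := by fun_prop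
  simpa using this.tendsto 0

namespace IsIdentifiable

variable {na nc n N : ℕ} {b : Fin n → RegIdx na nc → ℝ} {x u ξ : ℤ → ℝ} {δ : ℕ → Fin n}

lemma ne_zero (h : IsIdentifiable N b x u ξ δ) (i : Fin n) : b i ≠ 0 := by
  intro h0
  have := h.head i
  rw [h0] at this
  simp at this

lemma momentMatrix_mulVec_prodCoeff (h : IsIdentifiable N b x u ξ δ) :
    momentMatrix na nc n N x u *ᵥ prodCoeff b = 0 := by
  rw [momentMatrix_mulVec_eq_zero_iff h.one_le]
  intro k hk
  rw [prodCoeff_dotProduct_veronese]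
  exact Finset.prod_eq_zero (Finset.mem_univ (δ k)) (h.active k (Finset.mem_Icc.1 hk).1)

end IsIdentifiable

lemma prodCoeff_ne_zero {na nc n : ℕ} {b : Fin n → RegIdx na nc → ℝ}
    (hb : ∀ i, b i (Sum.inl 0) ≠ 0) : prodCoeff b ≠ 0 := by
  intro h0
  have h := prodCoeff_dotProduct_veronese b (Pi.single (Sum.inl 0) 1)
  rw [h0, zero_dotProduct] at h
  exact (Finset.prod_ne_zero_iff.2 fun i _ => by simpa using hb i) h.symm

namespace IsIdentifiable

variable {na nc n N : ℕ} {b : Fin n → RegIdx na nc → ℝ} {x u ξ : ℤ → ℝ} {δ : ℕ → Fin n}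

/-- Strict positivity comes from `det_ne_zero`: the estimate is a zero of the determinant, and `0`
is not one. At level `0` the snippet covariances would degenerate and the likelihood could not
separate switching sequences. -/
lemma tendsto_noiseLevel (h : IsIdentifiable N b x u ξ δ) {σmax : ℝ} (hσmax : 0 < σmax)
    {F : Filter ℝ} (hF : F ≤ 𝓝[>] 0) {s : ℝ → ℝ}
    (hs : ∀ᶠ σ in F, IsNoiseLevelEstimate na nc n N σmax (fun k => x k + σ * ξ k) u (s σ)) :
    Tendsto s F (𝓝 0) ∧ (∀ᶠ σ in F, 0 < s σ) ∧
      ∀ᶠ σ in F, (noisyMomentMatrix na nc n N (fun k => x k + σ * ξ k) u (s σ)).det = 0 := by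
  have key : ∀ T : ℝ, 0 < T → ∀ᶠ σ in F, 0 ≤ s σ ∧ s σ ≤ T ∧
      (noisyMomentMatrix na nc n N (fun k => x k + σ * ξ k) u (s σ)).det = 0 := by
    intro T hT
    filter_upwards [hs, hF (eventually_noiseLevelEstimate (ξ := ξ) h.one_le hσmax h.head h.active
      h.inactive hT)] with σ h1 h2
    exact h2.2 _ h1
  refine ⟨?_, ?_, (key 1 one_pos).mono fun σ hσ => hσ.2.2⟩
  · rw [Metric.tendsto_nhds]
    intro e he
    filter_upwards [key (e / 2) (by positivity)] with σ hσ
    rw [Real.dist_0_eq_abs, abs_of_nonneg hσ.1]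
    linarith [hσ.2.1]
  · filter_upwards [key 1 one_pos, hF h.det_ne_zero] with σ h1 h2
    refine lt_of_le_of_ne h1.1 fun h0 => h2 ?_
    rw [← noisyMomentMatrix_zero]
    have h3 := h1.2.2
    rwa [← h0] at h3

/-- A limit of unit kernel vectors is a unit vector in the kernel of the limit matrix, which is
one-dimensional. The multiple `κ` may depend on the ultrafilter, since the sign is arbitrary. -/
lemma tendsto_singularVector (h : IsIdentifiable N b x u ξ δ) {σmax : ℝ} (hσmax : 0 < σmax)
    {F : Ultrafilter ℝ} (hF : (F : Filter ℝ) ≤ 𝓝[>] 0) {s : ℝ → ℝ} {v : ℝ → MonIdx na nc n → ℝ}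
    (hs : ∀ᶠ σ in F, IsNoiseLevelEstimate na nc n N σmax (fun k => x k + σ * ξ k) u (s σ))
    (hv : ∀ᶠ σ in F, IsMinSingularVector
      (noisyMomentMatrix na nc n N (fun k => x k + σ * ξ k) u (s σ)) (v σ)) :
    ∃ κ : ℝ, κ ≠ 0 ∧ Tendsto v F (𝓝 (κ • prodCoeff b)) := by
  obtain ⟨hs0, -, hdet⟩ := h.tendsto_noiseLevel hσmax hF hs
  obtain ⟨w, hw1, hw⟩ := exists_tendsto_unit_vector F v (hv.mono fun σ hσ => hσ.1)
  have hM : Tendsto (fun σ => noisyMomentMatrix na nc n N (fun k => x k + σ * ξ k) u (s σ)) F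
      (𝓝 (momentMatrix na nc n N x u)) := by
    have h1 := (continuous_noisyMomentMatrix (na := na) (nc := nc) (n := n) (N := N) x ξ u).tendsto
      (0, 0)
    have h2 : Tendsto (fun σ => (σ, s σ)) F (𝓝 ((0 : ℝ), (0 : ℝ))) :=
      Tendsto.prodMk_nhds (tendsto_id.mono_left (hF.trans nhdsWithin_le_nhds)) hs0
    have h3 := h1.comp h2
    simpa [noisyMomentMatrix_zero, Function.comp_def] using h3
  have hMw : momentMatrix na nc n N x u *ᵥ w = 0 := by
    have hc : Continuous fun q : Matrix (MonIdx na nc n) (MonIdx na nc n) ℝ × (MonIdx na nc n → ℝ)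
      => q.1 *ᵥ q.2 := continuous_fst.matrix_mulVec continuous_snd
    have h1 := (hc.tendsto (_, _)).comp (hM.prodMk_nhds hw)
    refine tendsto_nhds_unique h1 (Tendsto.congr' ?_ tendsto_const_nhds)
    filter_upwards [hv, hdet] with σ h2 h3
    exact (h2.mulVec_eq_zero ((minSingularValue_eq_zero_iff _).2 h3)).symm
  obtain ⟨κ, hκ⟩ := exists_smul_of_finrank_ker h.finrank_ker h.momentMatrix_mulVec_prodCoeff
    (prodCoeff_ne_zero fun i => by simp [h.head]) hMw
  refine ⟨κ, ?_, hκ ▸ hw⟩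
  rintro rfl
  simp [hκ] at hw1

lemma exists_polyGrad_limit (h : IsIdentifiable N b x u ξ δ) {κ : ℝ} (hκ : κ ≠ 0) :
    ∃ γ : ℕ → ℝ, (∀ k ∈ Finset.Icc 1 N, γ k ≠ 0) ∧
      ∀ (F : Filter ℝ), F ≤ 𝓝[>] 0 → ∀ v : ℝ → MonIdx na nc n → ℝ,
        Tendsto v F (𝓝 (κ • prodCoeff b)) → ∀ k ∈ Finset.Icc 1 N,
          Tendsto (fun σ => polyGrad (veroneseForm (v σ))
            (regressor na nc (fun k => x k + σ * ξ k) u k)) F (𝓝 (γ k • b (δ k))) := by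
  choose! γ hγ0 hγ using fun (k : ℕ) (hk : 1 ≤ k) =>
    exists_polyGrad_prodForm (h.active k hk) (h.inactive k hk)
  refine ⟨fun k => κ * γ k, fun k hk => mul_ne_zero hκ (hγ0 k (Finset.mem_Icc.1 hk).1), ?_⟩
  intro F hF v hv k hk
  have hr := ((continuous_regressor (na := na) (nc := nc) u k).tendsto x).comp
    (tendsto_noisy x ξ hF)
  have h1 := ((continuous_polyGrad (na := na) (nc := nc) (n := n)).tendsto
    (κ • prodCoeff b, regressor na nc x u k)).comp (hv.prodMk_nhds hr)
  have h2 : polyGrad (veroneseForm (κ • prodCoeff b)) (regressor na nc x u k)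
      = (κ * γ k) • b (δ k) := by
    rw [veroneseForm_smul, polyGrad_C_mul, veroneseForm_prodCoeff, hγ k (Finset.mem_Icc.1 hk).1,
      smul_smul]
  simp only [h2] at h1
  simpa only [Function.comp_def] using h1

lemma exists_tendsto_pda (h : IsIdentifiable N b x u ξ δ) {σmax ε : ℝ} (hσmax : 0 < σmax)
    (hε : 0 < ε) {F : Ultrafilter ℝ} (hF : (F : Filter ℝ) ≤ 𝓝[>] 0) {s : ℝ → ℝ}
    {v : ℝ → MonIdx na nc n → ℝ} {g : ℝ → Fin n → RegIdx na nc → ℝ}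
    (hs : ∀ᶠ σ in F, IsNoiseLevelEstimate na nc n N σmax (fun k => x k + σ * ξ k) u (s σ))
    (hv : ∀ᶠ σ in F, IsMinSingularVector
      (noisyMomentMatrix na nc n N (fun k => x k + σ * ξ k) u (s σ)) (v σ))
    (hg : ∀ᶠ σ in F, IsPDAOutput ε (veroneseForm (v σ)) N
      (fun k => regressor na nc (fun k => x k + σ * ξ k) u k) (g σ)) :
    ∃ (ρ : Equiv.Perm (Fin n)) (τ : Fin n → ℝ), (∀ i, τ i ≠ 0) ∧
      ∀ i, Tendsto (fun σ => g σ i) F (𝓝 (τ i • b (ρ i))) := by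
  obtain ⟨κ, hκ, hvκ⟩ := h.tendsto_singularVector hσmax hF hs hv
  obtain ⟨γ, hγ0, hγ⟩ := h.exists_polyGrad_limit hκ
  have hr : ∀ k : ℕ, Tendsto (fun σ => regressor na nc (fun k => x k + σ * ξ k) u k) F
      (𝓝 (regressor na nc x u k)) := fun k => by
    have := ((continuous_regressor (na := na) (nc := nc) u k).tendsto x).comp
      (tendsto_noisy x ξ hF)
    simpa only [Function.comp_def] using this
  refine IsPDAOutput.exists_tendsto F hε (p := fun σ => veroneseForm (v σ))
    (r := fun σ k => regressor na nc (fun k => x k + σ * ξ k) u k) hg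
    (r₀ := fun k => regressor na nc x u k) (b := b) (δ := δ) (γ := γ) (fun k _ => hr k) ?_
    (fun k hk => hγ F hF v hvκ k hk) hγ0 h.ne_zero
    (fun k hk => h.active k (Finset.mem_Icc.1 hk).1)
    (fun k hk => h.inactive k (Finset.mem_Icc.1 hk).1) h.visits
  intro k hk
  have hc : Continuous fun q : (MonIdx na nc n → ℝ) × (RegIdx na nc → ℝ) => q.1 ⬝ᵥ veronese q.2 :=
    continuous_fst.dotProduct (continuous_veronese.comp continuous_snd)
  have h1 := (hc.tendsto (κ • prodCoeff b, regressor na nc x u k)).comp (hvκ.prodMk_nhds (hr k))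
  have h2 : (κ • prodCoeff b) ⬝ᵥ veronese (regressor na nc x u k) = 0 := by
    rw [smul_dotProduct, prodCoeff_dotProduct_veronese,
      Finset.prod_eq_zero (Finset.mem_univ (δ k)) (h.active k (Finset.mem_Icc.1 hk).1), smul_zero]
  simp only [h2] at h1
  simpa only [Function.comp_def, eval_veroneseForm] using h1

/-- Normalizing the first entry to `-1` removes the unknown scale. What is left is a permutation
`θ`, and the numbering rule, compared with `θ.symm`, makes its total squared error zero. -/
lemma tendsto_coefficients (h : IsIdentifiable N b x u ξ δ) {σmax ε : ℝ} (hσmax : 0 < σmax)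
    (hε : 0 < ε) {F : Ultrafilter ℝ} (hF : (F : Filter ℝ) ≤ 𝓝[>] 0) {s : ℝ → ℝ}
    {v : ℝ → MonIdx na nc n → ℝ} {b' : ℝ → Fin n → RegIdx na nc → ℝ}
    (hs : ∀ᶠ σ in F, IsNoiseLevelEstimate na nc n N σmax (fun k => x k + σ * ξ k) u (s σ))
    (hv : ∀ᶠ σ in F, IsMinSingularVector
      (noisyMomentMatrix na nc n N (fun k => x k + σ * ξ k) u (s σ)) (v σ))
    (hb : ∀ᶠ σ in F, IsCoefficientEstimate ε N (fun k => x k + σ * ξ k) u (v σ) (b' σ))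
    (hnum : ∀ᶠ σ in F, IsNumberedLike b (b' σ)) :
    Tendsto b' F (𝓝 b) := by
  choose! g π hg hgb using fun σ (hσ : IsCoefficientEstimate ε N (fun k => x k + σ * ξ k) u
    (v σ) (b' σ)) => hσ
  obtain ⟨ρ, τ, hτ, hlim⟩ := h.exists_tendsto_pda hσmax hε hF hs hv (hb.mono fun σ hσ => hg σ hσ)
  obtain ⟨π₀, -, hπ₀⟩ := exists_eventually_eq_of_finite F π Set.finite_univ (by simp)
  set θ : Equiv.Perm (Fin n) := π₀.trans ρ with hθ
  have hlim' : ∀ i, Tendsto (fun σ => b' σ i) F (𝓝 (b (θ i))) := by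
    intro i
    have h1 := hlim (π₀ i)
    have h2 : Tendsto (fun σ => g σ (π₀ i) (Sum.inl 0)) F (𝓝 (-τ (π₀ i))) := by
      have := ((continuous_apply (Sum.inl 0 : RegIdx na nc)).tendsto _).comp h1
      simpa [h.head, Function.comp_def] using this
    have h3 := ((h2.inv₀ (neg_ne_zero.2 (hτ _))).neg).smul h1
    have h4 : (-(-τ (π₀ i))⁻¹) • τ (π₀ i) • b (ρ (π₀ i)) = b (θ i) := by
      rw [smul_smul, inv_neg, neg_neg, inv_mul_cancel₀ (hτ _), one_smul, hθ, Equiv.trans_apply]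
    rw [h4] at h3
    refine h3.congr' ?_
    filter_upwards [hb, hπ₀] with σ hσ hσ'
    obtain ⟨h5, t, h6⟩ := hgb σ hσ i
    rw [hσ'] at h6
    rw [h6, Pi.smul_apply, smul_eq_mul] at h5
    have h7 : g σ (π₀ i) (Sum.inl 0) ≠ 0 := by
      intro h0
      rw [h0] at h5
      simp at h5
    rw [h6]
    congr 1
    field_simp
    linarith
  have hle : ∑ i, euclNorm (b (θ i) - b i) ^ 2 ≤ ∑ i, euclNorm (b (θ (θ.symm i)) - b i) ^ 2 := by
    have hc : ∀ i j : Fin n, Tendsto (fun σ => euclNorm (b' σ j - b i) ^ 2) F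
        (𝓝 (euclNorm (b (θ j) - b i) ^ 2)) := fun i j =>
      ((continuous_euclNorm.tendsto _).comp ((hlim' j).sub_const (b i))).pow 2
    exact le_of_tendsto_of_tendsto (tendsto_finsetSum _ fun i _ => hc i i)
      (tendsto_finsetSum _ fun i _ => hc i (θ.symm i)) (hnum.mono fun σ hσ => hσ θ.symm)
  have hzero : ∀ i, b (θ i) = b i := by
    intro i
    have h1 : ∑ i, euclNorm (b (θ (θ.symm i)) - b i) ^ 2 = 0 := by
      simp [euclNorm]
    rw [h1] at hle
    have h2 := (Finset.sum_eq_zero_iff_of_nonneg fun i _ => sq_nonneg _).1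
      (le_antisymm hle (Finset.sum_nonneg fun i _ => sq_nonneg _)) i (Finset.mem_univ i)
    by_contra hne
    exact (pow_pos (euclNorm_pos (sub_ne_zero.2 hne)) 2).ne' h2
  rw [tendsto_pi_nhds]
  intro i
  rw [← hzero i]
  exact hlim' i

lemma eventually_switching_eq (h : IsIdentifiable N b x u ξ δ) {σmax ε : ℝ} (hσmax : 0 < σmax)
    (hε : 0 < ε) {nl K : ℕ} (start : ℕ → ℕ) (hstart : ∀ l, 1 ≤ start l) :
    ∀ᶠ σ in 𝓝[>] (0 : ℝ), ∀ z : ℝ × (MonIdx na nc n → ℝ) × (Fin n → RegIdx na nc → ℝ)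
        × (ℕ → Fin nl → Fin n),
      (IsNoiseLevelEstimate na nc n N σmax (fun k => x k + σ * ξ k) u z.1 ∧
        IsMinSingularVector (noisyMomentMatrix na nc n N (fun k => x k + σ * ξ k) u z.1) z.2.1 ∧
        IsCoefficientEstimate ε N (fun k => x k + σ * ξ k) u z.2.1 z.2.2.1 ∧
        IsNumberedLike b z.2.2.1 ∧
        ∀ l < K, IsMLSwitching z.2.2.1 z.1 (fun k => x k + σ * ξ k) u (start l) (z.2.2.2 l)) →
      ∀ l ∈ Finset.range K, z.2.2.2 l = fun t : Fin nl => δ (start l + t) := by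
  refine eventually_forall_of_ultrafilter fun F hF z hz => ?_
  have hs := hz.mono fun σ hσ => hσ.1
  have hv := hz.mono fun σ hσ => hσ.2.1
  have hb := h.tendsto_coefficients hσmax hε hF hs hv (hz.mono fun σ hσ => hσ.2.2.1)
    (hz.mono fun σ hσ => hσ.2.2.2.1)
  obtain ⟨hs0, hspos, -⟩ := h.tendsto_noiseLevel hσmax hF hs
  rw [Filter.eventually_all_finset]
  intro l hl
  -- A snippet has finitely many switching sequences, so one candidate `d` has to be excluded at a
  -- time.
  obtain ⟨d, -, hd⟩ := exists_eventually_eq_of_finite F (fun σ => (z σ).2.2.2 l)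
    Set.finite_univ (by simp)
  have hML : ∀ᶠ σ in F, IsMLSwitching (z σ).2.2.1 (z σ).1 (fun k => x k + σ * ξ k) u
      (start l) d := by
    filter_upwards [hz, hd] with σ h1 h2
    have := h1.2.2.2.2 l (Finset.mem_range.1 hl)
    rwa [h2] at this
  have hres := IsMLSwitching.residual_eq_zero hML hb (fun i => by simp [h.head]) hs0 hspos
    (tendsto_noisy x ξ hF) (d₀ := fun t : Fin nl => δ (start l + t)) (by
      funext t
      have := h.active (start l + t) (by have := hstart l; omega)
      push_cast at this
      simp [snippetResidual, this])
  have hdeq : d = fun t : Fin nl => δ (start l + t) := by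
    funext t
    by_contra hne
    have h1 := h.inactive (start l + t) (by have := hstart l; omega) _ hne
    apply h1
    have h2 := congrFun hres t
    simp only [snippetResidual, Pi.zero_apply, neg_eq_zero] at h2
    push_cast
    exact h2
  exact hd.mono fun σ hσ => hσ.trans hdeq

/-- Existence has to be proved because an estimator is constrained only where the procedure has an
output. It can fail in two places: all gradients may vanish, or a normal may have first entry zero.
Both are excluded by passing to the limit. -/
lemma eventually_exists_isEstimate (h : IsIdentifiable N b x u ξ δ) {σmax ε : ℝ}
    (hσmax : 0 < σmax) (hε : 0 < ε) (nl : ℕ) :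
    ∀ᶠ σ in 𝓝[>] (0 : ℝ), ∃ (b' : Fin n → RegIdx na nc → ℝ) (Q : Matrix (Fin n) (Fin n) ℝ),
      IsEstimate nl N σmax ε (fun k => x k + σ * ξ k) u b' Q := by
  have : Nonempty (Fin n) := ⟨δ 0⟩
  have h1 := eventually_noiseLevelEstimate (ξ := ξ) h.one_le hσmax h.head h.active
      h.inactive one_pos
  have h2 : ∀ᶠ σ in 𝓝[>] (0 : ℝ), ∀ z : ℝ × (MonIdx na nc n → ℝ),
      (IsNoiseLevelEstimate na nc n N σmax (fun k => x k + σ * ξ k) u z.1 ∧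
        IsMinSingularVector (noisyMomentMatrix na nc n N (fun k => x k + σ * ξ k) u z.1) z.2) →
      polyGrad (veroneseForm z.2) (regressor na nc (fun k => x k + σ * ξ k) u (1 : ℕ)) ≠ 0 := by
    refine eventually_forall_of_ultrafilter fun F hF z hz => ?_
    obtain ⟨κ, hκ, hvκ⟩ := h.tendsto_singularVector hσmax hF (hz.mono fun σ hσ => hσ.1)
      (hz.mono fun σ hσ => hσ.2)
    obtain ⟨γ, hγ0, hγ⟩ := h.exists_polyGrad_limit hκ
    have h1N : 1 ∈ Finset.Icc 1 N := by simp [h.one_le]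
    exact (hγ F hF _ hvκ 1 h1N).eventually_ne (smul_ne_zero (hγ0 1 h1N) (h.ne_zero _))
  have h3 : ∀ᶠ σ in 𝓝[>] (0 : ℝ), ∀ z : ℝ × (MonIdx na nc n → ℝ) × (Fin n → RegIdx na nc → ℝ),
      (IsNoiseLevelEstimate na nc n N σmax (fun k => x k + σ * ξ k) u z.1 ∧
        IsMinSingularVector (noisyMomentMatrix na nc n N (fun k => x k + σ * ξ k) u z.1) z.2.1 ∧
        IsPDAOutput ε (veroneseForm z.2.1) N
          (fun k => regressor na nc (fun k => x k + σ * ξ k) u k) z.2.2) →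
      ∀ i, z.2.2 i (Sum.inl 0) ≠ 0 := by
    refine eventually_forall_of_ultrafilter fun F hF z hz => ?_
    obtain ⟨ρ, τ, hτ, hlim⟩ := h.exists_tendsto_pda hσmax hε hF (hz.mono fun σ hσ => hσ.1)
      (hz.mono fun σ hσ => hσ.2.1) (hz.mono fun σ hσ => hσ.2.2)
    rw [Filter.eventually_all]
    intro i
    refine (((continuous_apply (Sum.inl 0 : RegIdx na nc)).tendsto _).comp (hlim i)).eventually_ne ?_
    simp [h.head, hτ]
  filter_upwards [h1, h2, h3] with σ h1 h2 h3
  obtain ⟨⟨s, hs⟩, hs'⟩ := h1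
  obtain ⟨v, hv⟩ := exists_isMinSingularVector (hs' s hs).2.2
  obtain ⟨g, hg⟩ := exists_isPDAOutput (n := n) ε (veroneseForm v) N
    (fun k => regressor na nc (fun k => x k + σ * ξ k) u k)
    ⟨1, by simp [h.one_le], h2 (s, v) ⟨hs, hv⟩⟩
  have hg0 := h3 (s, v, g) ⟨hs, hv, hg⟩
  set b' : Fin n → RegIdx na nc → ℝ := fun i => (-(g i (Sum.inl 0))⁻¹) • g i with hb'
  choose d hd using fun l => exists_isMLSwitching (nl := nl) b' s (fun k => x k + σ * ξ k) u
    (snippetStart na nl l)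
  obtain ⟨Q, hQ⟩ := exists_isTransitionMLE (transitionCount (snippetCount na nl N) d)
  refine ⟨b', Q, s, v, d, hs, hv, ⟨g, Equiv.refl _, hg, fun i => ⟨?_, _, rfl⟩⟩,
    fun l _ => hd l, hQ⟩
  simp [hb', hg0 i]

/-- For all sufficiently small noise levels an estimate exists, and it is a maximum likelihood
transition matrix for the true switching sequence. -/
lemma eventually_isEstimate (h : IsIdentifiable N b x u ξ δ) {σmax ε : ℝ}
    (hσmax : 0 < σmax) (hε : 0 < ε) (nl : ℕ) :
    ∀ᶠ σ in 𝓝[>] (0 : ℝ), (∃ (b' : Fin n → RegIdx na nc → ℝ) (Q : Matrix (Fin n) (Fin n) ℝ),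
      IsEstimate nl N σmax ε (fun k => x k + σ * ξ k) u b' Q) ∧
      ∀ (b' : Fin n → RegIdx na nc → ℝ) (Q : Matrix (Fin n) (Fin n) ℝ),
        IsEstimate nl N σmax ε (fun k => x k + σ * ξ k) u b' Q → IsNumberedLike b b' →
        IsTransitionMLE (transitionCount (snippetCount na nl N)
          (fun l (t : Fin nl) => δ (snippetStart na nl l + t))) Q := by
  filter_upwards [h.eventually_exists_isEstimate hσmax hε nl,
    h.eventually_switching_eq hσmax hε (nl := nl) (K := snippetCount na nl N) (snippetStart na nl)
      (fun l => by unfold snippetStart; omega)] with σ h1 h2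
  refine ⟨h1, fun b' Q hest hnum => ?_⟩
  obtain ⟨s, v, d, hs, hv, hb, hd, hQ⟩ := hest
  have h3 := h2 (s, v, b', d) ⟨hs, hv, hb, hnum, hd⟩
  have h4 : transitionCount (snippetCount na nl N) d = transitionCount (snippetCount na nl N)
      (fun l (t : Fin nl) => δ (snippetStart na nl l + t)) := by
    funext i j
    refine Finset.sum_congr rfl fun l hl => ?_
    rw [show d l = _ from h3 l hl]
  rwa [h4] at hQ

end IsIdentifiable

/-! ### Zero sets of polynomials -/

/-- View `q` as a polynomial in the first variable. By induction its leading coefficient is nonzero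
for almost all values of the others, and then only finitely many first coordinates are roots. -/
lemma pi_eval_eq_zero_null {d : ℕ} (ρ : Measure ℝ) [IsProbabilityMeasure ρ] [NullSingletonClass ρ]
    (q : MvPolynomial (Fin d) ℝ) (hq : q ≠ 0) :
    Measure.pi (fun _ : Fin d => ρ) {z | MvPolynomial.eval z q = 0} = 0 := by
  induction d with
  | zero =>
    have h : {z : Fin 0 → ℝ | MvPolynomial.eval z q = 0} = ∅ := by
      ext z
      rw [MvPolynomial.eq_C_of_isEmpty q] at hq ⊢
      simpa using hq
    rw [h, measure_empty]
  | succ d ih =>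
    set Q := MvPolynomial.finSuccEquiv ℝ d q with hQ
    have hQ0 : Q ≠ 0 := by simpa [hQ] using hq
    have hlead := ih Q.leadingCoeff (Polynomial.leadingCoeff_ne_zero.2 hQ0)
    set e := MeasurableEquiv.piFinSuccAbove (fun _ : Fin (d + 1) => ℝ) 0
    have hmp := measurePreserving_piFinSuccAbove (fun _ : Fin (d + 1) => ρ) 0
    set S : Set (ℝ × (Fin d → ℝ)) := {w | MvPolynomial.eval (Fin.cons w.1 w.2 : Fin (d + 1) → ℝ) q
      = 0} with hS
    have hSm : MeasurableSet S := by
      refine (isClosed_eq ((MvPolynomial.continuous_eval q).comp ?_) continuous_const).measurableSet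
      refine continuous_pi fun i => ?_
      refine Fin.cases ?_ (fun j => ?_) i
      · simpa using continuous_fst
      · simpa [Function.comp_def] using (continuous_apply j).comp continuous_snd
    have hpre : {z | MvPolynomial.eval z q = 0} = e ⁻¹' S := by
      ext z
      have : (Fin.cons (e z).1 (e z).2 : Fin (d + 1) → ℝ) = z := by
        funext i
        refine Fin.cases ?_ (fun j => ?_) i
        · simp [e, MeasurableEquiv.piFinSuccAbove]
        · simp [e, MeasurableEquiv.piFinSuccAbove, Fin.tail]
      simp [hS, this]
    rw [hpre, hmp.measure_preimage hSm.nullMeasurableSet, Measure.prod_apply_symm hSm,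
      lintegral_eq_zero_iff (measurable_measure_prodMk_right hSm)]
    have hae : ∀ᵐ s ∂(Measure.pi fun _ : Fin d => ρ), MvPolynomial.eval s Q.leadingCoeff ≠ 0 := by
      rw [ae_iff]
      simpa using hlead
    filter_upwards [hae] with s hs
    have hne : Q.map (MvPolynomial.eval s) ≠ 0 := by
      intro h0
      apply hs
      have := congrArg (fun P => P.coeff Q.natDegree) h0
      simpa [Polynomial.coeff_map] using this
    have hfin : ((fun y => (y, s)) ⁻¹' S).Finite := by
      refine (Polynomial.finite_setOfPred_isRoot hne).subset fun y hy => ?_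
      rw [Set.mem_preimage, hS, Set.mem_ofPred_eq, MvPolynomial.eval_eq_eval_mv_eval'] at hy
      exact hy
    exact hfin.measure_zero ρ

/-- A polynomial involves finitely many variables, whose joint law is a finite product of Gaussians.
-/
lemma ae_eval_ne_zero_of_iIndepFun {Ω : Type*} [MeasurableSpace Ω] {μ : Measure Ω}
    [IsProbabilityMeasure μ] {κ : Type*} {ξ : κ → Ω → ℝ}
    (hlaw : ∀ k, HasLaw (ξ k) (gaussianReal 0 1) μ) (hind : iIndepFun ξ μ)
    (p : MvPolynomial κ ℝ) (hp : p ≠ 0) :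
    ∀ᵐ ω ∂μ, MvPolynomial.eval (fun k => ξ k ω) p ≠ 0 := by
  obtain ⟨d, f, hf, q, rfl⟩ := MvPolynomial.exists_fin_rename p
  have hq : q ≠ 0 := by
    rintro rfl
    simp at hp
  have hna : NullSingletonClass (gaussianReal 0 1) := nullSingletonClass_gaussianReal (by simp)
  have hmap := (iIndepFun_iff_map_fun_eq_pi_map (fun i => (hlaw (f i)).aemeasurable)).1
    (hind.precomp hf)
  simp_rw [fun i => (hlaw (f i)).map_eq] at hmap
  have hnull := pi_eval_eq_zero_null (gaussianReal 0 1) q hq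
  rw [← hmap, Measure.map_apply_of_aemeasurable
    (aemeasurable_pi_iff.2 fun i => (hlaw (f i)).aemeasurable)
    (isClosed_eq (MvPolynomial.continuous_eval q) continuous_const).measurableSet] at hnull
  rw [ae_iff]
  simpa [MvPolynomial.eval_rename, Function.comp_def] using hnull

lemma exists_polynomial_det_momentMatrix (na nc n N : ℕ) (x u : ℤ → ℝ) :
    ∃ p : MvPolynomial ℤ ℝ, ∀ z : ℤ → ℝ,
      MvPolynomial.eval z p = (momentMatrix na nc n N (fun k => x k + z k) u).det := by
  set R : ℕ → RegIdx na nc → MvPolynomial ℤ ℝ := fun k =>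
    Sum.elim (fun j => MvPolynomial.C (x (k - (j : ℕ))) + MvPolynomial.X ((k : ℤ) - (j : ℕ)))
      (fun j => MvPolynomial.C (u (k - 1 - (j : ℕ)))) with hR
  set M : Matrix (MonIdx na nc n) (MonIdx na nc n) (MvPolynomial ℤ ℝ) := Matrix.of fun α β =>
    MvPolynomial.C (1 / (N : ℝ)) * ∑ k ∈ Finset.Icc 1 N,
      (∏ i, R k i ^ α.1 i) * ∏ i, R k i ^ β.1 i with hM
  refine ⟨M.det, fun z => ?_⟩
  rw [RingHom.map_det]
  congr 1
  ext α β
  have hRz : ∀ k i, MvPolynomial.eval z (R k i)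
      = regressor na nc (fun k => x k + z k) u k i := by
    intro k i
    rcases i with j | j <;> simp [hR, regressor]
  simp [hM, momentMatrix, Matrix.vecMulVec_apply, Matrix.sum_apply, veronese, map_sum, map_prod, hRz]

/-- On the line through `z` the polynomial is a univariate one that does not vanish at `σ = 1`, so
it has finitely many roots. -/
lemma eventually_eval_smul_ne_zero {κ : Type*} (p : MvPolynomial κ ℝ) (z : κ → ℝ)
    (h : MvPolynomial.eval z p ≠ 0) :
    ∀ᶠ σ in 𝓝[>] (0 : ℝ), MvPolynomial.eval (fun k => σ * z k) p ≠ 0 := by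
  set P : Polynomial ℝ := MvPolynomial.aeval (fun k => Polynomial.X * Polynomial.C (z k)) p with hP
  have hPe : ∀ σ : ℝ, P.eval σ = MvPolynomial.eval (fun k => σ * z k) p := by
    intro σ
    have h1 := MvPolynomial.comp_aeval_apply (f := fun k => Polynomial.X * Polynomial.C (z k))
      (Polynomial.aeval σ) p
    rw [← hP, Polynomial.coe_aeval_eq_eval] at h1
    rw [h1]
    simp_rw [mul_comm σ]
    simp [MvPolynomial.aeval_eq_eval]
  have hP0 : P ≠ 0 := by
    intro h0
    apply h
    have := hPe 1
    simpa [h0] using this.symm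
  -- The root `0` is set aside: the moment determinant may well vanish without noise.
  have hfin : (P.rootSet ℝ \ {0}).Finite := (P.rootSet_finite ℝ).subset Set.sdiff_subset
  have hnhds : (P.rootSet ℝ \ {0})ᶜ ∈ 𝓝 (0 : ℝ) := hfin.isClosed.isOpen_compl.mem_nhds (by simp)
  filter_upwards [nhdsWithin_le_nhds hnhds, self_mem_nhdsWithin] with σ hσ hpos h0
  apply hσ
  refine ⟨?_, ?_⟩
  · rw [Polynomial.mem_rootSet]
    refine ⟨hP0, ?_⟩
    rw [Polynomial.coe_aeval_eq_eval, hPe, h0]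
  · rw [Set.mem_Ioi] at hpos
    simpa using hpos.ne'

/-! ### Generic nonsingularity of the noisy moment matrix -/

/-- If the first `N₀` noise-free data determine the submodels, then a suitable perturbation of the
next output makes the moment matrix nonsingular. -/
lemma exists_det_momentMatrix_ne_zero {na nc n N₀ N : ℕ} (hN : N₀ < N)
    {b : Fin n → RegIdx na nc → ℝ} {x u : ℤ → ℝ} {δ : ℕ → Fin n}
    (head : ∀ i, b i (Sum.inl 0) = -1)
    (active : ∀ k : ℕ, 1 ≤ k → b (δ k) ⬝ᵥ regressor na nc x u k = 0)
    (hker : Module.finrank ℝ (LinearMap.ker (momentMatrix na nc n N₀ x u).mulVecLin) = 1) :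
    ∃ z : ℤ → ℝ, (momentMatrix na nc n N (fun k => x k + z k) u).det ≠ 0 := by
  -- Raising the output at time `N₀ + 1` by `t` lowers each `b i ⬝ᵥ r` there by `t`. This choice
  -- makes all of them nonzero, and the first `N₀` regressors are untouched.
  obtain ⟨t, ht⟩ := Set.Infinite.exists_notMem_finset (Set.infinite_univ (α := ℝ))
    (Finset.univ.image fun i => b i ⬝ᵥ regressor na nc x u (N₀ + 1 : ℕ))
  have ht' : ∀ i, b i ⬝ᵥ regressor na nc x u (N₀ + 1 : ℕ) ≠ t := by
    intro i hi
    exact ht.2 (Finset.mem_image.2 ⟨i, Finset.mem_univ i, hi⟩)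
  refine ⟨Pi.single ((N₀ + 1 : ℕ) : ℤ) t, fun hdet => ?_⟩
  set x' : ℤ → ℝ := fun k => x k + (Pi.single ((N₀ + 1 : ℕ) : ℤ) t : ℤ → ℝ) k with hx'
  obtain ⟨v, hv0, hv⟩ := Matrix.exists_mulVec_eq_zero_iff.2 hdet
  have hN1 : 1 ≤ N := by omega
  have hlow : ∀ k ∈ Finset.Icc 1 N₀, regressor na nc x' u k = regressor na nc x u k := by
    intro k hk
    rw [Finset.mem_Icc] at hk
    funext i
    rcases i with j | j
    · have hne : (k : ℤ) - (j : ℕ) ≠ ((N₀ + 1 : ℕ) : ℤ) := by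
        have := hk.2
        push_cast
        omega
      simp only [regressor, hx', Sum.elim_inl, Pi.single_eq_of_ne hne, add_zero]
    · simp [regressor]
  have hmat : momentMatrix na nc n N₀ x' u = momentMatrix na nc n N₀ x u := by
    rw [momentMatrix, momentMatrix]
    congr 1
    exact Finset.sum_congr rfl fun k hk => by rw [hlow k hk]
  have hv1 := momentMatrix_mulVec_mono hN1 hN.le x' u hv
  rw [hmat] at hv1
  have hc : momentMatrix na nc n N₀ x u *ᵥ prodCoeff b = 0 := by
    rcases Nat.eq_zero_or_pos N₀ with rfl | hpos
    · simp [momentMatrix]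
    · rw [momentMatrix_mulVec_eq_zero_iff hpos]
      intro k hk
      rw [prodCoeff_dotProduct_veronese]
      exact Finset.prod_eq_zero (Finset.mem_univ (δ k)) (active k (Finset.mem_Icc.1 hk).1)
  obtain ⟨κ, rfl⟩ := exists_smul_of_finrank_ker hker hc
    (prodCoeff_ne_zero fun i => by simp [head]) hv1
  have hlast := (momentMatrix_mulVec_eq_zero_iff hN1 x' u _).1 hv (N₀ + 1) (by simp; omega)
  rw [smul_dotProduct, prodCoeff_dotProduct_veronese, smul_eq_mul] at hlast
  have hκ : κ ≠ 0 := by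
    rintro rfl
    simp at hv0
  have hreg : regressor na nc x' u (N₀ + 1 : ℕ)
      = regressor na nc x u (N₀ + 1 : ℕ) + Pi.single (Sum.inl 0) t := by
    funext i
    rcases i with j | j
    · by_cases hj : j = 0
      · subst hj
        simp [regressor, hx']
      · have hne : ((N₀ + 1 : ℕ) : ℤ) - (j : ℕ) ≠ ((N₀ + 1 : ℕ) : ℤ) := by
          have : (j : ℕ) ≠ 0 := fun e => hj (Fin.ext e)
          omega
        have hne' : (Sum.inl j : RegIdx na nc) ≠ Sum.inl 0 := by simpa using hj
        rw [Pi.add_apply, Pi.single_eq_of_ne hne']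
        simp only [regressor, hx', Sum.elim_inl, Pi.single_eq_of_ne hne]
    · simp [regressor]
  refine (mul_ne_zero hκ (Finset.prod_ne_zero_iff.2 fun i _ => ?_)) hlast
  rw [hreg, dotProduct_add, dotProduct_single, head]
  intro h0
  apply ht' i
  linarith

lemma continuous_det_momentMatrix (na nc n N : ℕ) (u : ℤ → ℝ) :
    Continuous fun y : ℤ → ℝ => (momentMatrix na nc n N y u).det := by
  refine Continuous.matrix_det ?_
  refine continuous_matrix fun α β => ?_
  simp only [momentMatrix, Matrix.smul_apply, Matrix.sum_apply, Matrix.vecMulVec_apply, smul_eq_mul]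
  refine continuous_const.mul (continuous_finsetSum _ fun k _ => ?_)
  have h := (continuous_veronese (n := n)).comp (continuous_regressor (na := na) (nc := nc) u k)
  exact ((continuous_apply α).comp h).mul ((continuous_apply β).comp h)

/-- Almost surely the moment matrix of the noisy data is nonsingular for all small noise levels. -/
lemma ae_eventually_det_ne_zero {Ω : Type*} [MeasurableSpace Ω] {μ : Measure Ω}
    [IsProbabilityMeasure μ] {na nc n : ℕ} {b : Fin n → RegIdx na nc → ℝ} {u : ℤ → ℝ}
    (head : ∀ i, b i (Sum.inl 0) = -1) {δ : ℕ → Ω → Fin n} {x ξ : ℤ → Ω → ℝ}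
    (hx_meas : ∀ k, Measurable (x k))
    (active : ∀ ω, ∀ k : ℕ, 1 ≤ k → b (δ k ω) ⬝ᵥ regressor na nc (fun m => x m ω) u k = 0)
    (hlaw : ∀ k, HasLaw (ξ k) (gaussianReal 0 1) μ) (hind : iIndepFun ξ μ)
    (hindep : IndepFun (fun ω (k : ℤ) => ξ k ω) (fun ω (k : ℤ) => x k ω) μ) :
    ∀ᵐ ω ∂μ, ∀ N₀ N : ℕ, N₀ < N → Module.finrank ℝ (LinearMap.ker
        (momentMatrix na nc n N₀ (fun m => x m ω) u).mulVecLin) = 1 →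
      ∀ᶠ σ in 𝓝[>] (0 : ℝ), (momentMatrix na nc n N (fun k => x k ω + σ * ξ k ω) u).det ≠ 0 := by
  have hξm : AEMeasurable (fun ω (k : ℤ) => ξ k ω) μ :=
    aemeasurable_pi_iff.2 fun k => (hlaw k).aemeasurable
  have hxm : Measurable (fun ω (k : ℤ) => x k ω) := measurable_pi_iff.2 hx_meas
  set ν := μ.map (fun ω (k : ℤ) => ξ k ω) with hν
  set lam := μ.map (fun ω (k : ℤ) => x k ω) with hlam
  have hνp : IsProbabilityMeasure ν := Measure.isProbabilityMeasure_map hξm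
  have hlp : IsProbabilityMeasure lam := Measure.isProbabilityMeasure_map hxm.aemeasurable
  have hjoint := (indepFun_iff_map_prod_eq_prod_map_map hxm.aemeasurable hξm).1 hindep.symm
  have key : ∀ N : ℕ, ∀ᵐ ω ∂μ, ν {z | (momentMatrix na nc n N
      (fun k => x k ω + z k) u).det = 0} = 0 →
      (momentMatrix na nc n N (fun k => x k ω + ξ k ω) u).det ≠ 0 := by
    intro N
    set E : Set ((ℤ → ℝ) × (ℤ → ℝ)) :=
      {w | (momentMatrix na nc n N (fun k => w.1 k + w.2 k) u).det = 0} with hE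
    have hEm : MeasurableSet E := by
      refine (isClosed_eq ((continuous_det_momentMatrix na nc n N u).comp ?_)
        continuous_const).measurableSet
      fun_prop
    -- The outputs for which the determinant vanishes with probability zero over the noise. By
    -- independence and Fubini the exceptional event, restricted to `A`, is null.
    set A : Set (ℤ → ℝ) := {y | ν (Prod.mk y ⁻¹' E) = 0} with hA
    have hAm : MeasurableSet A := (measurable_measure_prodMk_left hEm) (measurableSet_singleton 0)
    have hBm : MeasurableSet ((Prod.fst ⁻¹' A) ∩ E) := (measurable_fst hAm).inter hEm
    have hnull : (lam.prod ν) ((Prod.fst ⁻¹' A) ∩ E) = 0 := by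
      rw [Measure.measure_prod_null hBm]
      refine Filter.Eventually.of_forall fun y => ?_
      by_cases hy : y ∈ A
      · refine measure_mono_null (fun z hz => ?_) hy
        exact hz.2
      · have : Prod.mk y ⁻¹' ((Prod.fst ⁻¹' A) ∩ E) = ∅ := by
          ext z
          simp [hy]
        simp [this]
    rw [← hjoint, Measure.map_apply_of_aemeasurable (hxm.aemeasurable.prodMk hξm) hBm] at hnull
    filter_upwards [measure_eq_zero_iff_ae_notMem.1 hnull] with ω hω h0 hdet
    exact hω ⟨h0, hdet⟩
  filter_upwards [ae_all_iff.2 key] with ω hω N₀ N hN hker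
  obtain ⟨p, hp⟩ := exists_polynomial_det_momentMatrix na nc n N (fun k => x k ω) u
  -- One perturbation with nonzero determinant shows that the polynomial `p` is not zero.
  obtain ⟨z, hz⟩ := exists_det_momentMatrix_ne_zero hN head (active ω) hker
  have hp0 : p ≠ 0 := by
    rintro rfl
    rw [← hp] at hz
    simp at hz
  have hnull : ν {z | (momentMatrix na nc n N (fun k => x k ω + z k) u).det = 0} = 0 := by
    simp_rw [← hp]
    rw [hν, Measure.map_apply_of_aemeasurable hξm
      (by
        refine measurableSet_eq_fun ?_ measurable_const
        simp_rw [hp]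
        exact ((continuous_det_momentMatrix na nc n N u).comp (by fun_prop)).measurable)]
    have := ae_iff.1 (ae_eval_ne_zero_of_iIndepFun hlaw hind p hp0)
    simpa using this
  have h1 := hω N hnull
  rw [← hp] at h1
  filter_upwards [eventually_eval_smul_ne_zero p _ h1] with σ hσ
  rwa [hp] at hσ

/-! ### Powers of aperiodic irreducible matrices -/

/-- Possible return times to a state are closed under addition and have greatest common divisor one,
so they include all large integers. A fixed path from `i` to `j` is then appended. -/
lemma exists_forall_pow_pos {n : ℕ} {P : Matrix (Fin n) (Fin n) ℝ} (hirr : P.IsIrreducible)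
    (haper : IsAperiodic P) : ∃ m₀, ∀ m ≥ m₀, ∀ i j, 0 < (P ^ m) i j := by
  have hnn := hirr.nonneg
  have hmul : ∀ {s t : ℕ} {i j k : Fin n}, 0 < (P ^ s) i j → 0 < (P ^ t) j k →
      0 < (P ^ (s + t)) i k := by
    intro s t i j k h1 h2
    rw [pow_add, Matrix.mul_apply]
    exact Finset.sum_pos' (fun l _ => mul_nonneg (Matrix.pow_apply_nonneg hnn s i l)
      (Matrix.pow_apply_nonneg hnn t l k)) ⟨j, Finset.mem_univ j, mul_pos h1 h2⟩
  have hret : ∀ i, ∃ m₀, ∀ m ≥ m₀, 0 < (P ^ m) i i := by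
    intro i
    set S : Set ℕ := {t | 0 < t ∧ 0 < (P ^ t) i i} with hS
    have hgcd : Nat.setGcd S = 1 := haper i _ fun t ht ht' => Nat.setGcd_dvd_of_mem ⟨ht, ht'⟩
    obtain ⟨m₀, hm₀⟩ := Nat.exists_mem_closure_of_ge S
    refine ⟨m₀, fun m hm => ?_⟩
    have hmem := hm₀ m hm (by simp [hgcd])
    clear hm
    induction hmem using AddSubmonoid.closure_induction with
    | mem t ht => exact ht.2
    | zero => simp
    | add s t _ _ hs ht => exact hmul hs ht
  choose m₀ hm₀ using hret
  choose k _ hk using (Matrix.isIrreducible_iff_exists_pow_pos hnn).1 hirr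
  -- The sum serves as a crude upper bound for the maximum over `i` and `j`.
  refine ⟨∑ i, ∑ j, (m₀ i + k i j), fun m hm i j => ?_⟩
  have hle : m₀ i + k i j ≤ m := by
    refine le_trans ?_ hm
    refine le_trans ?_ (Finset.single_le_sum (f := fun i => ∑ j, (m₀ i + k i j))
      (fun _ _ => Nat.zero_le _) (Finset.mem_univ i))
    exact Finset.single_le_sum (f := fun j => m₀ i + k i j) (fun _ _ => Nat.zero_le _)
      (Finset.mem_univ j)
  have := hmul (hm₀ i (m - k i j) (by omega)) (hk i j)
  rwa [Nat.sub_add_cancel (by omega)] at this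

/-! ### The Markov property -/

lemma measurableSet_path {Ω : Type*} [MeasurableSpace Ω] {n : ℕ} {δ : ℕ → Ω → Fin n}
    (hδ : ∀ k, Measurable (δ k)) (t : ℕ) (s : ℕ → Fin n) :
    MeasurableSet {ω | ∀ m ∈ Finset.Icc 1 t, δ m ω = s m} := by
  have : {ω | ∀ m ∈ Finset.Icc 1 t, δ m ω = s m} = ⋂ m ∈ Finset.Icc 1 t, δ m ⁻¹' {s m} := by
    ext ω
    simp
  rw [this]
  exact Finset.measurableSet_biInter _ fun m _ => hδ m (measurableSet_singleton _)

/-- Chapman–Kolmogorov after a prescribed past: the induction splits over the state at time `t + 1`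
and lengthens the past by one step, so `t` and `s` must vary. -/
lemma IsMarkovChain.measureReal_path_inter {Ω : Type*} [MeasurableSpace Ω] {μ : Measure Ω}
    [IsProbabilityMeasure μ] {n : ℕ} {P : Matrix (Fin n) (Fin n) ℝ} {δ : ℕ → Ω → Fin n}
    (h : IsMarkovChain μ P δ) (hδ : ∀ k, Measurable (δ k)) (m : ℕ) {t : ℕ} (ht : 1 ≤ t)
    (s : ℕ → Fin n) (j : Fin n) :
    μ.real ({ω | ∀ k ∈ Finset.Icc 1 t, δ k ω = s k} ∩ {ω | δ (t + m) ω = j})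
      = μ.real {ω | ∀ k ∈ Finset.Icc 1 t, δ k ω = s k} * (P ^ m) (s t) j := by
  induction m generalizing t s with
  | zero =>
    by_cases hj : s t = j
    · have : {ω | ∀ k ∈ Finset.Icc 1 t, δ k ω = s k} ∩ {ω | δ (t + 0) ω = j}
          = {ω | ∀ k ∈ Finset.Icc 1 t, δ k ω = s k} := by
        ext ω
        simp only [Set.mem_inter_iff, Set.mem_ofPred_eq, add_zero, and_iff_left_iff_imp]
        intro hω
        rw [hω t (by simp [ht]), hj]
      rw [this, pow_zero, hj, Matrix.one_apply_eq, mul_one]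
    · have : {ω | ∀ k ∈ Finset.Icc 1 t, δ k ω = s k} ∩ {ω | δ (t + 0) ω = j} = ∅ := by
        ext ω
        simp only [Set.mem_inter_iff, Set.mem_ofPred_eq, add_zero, Set.mem_empty_iff_false, iff_false,
          not_and]
        intro hω
        rwa [hω t (by simp [ht])]
      rw [this, pow_zero, Matrix.one_apply_ne hj, mul_zero, measureReal_empty]
  | succ m ih =>
    have hupd : ∀ i, {ω | ∀ k ∈ Finset.Icc 1 (t + 1), δ k ω = Function.update s (t + 1) i k}
        = {ω | ∀ k ∈ Finset.Icc 1 t, δ k ω = s k} ∩ {ω | δ (t + 1) ω = i} := by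
      intro i
      ext ω
      simp only [Set.mem_inter_iff, Set.mem_ofPred_eq]
      constructor
      · intro hω
        refine ⟨fun k hk => ?_, ?_⟩
        · have hk' := Finset.mem_Icc.1 hk
          have := hω k (Finset.mem_Icc.2 ⟨hk'.1, by omega⟩)
          rwa [Function.update_of_ne (by omega)] at this
        · simpa using hω (t + 1) (by simp)
      · rintro ⟨h1, h2⟩ k hk
        have hk' := Finset.mem_Icc.1 hk
        by_cases hkt : k = t + 1
        · subst hkt
          simpa using h2
        · rw [Function.update_of_ne hkt]
          exact h1 k (Finset.mem_Icc.2 ⟨hk'.1, by omega⟩)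
    have hsplit : {ω | ∀ k ∈ Finset.Icc 1 t, δ k ω = s k} ∩ {ω | δ (t + (m + 1)) ω = j}
        = ⋃ i, ({ω | ∀ k ∈ Finset.Icc 1 (t + 1), δ k ω = Function.update s (t + 1) i k}
          ∩ {ω | δ (t + 1 + m) ω = j}) := by
      ext ω
      simp only [hupd, Set.mem_iUnion, Set.mem_inter_iff, Set.mem_ofPred_eq]
      rw [show t + (m + 1) = t + 1 + m by ring]
      constructor
      · rintro ⟨h1, h2⟩
        exact ⟨_, ⟨h1, rfl⟩, h2⟩
      · rintro ⟨i, ⟨h1, -⟩, h2⟩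
        exact ⟨h1, h2⟩
    rw [hsplit, measureReal_iUnion_fintype]
    · simp_rw [ih (t := t + 1) (by omega), h t ht]
      have hpre : ∀ i, {ω | ∀ k ∈ Finset.Icc 1 t, δ k ω = Function.update s (t + 1) i k}
          = {ω | ∀ k ∈ Finset.Icc 1 t, δ k ω = s k} := by
        intro i
        ext ω
        refine forall₂_congr fun k hk => ?_
        rw [Function.update_of_ne (by have := (Finset.mem_Icc.1 hk).2; omega)]
      simp_rw [hpre, Function.update_self,
        fun i => Function.update_of_ne (show t ≠ t + 1 by omega) i s]
      rw [pow_succ', Matrix.mul_apply, Finset.mul_sum]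
      exact Finset.sum_congr rfl fun i _ => by ring
    · intro i i' hii
      rw [Function.onFun, Set.disjoint_left]
      rintro ω ⟨h1, -⟩ ⟨h2, -⟩
      apply hii
      have e1 := h1 (t + 1) (by simp)
      have e2 := h2 (t + 1) (by simp)
      simp only [Function.update_self] at e1 e2
      exact e1.symm.trans e2
    · intro i
      exact (measurableSet_path hδ _ _).inter (hδ _ (measurableSet_singleton _))

/-- The Markov property: an `m`-step transition is conditionally independent of the past given the
present. -/
lemma IsMarkovChain.integral_mul_sub_eq_zero {Ω : Type*} [MeasurableSpace Ω] {μ : Measure Ω}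
    [IsProbabilityMeasure μ] {n : ℕ} {P : Matrix (Fin n) (Fin n) ℝ} {δ : ℕ → Ω → Fin n}
    (h : IsMarkovChain μ P δ) (hδ : ∀ k, Measurable (δ k)) (m : ℕ) {t : ℕ} (ht : 1 ≤ t) (j : Fin n)
    (φ : (ℕ → Fin n) → ℝ)
    (hφ : ∀ s s' : ℕ → Fin n, (∀ k ∈ Finset.Icc 1 t, s k = s' k) → φ s = φ s') :
    ∫ ω, φ (fun k => δ k ω) * ((if δ (t + m) ω = j then 1 else 0) - (P ^ m) (δ t ω) j) ∂μ = 0 := by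
  classical
  -- The value `j` outside the window is arbitrary; only the states up to time `t` are used.
  set ext : (Finset.Icc 1 t → Fin n) → ℕ → Fin n := fun w k =>
    if hk : k ∈ Finset.Icc 1 t then w ⟨k, hk⟩ else j with hext
  have hextmem : ∀ w k (hk : k ∈ Finset.Icc 1 t), ext w k = w ⟨k, hk⟩ := fun w k hk => dif_pos hk
  have htmem : t ∈ Finset.Icc 1 t := by simp [ht]
  set A : (Finset.Icc 1 t → Fin n) → Set Ω := fun w => {ω | ∀ k ∈ Finset.Icc 1 t, δ k ω = ext w k}
  set B : Set Ω := {ω | δ (t + m) ω = j}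
  have hAm : ∀ w, MeasurableSet (A w) := fun w => measurableSet_path hδ _ _
  have hBm : MeasurableSet B := hδ _ (measurableSet_singleton _)
  have hpt : ∀ ω, φ (fun k => δ k ω) * ((if δ (t + m) ω = j then 1 else 0) - (P ^ m) (δ t ω) j)
      = ∑ w, (φ (ext w) * (A w ∩ B).indicator 1 ω
        - φ (ext w) * (P ^ m) (ext w t) j * (A w).indicator 1 ω) := by
    intro ω
    set w₀ : Finset.Icc 1 t → Fin n := fun k => δ k ω with hw₀
    have hω : ω ∈ A w₀ := fun k hk => (hextmem w₀ k hk).symm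
    have hwt : ext w₀ t = δ t ω := hextmem w₀ t htmem
    rw [Finset.sum_eq_single w₀]
    · rw [hφ (fun k => δ k ω) (ext w₀) hω, hwt]
      by_cases hB : ω ∈ B
      · have hB' : δ (t + m) ω = j := hB
        simp [hω, hB, hB']
        ring
      · have hB' : ¬ δ (t + m) ω = j := hB
        simp [hω, hB, hB']
    · intro w _ hw
      have : ω ∉ A w := by
        intro hmem
        apply hw
        funext k
        exact ((hmem k k.2).trans (hextmem w k k.2)).symm
      simp [this]
    · simp
  simp_rw [hpt]
  rw [integral_finsetSum]
  · refine Finset.sum_eq_zero fun w _ => ?_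
    rw [integral_sub, integral_const_mul, integral_const_mul, integral_indicator_one ((hAm w).inter hBm),
      integral_indicator_one (hAm w), h.measureReal_path_inter hδ m ht]
    · ring
    · exact ((integrable_indicator_iff ((hAm w).inter hBm)).2
        (integrable_const (1 : ℝ)).integrableOn).const_mul _
    · exact ((integrable_indicator_iff (hAm w)).2
        (integrable_const (1 : ℝ)).integrableOn).const_mul _
  · intro w _
    refine Integrable.sub ?_ ?_
    · exact ((integrable_indicator_iff ((hAm w).inter hBm)).2
        (integrable_const (1 : ℝ)).integrableOn).const_mul _
    · exact ((integrable_indicator_iff (hAm w)).2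
        (integrable_const (1 : ℝ)).integrableOn).const_mul _

/-! ### A strong law of large numbers for bounded orthogonal random variables -/

/-- Orthogonality bounds the second moment of the `K`-th partial sum by `K`. Along squares the mean
squares of the averages are summable, which gives almost sure convergence, and boundedness controls
the gaps. -/
lemma ae_tendsto_average_of_orthogonal {Ω : Type*} [MeasurableSpace Ω] {μ : Measure Ω}
    [IsProbabilityMeasure μ] {X : ℕ → Ω → ℝ} (hX : ∀ l, Measurable (X l))
    (hbd : ∀ l ω, |X l ω| ≤ 1) (horth : ∀ l l', l < l' → ∫ ω, X l ω * X l' ω ∂μ = 0) :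
    ∀ᵐ ω ∂μ, Tendsto (fun K : ℕ => (∑ l ∈ Finset.range K, X l ω) / K) atTop (𝓝 0) := by
  set S : ℕ → Ω → ℝ := fun K ω => ∑ l ∈ Finset.range K, X l ω with hS
  have hSm : ∀ K, Measurable (S K) := fun K => Finset.measurable_sum _ fun l _ => hX l
  have hprod : ∀ l l', Integrable (fun ω => X l ω * X l' ω) μ := by
    intro l l'
    refine Integrable.of_bound ((hX l).mul (hX l')).aestronglyMeasurable 1
      (Filter.Eventually.of_forall fun ω => ?_)
    rw [Real.norm_eq_abs, abs_mul]
    exact mul_le_one₀ (hbd l ω) (abs_nonneg _) (hbd l' ω)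
  have hsq : ∀ K, ∫ ω, S K ω ^ 2 ∂μ ≤ K := by
    intro K
    have h1 : ∀ ω, S K ω ^ 2 = ∑ l ∈ Finset.range K, ∑ l' ∈ Finset.range K, X l ω * X l' ω := by
      intro ω
      rw [hS, pow_two, Finset.sum_mul_sum]
    simp_rw [h1]
    rw [integral_finsetSum _ fun l _ => integrable_finsetSum _ fun l' _ => hprod l l']
    have h2 : ∀ l ∈ Finset.range K, ∫ ω, ∑ l' ∈ Finset.range K, X l ω * X l' ω ∂μ ≤ 1 := by
      intro l hl
      rw [integral_finsetSum _ fun l' _ => hprod l l', Finset.sum_eq_single l]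
      · have := integral_mono (hprod l l) (integrable_const (1 : ℝ)) fun ω => by
          have := abs_le.1 (hbd l ω)
          show X l ω * X l ω ≤ 1
          nlinarith
        simpa using this
      · intro l' _ hne
        rcases lt_or_gt_of_ne hne with hlt | hlt
        · simp_rw [mul_comm (X l _)]
          exact horth l' l hlt
        · exact horth l l' hlt
      · exact fun h => absurd hl h
    calc _ ≤ ∑ l ∈ Finset.range K, (1 : ℝ) := Finset.sum_le_sum h2
      _ = K := by simp
  -- The shift to `q + 1` avoids division by zero.
  set f : ℕ → Ω → ℝ := fun q ω => (S ((q + 1) ^ 2) ω / ((q + 1 : ℕ) : ℝ) ^ 2) ^ 2 with hf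
  have hfm : ∀ q, Measurable (f q) := fun q => ((hSm _).div_const _).pow_const 2
  have hfint : ∀ q, ∫ ω, f q ω ∂μ ≤ 1 / ((q + 1 : ℕ) : ℝ) ^ 2 := by
    intro q
    simp only [hf, div_pow]
    rw [integral_div]
    have h1 := hsq ((q + 1) ^ 2)
    push_cast at h1
    have hq : (0 : ℝ) < (q : ℝ) + 1 := by positivity
    push_cast
    rw [div_le_div_iff₀ (by positivity) (by positivity)]
    have : (((q : ℝ) + 1) ^ 2) ^ 2 = ((q : ℝ) + 1) ^ 2 * ((q : ℝ) + 1) ^ 2 := by ring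
    rw [this, one_mul]
    gcongr
  have hSbd : ∀ K ω, |S K ω| ≤ K := by
    intro K ω
    calc |S K ω| ≤ ∑ l ∈ Finset.range K, |X l ω| := Finset.abs_sum_le_sum_abs _ _
      _ ≤ ∑ l ∈ Finset.range K, (1 : ℝ) := Finset.sum_le_sum fun l _ => hbd l ω
      _ = K := by simp
  have hfI : ∀ q, Integrable (f q) μ := by
    intro q
    refine Integrable.of_bound (hfm q).aestronglyMeasurable 1 (Filter.Eventually.of_forall fun ω => ?_)
    have h1 := hSbd ((q + 1) ^ 2) ω
    push_cast at h1
    have hq : (0 : ℝ) < ((q : ℝ) + 1) ^ 2 := by positivity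
    simp only [hf]
    push_cast
    rw [Real.norm_of_nonneg (sq_nonneg _), sq_le_one_iff_abs_le_one, abs_div, abs_of_pos hq,
      div_le_one hq]
    exact h1
  have hsum : ∑' q, ∫⁻ ω, ENNReal.ofReal (f q ω) ∂μ ≠ ⊤ := by
    have h1 : ∀ q, ∫⁻ ω, ENNReal.ofReal (f q ω) ∂μ ≤ ENNReal.ofReal (1 / ((q + 1 : ℕ) : ℝ) ^ 2) := by
      intro q
      rw [← ofReal_integral_eq_lintegral_ofReal (hfI q)
        (Filter.Eventually.of_forall fun ω => sq_nonneg _)]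
      exact ENNReal.ofReal_le_ofReal (hfint q)
    have h2 : Summable fun q : ℕ => 1 / ((q + 1 : ℕ) : ℝ) ^ 2 :=
      (summable_nat_add_iff 1).2 (Real.summable_one_div_nat_pow.2 one_lt_two)
    exact ne_top_of_le_ne_top h2.tsum_ofReal_ne_top (ENNReal.tsum_le_tsum h1)
  rw [← lintegral_tsum fun q => (hfm q).ennreal_ofReal.aemeasurable] at hsum
  have hae := ae_lt_top' (AEMeasurable.tsum fun q => (hfm q).ennreal_ofReal.aemeasurable) hsum
  filter_upwards [hae] with ω hω
  have h0 := ENNReal.tendsto_atTop_zero_of_tsum_ne_top hω.ne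
  have h1 : Tendsto (fun q => f q ω) atTop (𝓝 0) := by
    have := (ENNReal.tendsto_toReal ENNReal.zero_ne_top).comp h0
    simpa [Function.comp_def, hf, ENNReal.toReal_ofReal (sq_nonneg _)] using this
  have h2 : Tendsto (fun q : ℕ => |S ((q + 1) ^ 2) ω / ((q + 1 : ℕ) : ℝ) ^ 2|) atTop (𝓝 0) := by
    have := (Real.continuous_sqrt.tendsto 0).comp h1
    simpa [Function.comp_def, hf, Real.sqrt_sq_eq_abs] using this
  have h3 : Tendsto (fun q : ℕ => |S (q ^ 2) ω / (q : ℝ) ^ 2|) atTop (𝓝 0) :=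
    (tendsto_add_atTop_iff_nat (f := fun q : ℕ => |S (q ^ 2) ω / (q : ℝ) ^ 2|) 1).1 h2
  have h4 : Tendsto (fun q : ℕ => |S (q ^ 2) ω / (q : ℝ) ^ 2| + 2 / (q : ℝ)) atTop (𝓝 0) := by
    simpa using h3.add (tendsto_const_div_atTop_nhds_zero_nat 2)
  have hsqrt : Tendsto Nat.sqrt atTop atTop := by
    refine tendsto_atTop_mono' _ (Filter.Eventually.of_forall fun K => le_rfl)
      (tendsto_atTop.2 fun B => ?_)
    filter_upwards [eventually_ge_atTop (B * B)] with K hK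
    exact Nat.le_sqrt.2 hK
  refine squeeze_zero_norm' ?_ (h4.comp hsqrt)
  filter_upwards [eventually_ge_atTop 1] with K hK
  -- Between `q²` and `K` there are at most `2 q` terms, which is negligible against `q²`.
  set q := Nat.sqrt K with hq
  have hq1 : 1 ≤ q := Nat.le_sqrt.2 (by simpa using hK)
  have hqK : q ^ 2 ≤ K := by rw [pow_two]; exact Nat.sqrt_le K
  have hKq : K ≤ q ^ 2 + 2 * q := by
    have := Nat.sqrt_le_add K
    rw [← hq] at this
    rw [pow_two]
    omega
  have hdiff : |S K ω - S (q ^ 2) ω| ≤ 2 * q := by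
    rw [hS]
    simp only
    rw [← Finset.sum_Ico_eq_sub _ hqK]
    calc |∑ l ∈ Finset.Ico (q ^ 2) K, X l ω| ≤ ∑ l ∈ Finset.Ico (q ^ 2) K, |X l ω| :=
          Finset.abs_sum_le_sum_abs _ _
      _ ≤ ∑ l ∈ Finset.Ico (q ^ 2) K, (1 : ℝ) := Finset.sum_le_sum fun l _ => hbd l ω
      _ = ((K - q ^ 2 : ℕ) : ℝ) := by simp
      _ ≤ ((2 * q : ℕ) : ℝ) := by
        exact_mod_cast (by omega : K - q ^ 2 ≤ 2 * q)
      _ = 2 * q := by push_cast; ring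
  have hq0 : (0 : ℝ) < q := by exact_mod_cast hq1
  have hqK' : (q : ℝ) ^ 2 ≤ K := by exact_mod_cast hqK
  have hK0 : (0 : ℝ) < K := by exact_mod_cast hK
  rw [Real.norm_eq_abs, abs_div, abs_of_pos hK0, Function.comp_apply, ← hq, abs_div,
    abs_of_pos (by positivity : (0 : ℝ) < (q : ℝ) ^ 2)]
  have htri : |S K ω| ≤ |S (q ^ 2) ω| + 2 * q := by
    have := abs_add_le (S K ω - S (q ^ 2) ω) (S (q ^ 2) ω)
    rw [sub_add_cancel] at this
    linarith
  calc |S K ω| / K ≤ (|S (q ^ 2) ω| + 2 * q) / K := by gcongr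
    _ ≤ (|S (q ^ 2) ω| + 2 * q) / (q : ℝ) ^ 2 := by gcongr
    _ = |S (q ^ 2) ω| / (q : ℝ) ^ 2 + 2 / q := by
      field_simp

/-- Law of large numbers for the `m`-step transitions of a Markov chain that start at the times of
an arithmetic progression. -/
lemma IsMarkovChain.ae_tendsto_average {Ω : Type*} [MeasurableSpace Ω] {μ : Measure Ω}
    [IsProbabilityMeasure μ] {n : ℕ} {P : Matrix (Fin n) (Fin n) ℝ}
    (hP : P ∈ Matrix.rowStochastic ℝ (Fin n)) {δ : ℕ → Ω → Fin n}
    (h : IsMarkovChain μ P δ) (hδ : ∀ k, Measurable (δ k)) {a m τ : ℕ} (ha : 1 ≤ a) (hm : m ≤ τ)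
    (f : Fin n → ℝ) (hf : ∀ i, |f i| ≤ 1) (j : Fin n) :
    ∀ᵐ ω ∂μ, Tendsto (fun K : ℕ => (∑ l ∈ Finset.range K, f (δ (a + τ * l) ω)
      * ((if δ (a + τ * l + m) ω = j then 1 else 0) - (P ^ m) (δ (a + τ * l) ω) j)) / K)
      atTop (𝓝 0) := by
  have hPm : P ^ m ∈ Matrix.rowStochastic ℝ (Fin n) := pow_mem hP m
  refine ae_tendsto_average_of_orthogonal (fun l => ?_) (fun l ω => ?_) fun l l' hll => ?_
  · refine ((measurable_of_finite f).comp (hδ _)).mul (Measurable.sub ?_ ?_)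
    · exact Measurable.ite (hδ _ (measurableSet_singleton _)) measurable_const measurable_const
    · exact (measurable_of_finite fun i => (P ^ m) i j).comp (hδ _)
  · rw [abs_mul]
    refine mul_le_one₀ (hf _) (abs_nonneg _) ?_
    have h0 := Matrix.nonneg_of_mem_rowStochastic hPm (i := δ (a + τ * l) ω) (j := j)
    have h1 := Matrix.le_one_of_mem_rowStochastic hPm (i := δ (a + τ * l) ω) (j := j)
    rw [abs_le]
    split_ifs <;> constructor <;> linarith
  -- Since `m ≤ τ`, the earlier transition is completed by the time the later one starts, so it
  -- belongs to the past in the Markov property.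
  · have hle : a + τ * l + m ≤ a + τ * l' := by
      have : τ * (l + 1) ≤ τ * l' := Nat.mul_le_mul_left _ hll
      rw [mul_add, mul_one] at this
      omega
    have hzero := h.integral_mul_sub_eq_zero hδ m (t := a + τ * l') (by omega) j
      (fun s => f (s (a + τ * l)) * ((if s (a + τ * l + m) = j then 1 else 0)
        - (P ^ m) (s (a + τ * l)) j) * f (s (a + τ * l'))) (by
        intro s s' hs
        have e1 := hs (a + τ * l) (Finset.mem_Icc.2 ⟨by omega, by omega⟩)
        have e2 := hs (a + τ * l + m) (Finset.mem_Icc.2 ⟨by omega, hle⟩)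
        have e3 := hs (a + τ * l') (Finset.mem_Icc.2 ⟨by omega, le_rfl⟩)
        simp only [e1, e2, e3])
    refine Eq.trans ?_ hzero
    refine integral_congr_ae (Filter.Eventually.of_forall fun ω => ?_)
    simp only
    ring

/-! ### Transition frequencies -/

/-- Every state of an irreducible aperiodic chain is visited with positive lower density along every
arithmetic progression of times. -/
lemma IsMarkovChain.exists_visits_lower_bound {Ω : Type*} [MeasurableSpace Ω] {μ : Measure Ω}
    [IsProbabilityMeasure μ] {n : ℕ} {P : Matrix (Fin n) (Fin n) ℝ}
    (hP : P ∈ Matrix.rowStochastic ℝ (Fin n)) (hirr : P.IsIrreducible) (haper : IsAperiodic P)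
    {δ : ℕ → Ω → Fin n} (h : IsMarkovChain μ P δ) (hδ : ∀ k, Measurable (δ k)) {a τ : ℕ}
    (ha : 1 ≤ a) (hτ : 1 ≤ τ) (i : Fin n) :
    ∃ c > 0, ∀ᵐ ω ∂μ, ∀ᶠ K : ℕ in atTop,
      c * (K : ℝ) ≤ ∑ l ∈ Finset.range K, if δ (a + τ * l) ω = i then (1 : ℝ) else 0 := by
  obtain ⟨m₀, hm₀⟩ := exists_forall_pow_pos hirr haper
  -- A nonzero factor for which all entries of `P ^ (τ * q)` are positive. The progression is
  -- thinned by `q`, so that each step has probability at least `c₀` of hitting `i`.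
  set q := m₀ + 1 with hq
  have hM : m₀ ≤ τ * q := by
    have : 1 * q ≤ τ * q := Nat.mul_le_mul_right q hτ
    omega
  have : Nonempty (Fin n) := ⟨i⟩
  obtain ⟨j₀, hj₀⟩ := Finite.exists_min fun j => (P ^ (τ * q)) j i
  set c₀ := (P ^ (τ * q)) j₀ i with hc₀
  have hc₀pos : 0 < c₀ := hm₀ _ hM j₀ i
  have hq0 : (0 : ℝ) < q := by positivity
  -- A factor `2` is lost in replacing `c₀` by `c₀ / 2` for large `L`, another in `K ≤ 2 q L`, and
  -- the factor `q` by the thinning.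
  refine ⟨c₀ / (4 * q), by positivity, ?_⟩
  filter_upwards [h.ae_tendsto_average hP hδ ha (le_refl (τ * q)) (fun _ => 1) (by simp) i]
    with ω hω
  have hev := hω.eventually_const_lt (show -(c₀ / 2) < 0 by linarith)
  obtain ⟨L₀, hL₀⟩ := eventually_atTop.1 hev
  filter_upwards [eventually_ge_atTop (q * (L₀ + 1) + 1 + 2 * q)] with K hK
  set L := (K - 1) / q with hL
  have hLL : L₀ + 1 ≤ L := by
    rw [hL, Nat.le_div_iff_mul_le (by omega), mul_comm]
    omega
  have hLK : q * L ≤ K - 1 := Nat.mul_div_le _ _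
  have hKL : K - 1 < q * L + q := by
    have := Nat.lt_mul_div_succ (K - 1) (show 0 < q by omega)
    rwa [mul_add, mul_one] at this
  have hLpos : (0 : ℝ) < L := by
    have : 0 < L := by omega
    exact_mod_cast this
  have h1 := hL₀ L (by omega)
  rw [lt_div_iff₀ hLpos] at h1
  have h2 : ∑ l ∈ Finset.range L, (fun _ => (1 : ℝ)) (δ (a + τ * q * l) ω)
      * ((if δ (a + τ * q * l + τ * q) ω = i then 1 else 0)
        - (P ^ (τ * q)) (δ (a + τ * q * l) ω) i)
      ≤ ∑ l ∈ Finset.range L, ((if δ (a + τ * (q * (l + 1))) ω = i then (1 : ℝ) else 0) - c₀) := by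
    refine Finset.sum_le_sum fun l _ => ?_
    rw [one_mul, show a + τ * q * l + τ * q = a + τ * (q * (l + 1)) by ring]
    exact sub_le_sub_left (hj₀ _) _
  rw [Finset.sum_sub_distrib, Finset.sum_const, Finset.card_range, nsmul_eq_mul] at h2
  have h3 : ∑ l ∈ Finset.range L, (if δ (a + τ * (q * (l + 1))) ω = i then (1 : ℝ) else 0)
      ≤ ∑ l ∈ Finset.range K, if δ (a + τ * l) ω = i then (1 : ℝ) else 0 := by
    have hinj : Set.InjOn (fun l => q * (l + 1)) (Finset.range L) := by
      intro l _ l' _ hll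
      have := Nat.eq_of_mul_eq_mul_left (show 0 < q by omega) hll
      omega
    rw [← Finset.sum_image (f := fun k => if δ (a + τ * k) ω = i then (1 : ℝ) else 0) hinj]
    refine Finset.sum_le_sum_of_subset_of_nonneg ?_ fun _ _ _ => by split_ifs <;> norm_num
    intro k hk
    obtain ⟨l, hl, rfl⟩ := Finset.mem_image.1 hk
    rw [Finset.mem_range] at hl ⊢
    have : q * (l + 1) ≤ q * L := Nat.mul_le_mul_left q hl
    omega
  have h4 : (K : ℝ) ≤ 2 * (q * L) := by
    have : K ≤ 2 * (q * L) := by omega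
    exact_mod_cast this
  calc c₀ / (4 * q) * K ≤ c₀ / (4 * q) * (2 * (q * L)) := by gcongr
    _ = c₀ / 2 * L := by field_simp; ring
    _ ≤ _ := by linarith

/-- Regrouping by the position `t` inside the snippet makes the times for each `t` an arithmetic
progression, to which the law of large numbers applies. -/
lemma transitionCount_cast {n nl : ℕ} (K : ℕ) (s : ℕ → ℕ → Fin n) (i j : Fin n) :
    (transitionCount K (fun l (t : Fin nl) => s l t) i j : ℝ)
      = ∑ t ∈ Finset.range (nl - 1), ∑ l ∈ Finset.range K,
        (if s l t = i then (1 : ℝ) else 0) * (if s l (t + 1) = j then 1 else 0) := by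
  rw [Finset.sum_comm, transitionCount, Nat.cast_sum]
  refine Finset.sum_congr rfl fun l _ => ?_
  have h : (Finset.univ.filter fun p : Fin nl × Fin nl =>
      (p.1 : ℕ) + 1 = (p.2 : ℕ) ∧ s l p.1 = i ∧ s l p.2 = j).card
      = ((Finset.range (nl - 1)).filter fun t => s l t = i ∧ s l (t + 1) = j).card := by
    refine Finset.card_bij (fun p _ => (p.1 : ℕ)) ?_ ?_ ?_
    · intro p hp
      rw [Finset.mem_filter] at hp ⊢
      obtain ⟨-, h1, h2, h3⟩ := hp
      have := p.2.2
      exact ⟨Finset.mem_range.2 (by omega), h2, by rwa [h1]⟩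
    · intro p hp p' hp' hpp
      rw [Finset.mem_filter] at hp hp'
      have h1 := hp.2.1
      have h2 := hp'.2.1
      have hpp' : (p.1 : ℕ) = (p'.1 : ℕ) := hpp
      ext
      · exact hpp'
      · omega
    · intro t ht
      rw [Finset.mem_filter, Finset.mem_range] at ht
      refine ⟨(⟨t, by omega⟩, ⟨t + 1, by omega⟩), ?_, rfl⟩
      rw [Finset.mem_filter]
      exact ⟨Finset.mem_univ _, rfl, ht.2⟩
  rw [h, Finset.card_filter, Nat.cast_sum]
  refine Finset.sum_congr rfl fun t _ => ?_
  by_cases h1 : s l t = i <;> by_cases h2 : s l (t + 1) = j <;> simp [h1, h2]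

/-- Law of large numbers for relative transition frequencies, in deterministic form. -/
lemma tendsto_transition_frequencies {n nl : ℕ} (hnl : 2 ≤ nl) (s : ℕ → ℕ → Fin n)
    (P : Matrix (Fin n) (Fin n) ℝ)
    (hvis : ∀ i, ∃ c > 0, ∀ᶠ K : ℕ in atTop,
      c * (K : ℝ) ≤ ∑ l ∈ Finset.range K, if s l 0 = i then (1 : ℝ) else 0)
    (havg : ∀ t < nl - 1, ∀ i j, Tendsto (fun K : ℕ => (∑ l ∈ Finset.range K,
      (if s l t = i then (1 : ℝ) else 0) * ((if s l (t + 1) = j then 1 else 0) - P (s l t) j)) / K)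
      atTop (𝓝 0)) (i : Fin n) :
    (∀ᶠ K in atTop, 0 < ∑ j, transitionCount K (fun l (t : Fin nl) => s l t) i j) ∧
      ∀ j, Tendsto (fun K => (transitionCount K (fun l (t : Fin nl) => s l t) i j : ℝ)
        / ∑ j, (transitionCount K (fun l (t : Fin nl) => s l t) i j : ℝ)) atTop (𝓝 (P i j)) := by
  obtain ⟨c, hc, hK⟩ := hvis i
  set m : ℕ → Fin n → ℕ := fun K j => transitionCount K (fun l (t : Fin nl) => s l t) i j with hm
  have hrow : ∀ K, ∑ j, (m K j : ℝ) = ∑ t ∈ Finset.range (nl - 1), ∑ l ∈ Finset.range K,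
      if s l t = i then (1 : ℝ) else 0 := by
    intro K
    simp only [hm, transitionCount_cast]
    rw [Finset.sum_comm]
    refine Finset.sum_congr rfl fun t _ => ?_
    rw [Finset.sum_comm]
    refine Finset.sum_congr rfl fun l _ => ?_
    rw [← Finset.mul_sum]
    simp
  have hlow : ∀ᶠ K : ℕ in atTop, c * (K : ℝ) ≤ ∑ j, (m K j : ℝ) := by
    filter_upwards [hK] with K h1
    refine h1.trans ?_
    rw [hrow]
    exact Finset.single_le_sum (f := fun t => ∑ l ∈ Finset.range K, if s l t = i then (1 : ℝ) else 0)
      (fun t _ => Finset.sum_nonneg fun l _ => by split_ifs <;> norm_num)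
      (Finset.mem_range.2 (by omega : 0 < nl - 1))
  have hpos : ∀ᶠ K : ℕ in atTop, 0 < ∑ j, (m K j : ℝ) := by
    filter_upwards [hlow, eventually_ge_atTop 1] with K h1 h2
    have : (0 : ℝ) < K := by exact_mod_cast h2
    exact lt_of_lt_of_le (by positivity) h1
  refine ⟨hpos.mono fun K h => by exact_mod_cast h, fun j => ?_⟩
  -- The numerator of the frequency error. It is `o(K)` by `havg`, while the row total is at least
  -- `c K`, already from the first positions of the snippets.
  set E : ℕ → ℝ := fun K => m K j - P i j * ∑ j, (m K j : ℝ) with hE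
  have hEeq : ∀ K, E K = ∑ t ∈ Finset.range (nl - 1), ∑ l ∈ Finset.range K,
      (if s l t = i then (1 : ℝ) else 0)
        * ((if s l (t + 1) = j then 1 else 0) - P (s l t) j) := by
    intro K
    rw [hE]
    simp only
    rw [hrow, hm]
    simp only
    rw [transitionCount_cast, Finset.mul_sum, ← Finset.sum_sub_distrib]
    refine Finset.sum_congr rfl fun t _ => ?_
    rw [Finset.mul_sum, ← Finset.sum_sub_distrib]
    refine Finset.sum_congr rfl fun l _ => ?_
    by_cases h1 : s l t = i <;> simp [h1]
  have hElim : Tendsto (fun K : ℕ => |E K / K| / c) atTop (𝓝 0) := by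
    have h1 : Tendsto (fun K : ℕ => E K / K) atTop (𝓝 0) := by
      simp_rw [hEeq, Finset.sum_div]
      have := tendsto_finsetSum (Finset.range (nl - 1)) fun t ht =>
        havg t (Finset.mem_range.1 ht) i j
      simpa [Finset.sum_div] using this
    simpa using h1.abs.div_const c
  rw [tendsto_iff_norm_sub_tendsto_zero]
  refine squeeze_zero' (Filter.Eventually.of_forall fun K => norm_nonneg _) ?_ hElim
  filter_upwards [hlow, hpos, eventually_ge_atTop 1] with K h1 h2 h3
  have hK0 : (0 : ℝ) < K := by exact_mod_cast h3
  have h4 : (m K j : ℝ) / ∑ j, (m K j : ℝ) - P i j = E K / ∑ j, (m K j : ℝ) := by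
    rw [hE]
    field_simp
  rw [h4, Real.norm_eq_abs, abs_div, abs_of_pos h2, abs_div, abs_of_pos hK0, div_div, mul_comm _ c]
  exact div_le_div_of_nonneg_left (abs_nonneg _) (by positivity) h1

/-! ### Preparations for the theorem and its proof. -/

lemma IsTrajectory.paramVec_dotProduct_regressor {na nc n : ℕ} {a : Fin n → Fin na → ℝ}
    {c : Fin n → Fin nc → ℝ} {u : ℤ → ℝ} {δ : ℕ → Fin n} {x : ℤ → ℝ}
    (h : IsTrajectory a c u δ x) {k : ℕ} (hk : 1 ≤ k) :
    paramVec (a (δ k)) (c (δ k)) ⬝ᵥ regressor na nc x u k = 0 := by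
  have := h k hk
  rw [dotProduct, Fintype.sum_sum_type, Fin.sum_univ_succ]
  simp only [paramVec, regressor, Sum.elim_inl, Sum.elim_inr, Fin.cons_zero, Fin.cons_succ,
    Fin.val_zero, Fin.val_succ, Nat.cast_zero, sub_zero]
  have e : ∀ j : Fin na, (k : ℤ) - (((j : ℕ) + 1 : ℕ) : ℤ) = (k : ℤ) - 1 - (j : ℕ) := by
    intro j
    push_cast
    ring
  simp_rw [e]
  linarith

/-- The kernel shrinks as data are added but always contains `prodCoeff b`, so once it is a line it
stays that line. -/
lemma finrank_ker_momentMatrix_eq_one {na nc n N₀ N : ℕ} (hN : N₀ < N)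
    {b : Fin n → RegIdx na nc → ℝ} {x u : ℤ → ℝ} {δ : ℕ → Fin n}
    (head : ∀ i, b i (Sum.inl 0) = -1)
    (active : ∀ k : ℕ, 1 ≤ k → b (δ k) ⬝ᵥ regressor na nc x u k = 0)
    (hker : Module.finrank ℝ (LinearMap.ker (momentMatrix na nc n N₀ x u).mulVecLin) = 1) :
    Module.finrank ℝ (LinearMap.ker (momentMatrix na nc n N x u).mulVecLin) = 1 := by
  have hN1 : 1 ≤ N := by omega
  have hc0 : prodCoeff b ≠ 0 := prodCoeff_ne_zero fun i => by simp [head]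
  have hc : momentMatrix na nc n N x u *ᵥ prodCoeff b = 0 := by
    rw [momentMatrix_mulVec_eq_zero_iff hN1]
    intro k hk
    rw [prodCoeff_dotProduct_veronese]
    exact Finset.prod_eq_zero (Finset.mem_univ (δ k)) (active k (Finset.mem_Icc.1 hk).1)
  refine (finrank_eq_one_iff_of_nonzero'
    (⟨prodCoeff b, by simpa using hc⟩ : LinearMap.ker (momentMatrix na nc n N x u).mulVecLin)
    (by simpa using hc0)).2 fun w => ?_
  have hw : momentMatrix na nc n N x u *ᵥ w.1 = 0 := w.2
  obtain ⟨κ, hκ⟩ := exists_smul_of_finrank_ker hker (momentMatrix_mulVec_mono hN1 hN.le x u hc) hc0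
    (momentMatrix_mulVec_mono hN1 hN.le x u hw)
  exact ⟨κ, Subtype.ext hκ.symm⟩

lemma tendsto_snippetCount {na nl : ℕ} (hnl : 2 ≤ nl) :
    Tendsto (fun N => snippetCount na nl N) atTop atTop := by
  refine tendsto_atTop.2 fun B => ?_
  filter_upwards [eventually_ge_atTop ((B + (na + nl)) * (na + nl))] with N hN
  have := (Nat.le_div_iff_mul_le (show 0 < na + nl by omega)).2 hN
  unfold snippetCount
  omega

end SwitchedAR

theorem theorem1
    {Ω : Type*} [MeasurableSpace Ω] (μ : Measure Ω) [IsProbabilityMeasure μ]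
    (na nc n nl : ℕ) (hnl : 2 ≤ nl)
    -- the submodels and the bounded input
    (a : Fin n → Fin na → ℝ) (c : Fin n → Fin nc → ℝ)
    (u : ℤ → ℝ) (hu : ∃ U : ℝ, ∀ k, |u k| ≤ U)
    -- the switching sequence
    (P : Matrix (Fin n) (Fin n) ℝ) (hP : P ∈ Matrix.rowStochastic ℝ (Fin n))
    (hirr : P.IsIrreducible) (haper : SwitchedAR.IsAperiodic P)
    (δ : ℕ → Ω → Fin n) (hδ_meas : ∀ k, Measurable (δ k))
    (hδ : SwitchedAR.IsMarkovChain μ P δ)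
    -- the noise-free output
    (x : ℤ → Ω → ℝ) (hx_meas : ∀ k, Measurable (x k))
    (hx : ∀ ω, SwitchedAR.IsTrajectory a c u (fun k => δ k ω) (fun k => x k ω))
    (hx_bdd : ∃ L : ℝ, ∀ᵐ ω ∂μ, ∀ k : ℕ, 1 ≤ k → |x k ω| ≤ L)
    -- the normalized measurement noise; at noise level `σ` the output is `y_k = x_k + σ ξ_k`
    (ξ : ℤ → Ω → ℝ) (hξ_law : ∀ k, HasLaw (ξ k) (gaussianReal 0 1) μ)
    (hξ_indep : iIndepFun ξ μ)
    (hξ_indep_sys : IndepFun (fun ω (k : ℤ) => ξ k ω)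
      (fun ω => ((fun k : ℕ => δ k ω), (fun k : ℤ => x k ω))) μ)
    -- mild assumptions: the active submodel is the only one that explains the noise-free data
    (hdisc : ∀ᵐ ω ∂μ, ∀ k : ℕ, 1 ≤ k → ∀ i : Fin n, i ≠ δ k ω →
      SwitchedAR.paramVec (a i) (c i) ⬝ᵥ
        SwitchedAR.regressor na nc (fun m => x m ω) u k ≠ 0)
    -- and the noise-free data determine the product of the submodels
    (hnull : ∀ᵐ ω ∂μ, ∃ N : ℕ, Module.finrank ℝ (LinearMap.ker (Matrix.mulVecLin
      (SwitchedAR.momentMatrix na nc n N (fun m => x m ω) u))) = 1)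
    -- tuning constants
    (σmax : ℝ) (hσmax : 0 < σmax) (ε : ℝ) (hε : 0 < ε)
    -- estimate computed from `N` measurements at noise level `σ`, all ties broken arbitrarily
    (Phat : ℕ → ℝ → Ω → Matrix (Fin n) (Fin n) ℝ)
    (hPhat : ∀ (N : ℕ) (σ : ℝ) (ω : Ω), 0 < σ →
      (∃ (b : Fin n → SwitchedAR.RegIdx na nc → ℝ) (Q : Matrix (Fin n) (Fin n) ℝ),
        SwitchedAR.IsEstimate nl N σmax ε (fun k => x k ω + σ * ξ k ω) u b Q) →
      ∃ b : Fin n → SwitchedAR.RegIdx na nc → ℝ,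
        SwitchedAR.IsEstimate nl N σmax ε (fun k => x k ω + σ * ξ k ω) u b (Phat N σ ω) ∧
        SwitchedAR.IsNumberedLike (fun i => SwitchedAR.paramVec (a i) (c i)) b) :
    ∀ᵐ ω ∂μ, ∃ ℓ : ℕ → ℝ,
      (∀ᶠ N in atTop,
        Tendsto (fun σ => SwitchedAR.frobNorm (Phat N σ ω - P)) (𝓝[>] 0) (𝓝 (ℓ N))) ∧
      Tendsto ℓ atTop (𝓝 0) := by
  classical
  set b : Fin n → SwitchedAR.RegIdx na nc → ℝ := fun i => SwitchedAR.paramVec (a i) (c i) with hb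
  have head : ∀ i, b i (Sum.inl 0) = -1 := fun i => rfl
  have active : ∀ ω, ∀ k : ℕ, 1 ≤ k →
      b (δ k ω) ⬝ᵥ SwitchedAR.regressor na nc (fun m => x m ω) u k = 0 := fun ω k hk =>
    (hx ω).paramVec_dotProduct_regressor hk
  have hindep : IndepFun (fun ω (k : ℤ) => ξ k ω) (fun ω (k : ℤ) => x k ω) μ :=
    hξ_indep_sys.comp measurable_id measurable_snd
  have hdet := SwitchedAR.ae_eventually_det_ne_zero (n := n) head hx_meas active hξ_law hξ_indep
    hindep
  have hvis : ∀ i, ∃ c > 0, ∀ᵐ ω ∂μ, ∀ᶠ K : ℕ in atTop, c * (K : ℝ) ≤ ∑ l ∈ Finset.range K,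
      if δ (SwitchedAR.snippetStart na nl l + 0) ω = i then (1 : ℝ) else 0 := fun i =>
    hδ.exists_visits_lower_bound hP hirr haper hδ_meas (a := na + 1) (τ := na + nl) (by omega)
      (by omega) i
  choose cvis hcvis hvis using hvis
  have havg : ∀ᵐ ω ∂μ, ∀ t : ℕ, t < nl - 1 → ∀ i j, Tendsto (fun K : ℕ => (∑ l ∈ Finset.range K,
      (if δ (SwitchedAR.snippetStart na nl l + t) ω = i then (1 : ℝ) else 0)
        * ((if δ (SwitchedAR.snippetStart na nl l + (t + 1)) ω = j then 1 else 0)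
          - P (δ (SwitchedAR.snippetStart na nl l + t) ω) j)) / K) atTop (𝓝 0) := by
    refine ae_all_iff.2 fun t => ?_
    by_cases ht : t < nl - 1
    · have h1 : ∀ i j, ∀ᵐ ω ∂μ, Tendsto (fun K : ℕ => (∑ l ∈ Finset.range K,
          (if δ (SwitchedAR.snippetStart na nl l + t) ω = i then (1 : ℝ) else 0)
          * ((if δ (SwitchedAR.snippetStart na nl l + (t + 1)) ω = j then 1 else 0)
            - P (δ (SwitchedAR.snippetStart na nl l + t) ω) j)) / K) atTop (𝓝 0) := by
        intro i j
        -- One-step transitions from position `t` of all snippets; `t < nl - 1` is already excluded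
        -- from overlap because the step `na + nl` is at least `1`.
        filter_upwards [hδ.ae_tendsto_average hP hδ_meas (a := na + 1 + t) (m := 1) (τ := na + nl)
          (by omega) (by omega) (fun s => if s = i then 1 else 0)
          (fun s => by split_ifs <;> simp) j] with ω hω
        refine hω.congr fun K => ?_
        congr 1
        refine Finset.sum_congr rfl fun l _ => ?_
        rw [pow_one, show na + 1 + t + (na + nl) * l = SwitchedAR.snippetStart na nl l + t by
          unfold SwitchedAR.snippetStart; ring, add_assoc _ t 1]
      filter_upwards [ae_all_iff.2 fun i => ae_all_iff.2 (h1 i)] with ω hω _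
      exact hω
    · exact Filter.Eventually.of_forall fun ω h => absurd h ht
  filter_upwards [hdisc, hnull, hdet, ae_all_iff.2 hvis, havg] with ω hdisc hnull hdet hvis havg
  obtain ⟨N₀, hN₀⟩ := hnull
  set s : ℕ → ℕ → Fin n := fun l t => δ (SwitchedAR.snippetStart na nl l + t) ω with hs
  set m : ℕ → Fin n → Fin n → ℕ := fun N => SwitchedAR.transitionCount
    (SwitchedAR.snippetCount na nl N) (fun l (t : Fin nl) => s l t) with hm
  have hfreq := SwitchedAR.tendsto_transition_frequencies hnl s P
    (fun i => ⟨cvis i, hcvis i, hvis i⟩) havg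
  have hK := SwitchedAR.tendsto_snippetCount (na := na) hnl
  have hrow : ∀ᶠ N in atTop, ∀ i, 0 < ∑ j, m N i j :=
    Filter.eventually_all.2 fun i => hK.eventually (hfreq i).1
  set R : ℕ → Matrix (Fin n) (Fin n) ℝ := fun N =>
    Matrix.of fun i j => (m N i j : ℝ) / ∑ j, (m N i j : ℝ) with hR
  have hRlim : ∀ i j, Tendsto (fun N => R N i j) atTop (𝓝 (P i j)) := fun i j =>
    ((hfreq i).2 j).comp hK
  -- Positive lower density implies at least one visit to every state.
  have htime : ∀ i, ∃ k : ℕ, 1 ≤ k ∧ δ k ω = i := by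
    intro i
    obtain ⟨K, h1, h2⟩ := ((hvis i).and (eventually_ge_atTop 1)).exists
    have h3 : (0 : ℝ) < K := by exact_mod_cast h2
    have h4 : (0 : ℝ) < cvis i * K := mul_pos (hcvis i) h3
    obtain ⟨l, -, hl⟩ := Finset.exists_ne_zero_of_sum_ne_zero (h4.trans_le h1).ne'
    refine ⟨SwitchedAR.snippetStart na nl l, by unfold SwitchedAR.snippetStart; omega, ?_⟩
    by_contra hne
    exact hl (if_neg hne)
  choose κ hκ1 hκ using htime
  -- The inner limit is the error of the true transition frequencies: for small `σ` the estimate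
  -- equals `R N`.
  refine ⟨fun N => SwitchedAR.frobNorm (R N - P), ?_, ?_⟩
  -- `N` must exceed `N₀` strictly, since the nonsingularity argument perturbs output `N₀ + 1`. The
  -- sum of the `κ i` bounds a time by which every submodel has been active.
  · filter_upwards [hrow, eventually_gt_atTop N₀, eventually_ge_atTop (∑ i, κ i)] with N hrow hN hvisN
    have hid : SwitchedAR.IsIdentifiable N b (fun k => x k ω) u (fun k => ξ k ω)
        (fun k => δ k ω) :=
      { one_le := by omega
        head := head
        active := active ω
        inactive := hdisc
        visits := fun i => ⟨κ i, Finset.mem_Icc.2 ⟨hκ1 i,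
          (Finset.single_le_sum (fun _ _ => Nat.zero_le _) (Finset.mem_univ i)).trans hvisN⟩, hκ i⟩
        finrank_ker := SwitchedAR.finrank_ker_momentMatrix_eq_one hN head (active ω) hN₀
        det_ne_zero := hdet N₀ N hN hN₀ }
    refine Tendsto.congr' ?_ tendsto_const_nhds
    filter_upwards [hid.eventually_isEstimate hσmax hε nl, self_mem_nhdsWithin] with σ hσ hσpos
    obtain ⟨b', hest, hnum⟩ := hPhat N σ ω hσpos hσ.1
    have hMLE := hσ.2 b' _ hest hnum
    congr 2
    ext i j
    exact (hMLE.eq_div hrow i j).symm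
  · have hlim : Tendsto (fun N => Real.sqrt (∑ i, ∑ j, (R N - P) i j ^ 2)) atTop
        (𝓝 (Real.sqrt (∑ i : Fin n, ∑ j : Fin n, (P i j - P i j) ^ 2))) :=
      (Real.continuous_sqrt.tendsto _).comp (tendsto_finsetSum _ fun i _ =>
        tendsto_finsetSum _ fun j _ => ((hRlim i j).sub_const (P i j)).pow 2)
    simpa [SwitchedAR.frobNorm] using hlim
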